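/- Let $\mathcal A$ be the algebra of differential superpolynomials over $\mathbb C$ in even fields $v,w$ and odd fields $\alpha,\beta$, i.e. the free supercommutative algebra on the jets $u_i^{(k)}$ ($k\ge 0$) of $u=(v,w,\alpha,\beta)^T$, with the even derivation $\partial=\partial_x$, $\partial u_i^{(k)}=u_i^{(k+1)}$. Functionals $\int h\,dx$ are classes of $h\in\mathcal A$ modulo $\partial\mathcal A$, and $\frac{\delta}{\delta u_i}\int h\,dx=\sum_k(-\partial)^k\big(h\,\overleftarrow{\partial}/\partial u_i^{(k)}\big)$ (right derivatives). Let $$M=\begin{pmatrix}-\lambda+\frac v2&1&\alpha\\-2w-2&\lambda-\frac v2&\beta\\ \beta&-\alpha&0\end{pmatrix},\qquad N=\sum_{m\ge0}N_m\lambda^{-m},\quad N_m=\begin{pmatrix}a_m&b_m&\rho_m\\-2b_m+2c_m&-a_m&\delta_m\\ \delta_m&-\rho_m&0\end{pmatrix},$$ with $a_m,b_m,c_m\in\mathcal A$ even and $\rho_m,\delta_m\in\mathcal A$ odd. Fix $0\ne k_0\in\mathbb C$ and call $N$ a solution if $N_x=[M,N]$, $a_0=k_0$ and $b_0=c_0=\rho_0=\delta_0=0$;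 a solution is determined up to the integration constants in $a_1,a_2,\dots$. Put $G_n=(a_n,-2b_n,-2\delta_n,2\rho_n)^T$, $\mathrm{Str}\,X=X_{11}+X_{22}-X_{33}$ and $N^{(n)}=\sum_{m=0}^nN_m\lambda^{n-m}+b_{n+1}\,\mathrm{diag}(1,-1,0)$. The $n$-th flow ($n\ge0$) of the super generalized Broer--Kaup (gBK) hierarchy is the derivation $\partial_{t_n}$ of $\mathcal A$ that commutes with $\partial$ and satisfies $M_{t_n}-N^{(n)}_x+[M,N^{(n)}]=0$. Let $$J=\begin{pmatrix}0&-\partial&0&0\\-\partial&0&-\frac12\alpha&\frac12\beta\\0&-\frac12\alpha&0&-\frac12\\0&\frac12\beta&-\frac12&0\end{pmatrix},$$ $$\mathcal L=\begin{pmatrix}\frac12\partial^{-1}v\partial+\frac12\partial&\frac12\partial^{-1}w\partial+\frac12w+1&-\frac12\partial^{-1}\alpha\partial+\frac14\alpha&-\frac12\partial^{-1}\beta\partial-\frac14\beta\\2&-\frac12\partial+\frac12v&0&\alpha\\2\beta-2\alpha\partial&-2\alpha(w+1)&\partial+\frac12v&\alpha\beta-(2w+2)\\-2\alpha&\beta&-1&-\partial+\frac12v\end{pmatrix},$$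 $$R=\begin{pmatrix}-2\partial&\frac12\partial^2-\frac12\partial v&0&-\partial\alpha\\-\frac12v\partial-\frac12\partial^2&-\frac12w\partial-\frac12\partial w-\partial&R_1&R_2\\0&\frac14\alpha\partial-\frac14v\alpha-\frac12\beta&\frac12&\frac12\partial-\frac14v\\ \alpha\partial&-\frac14\beta\partial+(w+1)\alpha+\frac14v\beta&-\frac12\partial-\frac14v&(w+1)-\alpha\beta\end{pmatrix},$$ $R_1=-\frac14\partial\alpha-\frac14v\alpha-\frac12\beta$, $R_2=\frac14\partial\beta+(w+1)\alpha+\frac14v\beta$ (products of operators, e.g. $\partial v$ is $f\mapsto(vf)_x$). When $\mathcal L$ is applied to a vector over $\mathcal A$, $\partial^{-1}$ denotes an arbitrary antiderivative of the sum it acts on. Then: 1. $J\mathcal L=R$ as matrices of formal (pseudo)differential operators, and $J$, $R$ are compatible super-Hamiltonian operators: for all $c_1,c_2\in\mathbb C$ the bracket $\{\int f,\int g\}=\int(\delta f/\delta u)^T(c_1J+c_2R)(\delta g/\delta u)\,dx$ of even functionals is even, skew-symmetric and satisfies the Jacobi identity. 2. There is exactly one solution $N$ for which $\mathrm{Str}(N^2)$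 is independent of $\lambda$, i.e. $\mathrm{Str}(N^2)=2k_0^2$ (normalized integration constants). For it the super-trace identity holds with $\gamma=0$, coefficientwise in $\lambda$: $$\frac{\delta}{\delta u}\int\mathrm{Str}\Big(N\frac{\partial M}{\partial\lambda}\Big)dx=\frac{\partial}{\partial\lambda}\mathrm{Str}\Big(N\frac{\partial M}{\partial u}\Big).$$ 3. For this $N$ put $\tilde H_n=\int\frac{2a_{n+1}}n\,dx$ for $n\ge1$ and $\tilde H_0=\int k_0v\,dx$. For every $n\ge0$: $\delta\tilde H_n/\delta u=G_n$; the $n$-th flow exists, is unique and is $$u_{t_n}=\begin{pmatrix}2b_{n+1,x}\\-a_{n+1,x}+\alpha\delta_{n+1}+\beta\rho_{n+1}\\ \alpha b_{n+1}-\rho_{n+1}\\-\beta b_{n+1}+\delta_{n+1}\end{pmatrix};$$ moreover $\delta\tilde H_{n+1}/\delta u$ is a value of $\mathcal L\,\delta\tilde H_n/\delta u$, and $$u_{t_n}=J\frac{\delta\tilde H_{n+1}}{\delta u}=J\mathcal L\frac{\delta\tilde H_n}{\delta u}=R\frac{\delta\tilde H_n}{\delta u}.$$ 4. For any other integration constants,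 i.e. any solution $N'$, there are constants $f_0=1,f_1,f_2,\dots\in\mathbb C$ with $N'=\big(\sum_jf_j\lambda^{-j}\big)N$. With $K_n=\sum_{j=0}^nf_j\tilde H_{n-j}$, for every $n\ge0$: $\delta K_n/\delta u=G'_n$, the $n$-th flow of $N'$ exists and is unique, $\delta K_{n+1}/\delta u$ is a value of $\mathcal L\,\delta K_n/\delta u$, and $u_{t_n}=J\,\delta K_{n+1}/\delta u=J\mathcal L\,\delta K_n/\delta u=R\,\delta K_n/\delta u$. The formula $\delta\tilde H'_n/\delta u=G'_n$ with $\tilde H'_n=\int\frac{2a'_{n+1}}n\,dx$ holds for all $n\ge1$ if and only if $N'$ is normalized as in 2. -/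

import Mathlib

namespace SuperGBK

noncomputable section

/-! ### Differential superpolynomials -/

/-- The Koszul sign `(-1)^{|i||j|}` of two fields with parities `odd i`, `odd j`. -/
def koszul {ι : Type} (odd : ι → Bool) (i j : ι) : ℂ := if odd i && odd j then -1 else 1

/-- The relations `x y = (-1)^{|x||y|} y x` between the jet variables `x = u_i^{(k)}`, encoded as
pairs `(i, k)` (in particular `x² = 0` for odd `x`). -/
inductive JetRel {ι : Type} (odd : ι → Bool) :
    FreeAlgebra ℂ (ι × ℕ) → FreeAlgebra ℂ (ι × ℕ) → Prop
  | comm (x y : ι × ℕ) : JetRel odd (FreeAlgebra.ι ℂ x * FreeAlgebra.ι ℂ y)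
      (koszul odd x.1 y.1 • (FreeAlgebra.ι ℂ y * FreeAlgebra.ι ℂ x))

/-- The free supercommutative complex algebra on the jet variables `u_i^{(k)}`, `i : ι`, `k : ℕ`:
polynomials in the even jets tensored with the Grassmann algebra on the odd jets. -/
def JetAlg {ι : Type} (odd : ι → Bool) : Type := RingQuot (JetRel odd)

instance {ι : Type} (odd : ι → Bool) : Ring (JetAlg odd) :=
  inferInstanceAs (Ring (RingQuot (JetRel odd)))

instance {ι : Type} (odd : ι → Bool) : Algebra ℂ (JetAlg odd) :=
  inferInstanceAs (Algebra ℂ (RingQuot (JetRel odd)))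

namespace JetAlg

variable {ι : Type} {odd : ι → Bool}

/-- The jet variable `u_i^{(k)}`, for `x = (i, k)`. -/
def gen (odd : ι → Bool) (x : ι × ℕ) : JetAlg odd :=
  RingQuot.mkAlgHom ℂ (JetRel odd) (FreeAlgebra.ι ℂ x)

theorem gen_mul_gen (x y : ι × ℕ) :
    gen odd x * gen odd y = koszul odd x.1 y.1 • (gen odd y * gen odd x) := by
  have h := RingQuot.mkAlgHom_rel ℂ (JetRel.comm (odd := odd) x y)
  rw [map_mul, map_smul, map_mul] at h
  exact h

/-- The universal property of the free supercommutative algebra. -/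
def lift {B : Type} [Ring B] [Algebra ℂ B] (f : ι × ℕ → B)
    (hf : ∀ x y, f x * f y = koszul odd x.1 y.1 • (f y * f x)) : JetAlg odd →ₐ[ℂ] B :=
  RingQuot.liftAlgHom ℂ ⟨FreeAlgebra.lift ℂ f, by
    rintro _ _ ⟨x, y⟩
    simpa using hf x y⟩

@[simp] theorem lift_gen {B : Type} [Ring B] [Algebra ℂ B] (f : ι × ℕ → B)
    (hf : ∀ x y, f x * f y = koszul odd x.1 y.1 • (f y * f x)) (x : ι × ℕ) :
    lift f hf (gen odd x) = f x := by
  unfold lift gen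
  erw [RingQuot.liftAlgHom_mkAlgHom_apply]
  simp

/-- The parity automorphism: `+1` on even elements, `-1` on odd elements. -/
def parity (odd : ι → Bool) : JetAlg odd →ₐ[ℂ] JetAlg odd :=
  lift (fun x => (if odd x.1 then (-1 : ℂ) else 1) • gen odd x) (by
    intro x y
    simp only [smul_mul_smul_comm, gen_mul_gen x y]
    simp only [smul_smul]
    congr 1
    ring)

def IsEven (f : JetAlg odd) : Prop := parity odd f = f

def IsOdd (f : JetAlg odd) : Prop := parity odd f = -f

/-- `f ↦ [[f, ∂f], [0, f]]` as an algebra homomorphism, where `∂ u_i^{(k)} = u_i^{(k+1)}`. -/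
def totalHom (odd : ι → Bool) : JetAlg odd →ₐ[ℂ] Matrix (Fin 2) (Fin 2) (JetAlg odd) :=
  lift (fun x => !![gen odd x, gen odd (x.1, x.2 + 1); 0, gen odd x]) (by
    intro x y
    have h1 := gen_mul_gen (odd := odd) x y
    have h2 := gen_mul_gen (odd := odd) x (y.1, y.2 + 1)
    have h3 := gen_mul_gen (odd := odd) (x.1, x.2 + 1) y
    ext i j
    fin_cases i <;> fin_cases j <;>
      simp [h1, h2, h3, Matrix.mul_apply, add_comm])

/-- The total derivative `∂ = d/dx`: the even derivation with `∂ u_i^{(k)} = u_i^{(k+1)}`. -/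
def D (odd : ι → Bool) : JetAlg odd →ₗ[ℂ] JetAlg odd :=
  Matrix.entryLinearMap ℂ (JetAlg odd) 0 1 ∘ₗ (totalHom odd).toLinearMap

theorem koszul_comm (i j : ι) : koszul odd i j = koszul odd j i := by
  simp [koszul, Bool.and_comm]

theorem koszul_mul_self (i j : ι) : koszul odd i j * koszul odd i j = 1 := by
  unfold koszul; split <;> norm_num

/-- `f ↦ [[f, f ∂/∂z], [0, σ_z f]]` as an algebra homomorphism, where `f ∂/∂z` is the right partial
derivative by the jet variable `z` and `σ_z` multiplies a jet variable `x` by `(-1)^{|z||x|}`. -/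
def pdHom [DecidableEq ι] (odd : ι → Bool) (z : ι × ℕ) :
    JetAlg odd →ₐ[ℂ] Matrix (Fin 2) (Fin 2) (JetAlg odd) :=
  lift (fun x => !![gen odd x, if x = z then 1 else 0; 0, koszul odd z.1 x.1 • gen odd x]) (by
    intro x y
    have h1 := gen_mul_gen (odd := odd) x y
    have h2 := koszul_comm (odd := odd) x.1 y.1
    have h3 := koszul_mul_self (odd := odd) x.1 y.1
    ext i j
    fin_cases i <;> fin_cases j
    · by_cases hy : y = z
      · subst hy
        simpa [Matrix.mul_apply] using h1
      · simpa [Matrix.mul_apply, hy] using h1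
    · by_cases hx : x = z <;> by_cases hy : y = z
      · subst hx; subst hy
        simp [Matrix.mul_apply, smul_smul, h3, add_comm]
      · subst hx
        simp [Matrix.mul_apply, hy]
      · subst hy
        simp [Matrix.mul_apply, hx, smul_smul, ← h2, h3]
      · simp [Matrix.mul_apply, hx, hy]
    · simp [Matrix.mul_apply]
    · simp [Matrix.mul_apply, h1, smul_smul]
      congr 1
      ring)

/-- The right partial derivative by the jet variable `z = u_i^{(k)}`: it is linear, takes `z` to `1`
and the other jet variables to `0`, and
`(f g) ∂/∂z = f (g ∂/∂z) + (-1)^{|z||g|} (f ∂/∂z) g`. -/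
def pd [DecidableEq ι] (odd : ι → Bool) (z : ι × ℕ) : JetAlg odd →ₗ[ℂ] JetAlg odd :=
  Matrix.entryLinearMap ℂ (JetAlg odd) 0 1 ∘ₗ (pdHom odd z).toLinearMap

/-- The variational derivative `δ/δu_i ∫ h dx = ∑_k (-∂)^k (h ∂/∂u_i^{(k)})` (a finite sum), so that
the first variation of `∫ h dx` is `∫ ∑_i (δ/δu_i ∫ h dx) δu_i dx`. -/
def euler [DecidableEq ι] (odd : ι → Bool) (i : ι) (h : JetAlg odd) : JetAlg odd :=
  ∑ᶠ k : ℕ, ((-D odd) ^ k : Module.End ℂ (JetAlg odd)) (pd odd (i, k) h)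

end JetAlg

open JetAlg

/-! ### The fields `u = (v, w, α, β)` -/

/-- The fields are numbered `v = 0`, `w = 1` (even), `α = 2`, `β = 3` (odd). -/
def oddField : Fin 4 → Bool := ![false, false, true, true]

/-- Differential superpolynomials in `v, w, α, β`. -/
abbrev Alg : Type := JetAlg oddField

/-- The field `u_i` itself. -/
def field (i : Fin 4) : Alg := gen oddField (i, 0)

abbrev fv : Alg := field 0
abbrev fw : Alg := field 1
abbrev fα : Alg := field 2
abbrev fβ : Alg := field 3

/-- `∂ = d/dx`. -/
abbrev dx : Module.End ℂ Alg := D oddField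

/-- The variational gradient `δ/δu ∫ h dx`. -/
def grad (h : Alg) : Fin 4 → Alg := fun i => euler oddField i h

/-! ### Matrix differential operators

`mul` interprets functions as multiplication operators, `d` is `∂` and `dinv` is `∂⁻¹`; products
are compositions. -/

section Operators

variable {E : Type} [Ring E] [Algebra ℂ E] (mul : Alg →ₐ[ℂ] E) (d dinv : E)

/-- The operator `J`. -/
def opJ : Matrix (Fin 4) (Fin 4) E :=
  let α := mul fα
  let β := mul fβ
  let h : ℂ := 1 / 2
  !![0, -d, 0, 0;
     -d, 0, -(h • α), h • β;
     0, -(h • α), 0, -(h • 1);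
     0, h • β, -(h • 1), 0]

/-- The row `ℓ = ½ (v∂, w∂, -α∂, -β∂)`, on which `∂⁻¹` acts in the recursion operator. -/
def recRow : Fin 4 → E :=
  let h : ℂ := 1 / 2
  ![h • (mul fv * d), h • (mul fw * d), -(h • (mul fα * d)), -(h • (mul fβ * d))]

/-- The part of the recursion operator without `∂⁻¹`. -/
def recLocal : Matrix (Fin 4) (Fin 4) E :=
  let v := mul fv
  let w := mul fw
  let α := mul fα
  let β := mul fβ
  let h : ℂ := 1 / 2
  let q : ℂ := 1 / 4
  !![h • d, h • w + 1, q • α, -(q • β);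
     2, -(h • d) + h • v, 0, α;
     2 * β - 2 * α * d, -(2 * α * (w + 1)), d + h • v, α * β - (2 * w + 2);
     -(2 * α), β, -1, -d + h • v]

/-- The recursion operator `𝓛`: its first row is `∂⁻¹ ℓ` plus the first row of `recLocal`, the other
rows contain no `∂⁻¹`. -/
def opL : Matrix (Fin 4) (Fin 4) E :=
  recLocal mul d +
    !![dinv * recRow mul d 0, dinv * recRow mul d 1, dinv * recRow mul d 2, dinv * recRow mul d 3;
       0, 0, 0, 0;
       0, 0, 0, 0;
       0, 0, 0, 0]

/-- The operator `R`. -/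
def opR : Matrix (Fin 4) (Fin 4) E :=
  let v := mul fv
  let w := mul fw
  let α := mul fα
  let β := mul fβ
  let h : ℂ := 1 / 2
  let q : ℂ := 1 / 4
  !![-(2 * d), h • (d * d) - h • (d * v), 0, -(d * α);
     -(h • (v * d)) - h • (d * d), -(h • (w * d)) - h • (d * w) - d,
       -(q • (d * α)) - q • (v * α) - h • β, q • (d * β) + (w + 1) * α + q • (v * β);
     0, q • (α * d) - q • (v * α) - h • β, h • 1, h • d - q • v;
     α * d, -(q • (β * d)) + (w + 1) * α + q • (v * β), -(h • d) - q • v, (w + 1) - α * β]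

end Operators

/-- `J` acting on differential superpolynomials. -/
def J : Matrix (Fin 4) (Fin 4) (Module.End ℂ Alg) := opJ (Algebra.lmul ℂ Alg) dx

/-- `R` acting on differential superpolynomials. -/
def R : Matrix (Fin 4) (Fin 4) (Module.End ℂ Alg) := opR (Algebra.lmul ℂ Alg) dx

/-- The action of a matrix of operators on a column. -/
def act (P : Matrix (Fin 4) (Fin 4) (Module.End ℂ Alg)) (G : Fin 4 → Alg) : Fin 4 → Alg :=
  fun i => ∑ j, P i j (G j)

/-- `G' = 𝓛 G`, where `∂⁻¹` stands for some antiderivative `s` (determined up to a constant) of the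
differential superpolynomial it is applied to. -/
def RecursionRel (G G' : Fin 4 → Alg) : Prop :=
  ∃ s : Alg, dx s = ∑ j, recRow (Algebra.lmul ℂ Alg) dx j (G j) ∧
    G' = act (recLocal (Algebra.lmul ℂ Alg) dx) G + ![s, 0, 0, 0]

/-- A density of the super Poisson bracket `{∫f, ∫g} = ∫ (δf/δu)ᵀ P (δg/δu) dx`. -/
def bracket (P : Matrix (Fin 4) (Fin 4) (Module.End ℂ Alg)) (f g : Alg) : Alg :=
  ∑ i, grad f i * act P (grad g) i

/-- `P` is a super-Hamiltonian operator: its bracket of even functionals (densities modulo total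
derivatives) is skew-symmetric and satisfies the Jacobi identity. -/
structure IsSuperHamiltonian (P : Matrix (Fin 4) (Fin 4) (Module.End ℂ Alg)) : Prop where
  even : ∀ f g : Alg, IsEven f → IsEven g → IsEven (bracket P f g)
  skew : ∀ f g : Alg, IsEven f → IsEven g →
    bracket P f g + bracket P g f ∈ LinearMap.range dx
  jacobi : ∀ f g h : Alg, IsEven f → IsEven g → IsEven h →
    bracket P (bracket P f g) h + bracket P (bracket P g h) f + bracket P (bracket P h f) g ∈
      LinearMap.range dx

/-! ### The spectral problem -/

/-- Formal Laurent series in `z = λ⁻¹` (finitely many positive powers of `λ`). -/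
abbrev Ser : Type := LaurentSeries Alg

/-- The spectral parameter `λ = z⁻¹`. -/
def lam : Ser := HahnSeries.single (-1 : ℤ) 1

/-- A series that is constant in `λ`. -/
abbrev con : Alg →+* Ser := HahnSeries.C

/-- `∂/∂λ = -z² ∂/∂z`. -/
def dlam (f : Ser) : Ser := -(HahnSeries.single (2 : ℤ) 1 * LaurentSeries.derivative ℂ f)

/-- A linear map of `Alg` applied to all coefficients of the entries of a matrix. -/
def mapCoeff (T : Alg →ₗ[ℂ] Alg) (X : Matrix (Fin 3) (Fin 3) Ser) : Matrix (Fin 3) (Fin 3) Ser :=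
  X.map fun f => f.map T

/-- The supertrace. -/
def str (X : Matrix (Fin 3) (Fin 3) Ser) : Ser := X 0 0 + X 1 1 - X 2 2

/-- The spectral matrix `M`. -/
def specM : Matrix (Fin 3) (Fin 3) Ser :=
  let h : ℂ := 1 / 2
  !![-lam + con (h • fv), 1, con fα;
     con (-(2 * fw) - 2), lam - con (h • fv), con fβ;
     con fβ, -con fα, 0]

/-- The coefficients `a_m, b_m, c_m, ρ_m, δ_m` of `N`. -/
@[ext] structure Coeffs where
  a : ℕ → Alg
  b : ℕ → Alg
  c : ℕ → Alg
  ρ : ℕ → Alg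
  δ : ℕ → Alg

namespace Coeffs

variable (N : Coeffs)

/-- The coefficient of `λ^{-m}` in `N`. -/
def mat (m : ℕ) : Matrix (Fin 3) (Fin 3) Alg :=
  !![N.a m, N.b m, N.ρ m;
     -(2 * N.b m) + 2 * N.c m, -N.a m, N.δ m;
     N.δ m, -N.ρ m, 0]

/-- `N = ∑_{m ≥ 0} N_m λ^{-m}`. -/
def ser : Matrix (Fin 3) (Fin 3) Ser :=
  Matrix.of fun i j => HahnSeries.ofPowerSeries ℤ Alg (PowerSeries.mk fun m => N.mat m i j)

/-- `N` is an even element with `N_x = [M, N]` and the initial values `a_0 = k₀`,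
`b_0 = c_0 = ρ_0 = δ_0 = 0`. The integration constants in `a_1, a_2, …` are free. -/
structure IsSolution (k₀ : ℂ) : Prop where
  even : ∀ m, IsEven (N.a m) ∧ IsEven (N.b m) ∧ IsEven (N.c m)
  odd : ∀ m, IsOdd (N.ρ m) ∧ IsOdd (N.δ m)
  init : N.a 0 = algebraMap ℂ Alg k₀ ∧ N.b 0 = 0 ∧ N.c 0 = 0 ∧ N.ρ 0 = 0 ∧ N.δ 0 = 0
  stationary : mapCoeff dx N.ser = specM * N.ser - N.ser * specM

/-- The integration constants are chosen such that `Str N²` does not depend on `λ`. -/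
def IsNormalized (k₀ : ℂ) : Prop := str (N.ser * N.ser) = con (algebraMap ℂ Alg (2 * k₀ ^ 2))

/-- `G_n = (a_n, -2 b_n, -2 δ_n, 2 ρ_n)`. -/
def vec (n : ℕ) : Fin 4 → Alg := ![N.a n, -(2 * N.b n), -(2 * N.δ n), 2 * N.ρ n]

/-- `N^{(n)} = ∑_{m ≤ n} N_m λ^{n-m} + b_{n+1} diag(1, -1, 0)`. -/
def aux (n : ℕ) : Matrix (Fin 3) (Fin 3) Ser :=
  (Matrix.of fun i j =>
    ∑ m ∈ Finset.range (n + 1), HahnSeries.single ((m : ℤ) - (n : ℤ)) (N.mat m i j)) +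
  !![con (N.b (n + 1)), 0, 0; 0, -con (N.b (n + 1)), 0; 0, 0, 0]

/-- `T = ∂/∂t_n` is the `n`-th flow: a derivation commuting with `∂/∂x`, for which the zero curvature
equation `M_t - N^{(n)}_x + [M, N^{(n)}] = 0` holds. -/
structure IsFlow (n : ℕ) (T : Alg →ₗ[ℂ] Alg) : Prop where
  leibniz : ∀ f g, T (f * g) = T f * g + f * T g
  comm : ∀ f, T (dx f) = dx (T f)
  zeroCurvature :
    mapCoeff T specM - mapCoeff dx (N.aux n) + (specM * N.aux n - N.aux n * specM) = 0

/-- The density of `H̃_n`: `2 a_{n+1} / n` for `n ≥ 1`, and `k₀ v` for `n = 0`. -/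
def ham (k₀ : ℂ) (n : ℕ) : Alg :=
  if n = 0 then k₀ • fv else (2 / (n : ℂ)) • N.a (n + 1)

end Coeffs

/-- `u_t = J δ(∫h₁)/δu = J𝓛 δ(∫h₀)/δu` for the flow `T = ∂/∂t`. The second form is stated both with
`R` and with `J` applied to any value of `𝓛 δ(∫h₀)/δu`, one of which is `δ(∫h₁)/δu`. -/
structure BiHamiltonianForm (T : Alg →ₗ[ℂ] Alg) (h₀ h₁ : Alg) : Prop where
  first : (fun i => T (field i)) = act J (grad h₁)
  recursion : RecursionRel (grad h₀) (grad h₁)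
  second : ∀ G, RecursionRel (grad h₀) G → (fun i => T (field i)) = act J G
  secondR : (fun i => T (field i)) = act R (grad h₀)

end

end SuperGBK

/-!
Set `z = λ⁻¹` and let `n` be a power series solution of `n_x = [M, n]` with `½ Str n² = κ²`
constant. The ratios `s`, `σ` of the components of its eigenvector `(1, s, σ)` for the eigenvalue
`κ` solve Riccati equations, and `½ v + s + α σ` is a conserved density. Applying a derivation `T`
that commutes with `∂` to the Riccati equations expresses the variation of this density under `T`,
modulo total derivatives, by the entries of `n` and the variation of the spectral problem. The
choices `T = z d/dz`, which does not move the fields, and `T` evolutionary in the fields compute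
the density and its gradient; comparing them gives `δ/δu ∫ 2 a_{m+1} = m G_m`, from which the
super-trace identity follows. Any other solution is `f(z) n` with a constant series `f`. If its
own coefficients satisfy the gradient formula too, then `f' a = 0`, hence `f = 1`.

In the Jacobi identity for `P = c₁ J + c₂ R` the second variations of the functionals cancel,
because the Fréchet derivative of a gradient is self-adjoint. What remains is trilinear in the
gradients and involves only the derivative of the coefficients of `P`. It is a total derivative,
with an antiderivative found by integration by parts.
-/

namespace SuperGBK
noncomputable section

/-! ### Superderivations of the jet algebra -/

namespace JetAlg

variable {ι : Type} {odd : ι → Bool}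

theorem induction {P : JetAlg odd → Prop} (algebraMap : ∀ c : ℂ, P (algebraMap ℂ _ c))
    (gen : ∀ x, P (gen odd x)) (add : ∀ f g, P f → P g → P (f + g))
    (mul : ∀ f g, P f → P g → P (f * g)) (f : JetAlg odd) : P f := by
  obtain ⟨f, rfl⟩ := RingQuot.mkAlgHom_surjective ℂ (JetRel odd) f
  induction f using FreeAlgebra.induction with
  | grade0 r => exact (AlgHom.commutes (RingQuot.mkAlgHom ℂ (JetRel odd)) r).symm ▸ algebraMap r
  | grade1 x => exact gen x
  | mul f g hf hg => exact (map_mul (RingQuot.mkAlgHom ℂ (JetRel odd)) f g).symm ▸ mul _ _ hf hg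
  | add f g hf hg => exact (map_add (RingQuot.mkAlgHom ℂ (JetRel odd)) f g).symm ▸ add _ _ hf hg

/-- A homomorphism into upper triangular `2 × 2` matrices with diagonal `(f, σ f)` is the same as a
`σ`-twisted derivation, its upper right entry. -/
theorem upperTriangular_apply {Φ : JetAlg odd →ₐ[ℂ] Matrix (Fin 2) (Fin 2) (JetAlg odd)}
    {σ : JetAlg odd →ₐ[ℂ] JetAlg odd}
    (hΦ : ∀ x, Φ (gen odd x) = !![gen odd x, Φ (gen odd x) 0 1; 0, σ (gen odd x)])
    (f : JetAlg odd) : Φ f = !![f, Φ f 0 1; 0, σ f] := by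
  have h : Φ f 0 0 = f ∧ Φ f 1 0 = 0 ∧ Φ f 1 1 = σ f := by
    induction f using induction with
    | algebraMap c => simp [AlgHom.commutes, Matrix.algebraMap_matrix_apply]
    | gen x => rw [hΦ]; simp
    | add f g hf hg => simp [hf, hg]
    | mul f g hf hg => simp [hf, hg, Matrix.mul_apply]
  ext i j
  fin_cases i <;> fin_cases j <;> simp [h]

theorem upperTriangular_mul {Φ : JetAlg odd →ₐ[ℂ] Matrix (Fin 2) (Fin 2) (JetAlg odd)}
    {σ : JetAlg odd →ₐ[ℂ] JetAlg odd}
    (hΦ : ∀ x, Φ (gen odd x) = !![gen odd x, Φ (gen odd x) 0 1; 0, σ (gen odd x)])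
    (f g : JetAlg odd) : Φ (f * g) 0 1 = f * Φ g 0 1 + Φ f 0 1 * σ g := by
  rw [map_mul, Matrix.mul_apply, Fin.sum_univ_two, upperTriangular_apply hΦ f,
    upperTriangular_apply hΦ g]
  simp

theorem upperRight_algebraMap (Φ : JetAlg odd →ₐ[ℂ] Matrix (Fin 2) (Fin 2) (JetAlg odd)) (c : ℂ) :
    Φ (algebraMap ℂ _ c) 0 1 = 0 := by
  simp [AlgHom.commutes, Matrix.algebraMap_matrix_apply]

theorem D_mul (f g : JetAlg odd) : D odd (f * g) = D odd f * g + f * D odd g := by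
  rw [add_comm]
  exact upperTriangular_mul (σ := AlgHom.id ℂ _) (fun x => by simp [totalHom]) f g

@[simp] theorem D_gen (x : ι × ℕ) : D odd (gen odd x) = gen odd (x.1, x.2 + 1) := by
  simp [D, totalHom]

@[simp] theorem D_algebraMap (c : ℂ) : D odd (algebraMap ℂ _ c) = 0 := upperRight_algebraMap _ c

@[simp] theorem D_one : D odd 1 = 0 := by
  simpa using D_algebraMap (odd := odd) 1

theorem neg_D_pow_apply (k : ℕ) (f : JetAlg odd) :
    ((-D odd) ^ k : Module.End ℂ (JetAlg odd)) f = (-1 : ℂ) ^ k • (D odd ^ k) f := by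
  rw [← neg_one_smul ℂ (D odd), smul_pow, LinearMap.smul_apply]

/-! ### Parity -/

@[simp] theorem parity_gen (x : ι × ℕ) :
    parity odd (gen odd x) = (if odd x.1 then (-1 : ℂ) else 1) • gen odd x := by
  simp [parity]

theorem parity_D (f : JetAlg odd) : parity odd (D odd f) = D odd (parity odd f) := by
  induction f using induction with
  | algebraMap c => simp
  | gen x => rw [parity_gen, map_smul, D_gen, parity_gen]
  | add f g hf hg => simp [hf, hg]
  | mul f g hf hg => simp [D_mul, hf, hg]

/-- The sign automorphism picked up by an element when an element of parity `b` moves past it. -/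
def twist (odd : ι → Bool) (b : Bool) : JetAlg odd →ₐ[ℂ] JetAlg odd :=
  if b then parity odd else AlgHom.id ℂ _

theorem twist_gen (i : ι) (x : ι × ℕ) :
    twist odd (odd i) (gen odd x) = koszul odd i x.1 • gen odd x := by
  by_cases hi : odd i <;> by_cases hx : odd x.1 <;> simp [twist, koszul, hi, hx]

theorem twist_comm (b c : Bool) (f : JetAlg odd) :
    twist odd b (twist odd c f) = twist odd c (twist odd b f) := by
  cases b <;> cases c <;> simp [twist]

theorem twist_D (b : Bool) (f : JetAlg odd) : twist odd b (D odd f) = D odd (twist odd b f) := by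
  cases b <;> simp [twist, parity_D]

theorem gen_mul (x : ι × ℕ) (f : JetAlg odd) :
    gen odd x * f = twist odd (odd x.1) f * gen odd x := by
  induction f using induction with
  | algebraMap c => rw [AlgHom.commutes, Algebra.commutes]
  | gen y => rw [gen_mul_gen, twist_gen, smul_mul_assoc]
  | add f g hf hg => rw [mul_add, hf, hg, map_add, add_mul]
  | mul f g hf hg => rw [← mul_assoc, hf, mul_assoc, hg, map_mul, mul_assoc]

/-- `f` has the parity `b`, where `true` means odd. -/
def HasParity (b : Bool) (f : JetAlg odd) : Prop := parity odd f = (if b then (-1 : ℂ) else 1) • f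

theorem hasParity_false {f : JetAlg odd} : HasParity false f ↔ IsEven f := by
  simp [HasParity, IsEven]

theorem hasParity_true {f : JetAlg odd} : HasParity true f ↔ IsOdd f := by
  simp [HasParity, IsOdd]

theorem hasParity_gen (x : ι × ℕ) : HasParity (odd x.1) (gen odd x) := by
  simp [HasParity]

theorem HasParity.zero (b : Bool) : HasParity b (0 : JetAlg odd) := by simp [HasParity]

section

variable {b c : Bool} {f g : JetAlg odd}

theorem HasParity.add (hf : HasParity b f) (hg : HasParity b g) : HasParity b (f + g) := by
  rw [HasParity, map_add, hf, hg, smul_add]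

theorem HasParity.smul (a : ℂ) (hf : HasParity b f) : HasParity b (a • f) := by
  rw [HasParity, map_smul, hf, smul_comm]

theorem HasParity.sub (hf : HasParity b f) (hg : HasParity b g) : HasParity b (f - g) := by
  rw [sub_eq_add_neg, ← neg_one_smul ℂ g]
  exact hf.add (hg.smul _)

theorem HasParity.sum {κ : Type*} (s : Finset κ) {f : κ → JetAlg odd}
    (hf : ∀ i ∈ s, HasParity b (f i)) : HasParity b (∑ i ∈ s, f i) :=
  Finset.sum_induction f _ (fun _ _ => HasParity.add) (HasParity.zero b) hf

theorem HasParity.mul (hf : HasParity b f) (hg : HasParity c g) :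
    HasParity (xor b c) (f * g) := by
  rw [HasParity, map_mul, hf, hg, smul_mul_smul_comm]
  cases b <;> cases c <;> simp

theorem HasParity.D (hf : HasParity b f) : HasParity b (D odd f) := by
  rw [HasParity, parity_D, hf, map_smul]

theorem HasParity.D_pow (hf : HasParity b f) (k : ℕ) : HasParity b ((JetAlg.D odd ^ k) f) := by
  induction k with
  | zero => exact hf
  | succ k ih =>
    rw [pow_succ', Module.End.mul_apply]
    exact ih.D

theorem HasParity.twist_eq (hf : HasParity b f) (i j : ι) (hb : odd j = b) :
    twist odd (odd i) f = koszul odd i j • f := by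
  unfold HasParity at hf
  by_cases hi : odd i <;> cases b <;> simp_all [twist, koszul]

theorem HasParity.mul_eq_twist_mul (hf : HasParity b f) (g : JetAlg odd) :
    f * g = twist odd b g * f := by
  induction g using induction with
  | algebraMap c => rw [AlgHom.commutes, Algebra.commutes]
  | gen y =>
    unfold HasParity at hf
    have h := gen_mul y f
    by_cases hy : odd y.1 <;> cases b <;> simp_all [twist]
  | add g h hg hh => rw [mul_add, hg, hh, map_add, add_mul]
  | mul g h hg hh => rw [← mul_assoc, hg, mul_assoc, hh, map_mul, mul_assoc]

theorem IsEven.mul_comm (hf : IsEven f) (g : JetAlg odd) : f * g = g * f :=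
  (hasParity_false.2 hf).mul_eq_twist_mul g

theorem IsOdd.anticomm (hf : IsOdd f) (hg : IsOdd g) : f * g = -(g * f) := by
  rw [(hasParity_true.2 hf).mul_eq_twist_mul g, ← neg_mul]
  exact congrArg (· * f) hg

end

/-! ### Even derivations -/

section Der

variable {X : ι × ℕ → JetAlg odd}

/-- `f ↦ [[f, T f], [0, f]]`, where `T` is the even derivation with prescribed values on the jet
variables. -/
def derHom (X : ι × ℕ → JetAlg odd) (hX : ∀ x, HasParity (odd x.1) (X x)) :
    JetAlg odd →ₐ[ℂ] Matrix (Fin 2) (Fin 2) (JetAlg odd) :=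
  lift (fun x => !![gen odd x, X x; 0, gen odd x]) (by
    intro x y
    have hgg := gen_mul_gen (odd := odd) x y
    have hgX : gen odd x * X y = koszul odd x.1 y.1 • (X y * gen odd x) := by
      rw [gen_mul, (hX y).twist_eq x.1 y.1 rfl, smul_mul_assoc]
    have hXg : X x * gen odd y = koszul odd x.1 y.1 • (gen odd y * X x) := by
      rw [gen_mul, (hX x).twist_eq y.1 x.1 rfl, smul_mul_assoc, smul_smul, koszul_comm y.1 x.1,
        koszul_mul_self, one_smul]
    ext i j
    fin_cases i <;> fin_cases j <;> simp [hgg, hgX, hXg, Matrix.mul_apply, add_comm])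

/-- The even derivation with prescribed values on the jet variables. -/
def der (X : ι × ℕ → JetAlg odd) (hX : ∀ x, HasParity (odd x.1) (X x)) :
    JetAlg odd →ₗ[ℂ] JetAlg odd :=
  Matrix.entryLinearMap ℂ (JetAlg odd) 0 1 ∘ₗ (derHom X hX).toLinearMap

variable (hX : ∀ x, HasParity (odd x.1) (X x))

theorem der_mul (f g : JetAlg odd) : der X hX (f * g) = der X hX f * g + f * der X hX g := by
  rw [add_comm]
  exact upperTriangular_mul (σ := AlgHom.id ℂ _) (fun x => by simp [derHom]) f g

@[simp] theorem der_gen (x : ι × ℕ) : der X hX (gen odd x) = X x := by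
  simp [der, derHom]

@[simp] theorem der_algebraMap (c : ℂ) : der X hX (algebraMap ℂ _ c) = 0 :=
  upperRight_algebraMap _ c

theorem parity_der (f : JetAlg odd) : parity odd (der X hX f) = der X hX (parity odd f) := by
  induction f using induction with
  | algebraMap c => simp
  | gen x => rw [parity_gen, map_smul, der_gen, hX x]
  | add f g hf hg => simp [hf, hg]
  | mul f g hf hg => simp [der_mul, hf, hg]

end Der

/-- The even derivation commuting with `∂` that takes the field `u_i` to `X i`. -/
def ev (X : ι → JetAlg odd) (hX : ∀ i, HasParity (odd i) (X i)) : JetAlg odd →ₗ[ℂ] JetAlg odd :=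
  der (fun x => (D odd ^ x.2) (X x.1)) fun x => (hX x.1).D_pow x.2

section Ev

variable {X : ι → JetAlg odd} (hX : ∀ i, HasParity (odd i) (X i))

theorem ev_mul (f g : JetAlg odd) : ev X hX (f * g) = ev X hX f * g + f * ev X hX g :=
  der_mul _ f g

@[simp] theorem ev_algebraMap (c : ℂ) : ev X hX (algebraMap ℂ _ c) = 0 := der_algebraMap _ c

theorem ev_gen (x : ι × ℕ) : ev X hX (gen odd x) = (D odd ^ x.2) (X x.1) := der_gen _ x

theorem ev_D (f : JetAlg odd) : ev X hX (D odd f) = D odd (ev X hX f) := by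
  induction f using induction with
  | algebraMap c => simp
  | gen x => simp [ev_gen, pow_succ']
  | add f g hf hg => simp [hf, hg]
  | mul f g hf hg =>
    simp only [D_mul, ev_mul, map_add, hf, hg]
    abel

theorem HasParity.ev {b : Bool} {f : JetAlg odd} (hf : HasParity b f) :
    HasParity b (JetAlg.ev X hX f) := by
  rw [HasParity, JetAlg.ev, parity_der, hf, map_smul]

end Ev

theorem derivation_algebraMap {T : JetAlg odd →ₗ[ℂ] JetAlg odd}
    (hT : ∀ f g, T (f * g) = T f * g + f * T g) (c : ℂ) : T (algebraMap ℂ _ c) = 0 := by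
  have h := hT 1 1
  rw [mul_one, mul_one, one_mul, left_eq_add] at h
  rw [Algebra.algebraMap_eq_smul_one, map_smul, h, smul_zero]

theorem derivation_ext {S T : JetAlg odd →ₗ[ℂ] JetAlg odd}
    (hS : ∀ f g, S (f * g) = S f * g + f * S g) (hT : ∀ f g, T (f * g) = T f * g + f * T g)
    (hSD : ∀ f, S (D odd f) = D odd (S f)) (hTD : ∀ f, T (D odd f) = D odd (T f))
    (h : ∀ i, S (gen odd (i, 0)) = T (gen odd (i, 0))) : S = T := by
  ext f
  induction f using induction with
  | algebraMap c => rw [derivation_algebraMap hS, derivation_algebraMap hT]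
  | gen x =>
    obtain ⟨i, k⟩ := x
    induction k with
    | zero => exact h i
    | succ k ih => rw [← D_gen (i, k), hSD, hTD, ih]
  | add f g hf hg => rw [map_add, map_add, hf, hg]
  | mul f g hf hg => rw [hS, hT, hf, hg]

theorem ev_ev_sub {X Y : ι → JetAlg odd} (hX : ∀ i, HasParity (odd i) (X i))
    (hY : ∀ i, HasParity (odd i) (Y i)) (f : JetAlg odd) :
    ev X hX (ev Y hY f) - ev Y hY (ev X hX f) =
      ev (fun i => ev X hX (Y i) - ev Y hY (X i))
        (fun i => ((hY i).ev hX).sub ((hX i).ev hY)) f := by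
  refine DFunLike.congr_fun (f := ev X hX ∘ₗ ev Y hY - ev Y hY ∘ₗ ev X hX)
    (derivation_ext (fun f g => ?_) (ev_mul _) (fun f => ?_) (ev_D _) fun i => ?_) f
  · simp only [LinearMap.sub_apply, LinearMap.comp_apply, ev_mul, map_add]
    noncomm_ring
  · simp only [LinearMap.sub_apply, LinearMap.comp_apply, ev_D, map_sub]
  · simp only [LinearMap.sub_apply, LinearMap.comp_apply, ev_gen, pow_zero, Module.End.one_apply]

/-! ### Partial derivatives -/

section PartialDerivatives

variable [DecidableEq ι]

theorem pd_mul (z : ι × ℕ) (f g : JetAlg odd) :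
    pd odd z (f * g) = f * pd odd z g + pd odd z f * twist odd (odd z.1) g :=
  upperTriangular_mul (fun x => by simp [pdHom, twist_gen]) f g

theorem pd_gen (z x : ι × ℕ) : pd odd z (gen odd x) = if x = z then 1 else 0 := by
  simp [pd, pdHom]

@[simp] theorem pd_algebraMap (z : ι × ℕ) (c : ℂ) : pd odd z (algebraMap ℂ _ c) = 0 :=
  upperRight_algebraMap _ c

theorem parity_pd (z : ι × ℕ) (f : JetAlg odd) :
    parity odd (pd odd z f) = (if odd z.1 then (-1 : ℂ) else 1) • pd odd z (parity odd f) := by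
  induction f using induction with
  | algebraMap c => simp
  | gen x =>
    rw [pd_gen, parity_gen, map_smul, pd_gen]
    split_ifs with h1 h2 <;> simp_all
  | add f g hf hg => simp [hf, hg]
  | mul f g hf hg =>
    have ht : parity odd (twist odd (odd z.1) g) = twist odd (odd z.1) (parity odd g) := by
      cases odd z.1 <;> simp [twist]
    simp only [map_mul, pd_mul, map_add, hf, hg, ht, smul_add, mul_smul_comm, smul_mul_assoc]

theorem twist_pd (i : ι) (z : ι × ℕ) (f : JetAlg odd) :
    twist odd (odd i) (pd odd z f) = koszul odd i z.1 • pd odd z (twist odd (odd i) f) := by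
  have h := parity_pd z f
  by_cases hi : odd i <;> by_cases hz : odd z.1 <;> simp_all [twist, koszul]

theorem pd_twist (i : ι) (z : ι × ℕ) (f : JetAlg odd) :
    pd odd z (twist odd (odd i) f) = koszul odd i z.1 • twist odd (odd i) (pd odd z f) := by
  rw [twist_pd, smul_smul, koszul_mul_self, one_smul]

theorem pd_pd (z y : ι × ℕ) (f : JetAlg odd) :
    pd odd z (pd odd y f) = koszul odd z.1 y.1 • pd odd y (pd odd z f) := by
  induction f using induction with
  | algebraMap c => simp
  | gen x =>
    have h : ∀ a b : ι × ℕ, pd odd a (if x = b then 1 else 0) = 0 := fun a b => by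
      split_ifs
      · rw [← map_one (algebraMap ℂ _), pd_algebraMap]
      · exact map_zero _
    rw [pd_gen, pd_gen, h, h, smul_zero]
  | add f g hf hg => simp only [map_add, hf, hg, smul_add]
  | mul f g hf hg =>
    simp only [pd_mul, map_add, hf, hg, pd_twist, smul_add, mul_smul_comm,
      smul_mul_assoc, smul_smul, koszul_comm y.1 z.1, koszul_mul_self, one_smul,
      twist_comm (odd y.1)]
    abel

theorem HasParity.pd {b : Bool} {f : JetAlg odd} (hf : HasParity b f) (z : ι × ℕ) :
    HasParity (xor b (odd z.1)) (pd odd z f) := by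
  rw [HasParity, parity_pd, hf, map_smul, smul_smul]
  cases b <;> cases odd z.1 <;> simp

theorem pd_succ_D (i : ι) (k : ℕ) (f : JetAlg odd) :
    pd odd (i, k + 1) (D odd f) = D odd (pd odd (i, k + 1) f) + pd odd (i, k) f := by
  induction f using induction with
  | algebraMap c => simp
  | gen x =>
    obtain ⟨j, l⟩ := x
    simp only [D_gen, pd_gen, Prod.mk.injEq, Nat.add_right_cancel_iff]
    by_cases h : j = i ∧ l = k + 1 <;> by_cases h' : j = i ∧ l = k <;> simp [h, h']
  | add f g hf hg =>
    simp only [map_add, hf, hg]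
    abel
  | mul f g hf hg =>
    simp only [map_add, D_mul, pd_mul, hf, hg, twist_D, mul_add, add_mul]
    abel

theorem pd_zero_D (i : ι) (f : JetAlg odd) :
    pd odd (i, 0) (D odd f) = D odd (pd odd (i, 0) f) := by
  induction f using induction with
  | algebraMap c => simp
  | gen x =>
    obtain ⟨j, l⟩ := x
    simp only [D_gen, pd_gen, Prod.mk.injEq]
    by_cases h : j = i ∧ l = 0 <;> simp [h]
  | add f g hf hg => simp only [map_add, hf, hg]
  | mul f g hf hg =>
    simp only [map_add, D_mul, pd_mul, hf, hg, twist_D]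
    abel

/-- `f` does not depend on jets of order `K` or higher. -/
def OrderLT (K : ℕ) (f : JetAlg odd) : Prop := ∀ z : ι × ℕ, K ≤ z.2 → pd odd z f = 0

section Order

variable {K L : ℕ} {f g : JetAlg odd}

theorem OrderLT.mono (hf : OrderLT K f) (hKL : K ≤ L) : OrderLT L f :=
  fun z hz => hf z (hKL.trans hz)

theorem OrderLT.add (hf : OrderLT K f) (hg : OrderLT K g) : OrderLT K (f + g) :=
  fun z hz => by simp [hf z hz, hg z hz]

theorem OrderLT.smul (c : ℂ) (hf : OrderLT K f) : OrderLT K (c • f) :=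
  fun z hz => by simp [hf z hz]

theorem OrderLT.mul (hf : OrderLT K f) (hg : OrderLT K g) : OrderLT K (f * g) :=
  fun z hz => by simp [pd_mul, hf z hz, hg z hz]

theorem OrderLT.pd (hf : OrderLT K f) (z : ι × ℕ) : OrderLT K (pd odd z f) :=
  fun y hy => by rw [pd_pd, hf y hy, map_zero, smul_zero]

theorem OrderLT.D (hf : OrderLT K f) : OrderLT (K + 1) (D odd f) := by
  rintro ⟨i, _ | k⟩ hk
  · simp at hk
  · have hKk : K ≤ k := Nat.le_of_succ_le_succ hk
    rw [pd_succ_D, hf (i, k) hKk, hf (i, k + 1) (hKk.trans k.le_succ), map_zero, add_zero]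

theorem OrderLT.D_pow (hf : OrderLT K f) (L : ℕ) : OrderLT (K + L) ((JetAlg.D odd ^ L) f) := by
  induction L with
  | zero => exact hf
  | succ L ih =>
    rw [pow_succ', Module.End.mul_apply]
    exact ih.D

theorem OrderLT.pd_D_pow (hf : OrderLT (K + 1) f) (i : ι) (L : ℕ) :
    JetAlg.pd odd (i, K + L) ((JetAlg.D odd ^ L) f) = JetAlg.pd odd (i, K) f := by
  induction L with
  | zero => rfl
  | succ L ih =>
    rw [pow_succ', Module.End.mul_apply, ← add_assoc, pd_succ_D, ih,
      hf.D_pow L _ (by simp only; omega), map_zero, zero_add]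

theorem orderLT_gen {x : ι × ℕ} (hx : x.2 < K) : OrderLT K (gen odd x) := by
  intro z hz
  rw [pd_gen, if_neg]
  rintro rfl
  omega

theorem exists_orderLT (f : JetAlg odd) : ∃ K, OrderLT K f := by
  induction f using induction with
  | algebraMap c => exact ⟨0, fun z _ => by simp⟩
  | gen x => exact ⟨x.2 + 1, orderLT_gen x.2.lt_succ_self⟩
  | add f g hf hg =>
    obtain ⟨⟨K, hK⟩, ⟨L, hL⟩⟩ := hf, hg
    exact ⟨max K L, (hK.mono (le_max_left _ _)).add (hL.mono (le_max_right _ _))⟩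
  | mul f g hf hg =>
    obtain ⟨⟨K, hK⟩, ⟨L, hL⟩⟩ := hf, hg
    exact ⟨max K L, (hK.mono (le_max_left _ _)).mul (hL.mono (le_max_right _ _))⟩

end Order

theorem eventually_der_eq_sum_pd [Fintype ι] {X : ι × ℕ → JetAlg odd}
    (hX : ∀ x, HasParity (odd x.1) (X x)) (f : JetAlg odd) :
    ∀ᶠ K in Filter.atTop,
      der X hX f = ∑ i, ∑ k ∈ Finset.range K, pd odd (i, k) f * X (i, k) := by
  induction f using induction with
  | algebraMap c => simp
  | gen x =>
    filter_upwards [Filter.eventually_gt_atTop x.2] with K hK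
    have hx : ∀ i k, pd odd (i, k) (gen odd x) * X (i, k) =
        if x.1 = i then if x.2 = k then X (i, k) else 0 else 0 := fun i k => by
      simp only [pd_gen, ← ite_and, ite_mul, one_mul, zero_mul, Prod.ext_iff]
    simp [hx, hK, Finset.sum_ite_irrel]
  | add f g hf hg =>
    filter_upwards [hf, hg] with K h1 h2
    simp only [map_add, h1, h2, add_mul, Finset.sum_add_distrib]
  | mul f g hf hg =>
    filter_upwards [hf, hg] with K h1 h2
    simp only [der_mul, h1, h2, pd_mul, add_mul, Finset.sum_add_distrib, Finset.sum_mul,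
      Finset.mul_sum, mul_assoc, (hX (_, _)).mul_eq_twist_mul g]
    rw [add_comm]

end PartialDerivatives

/-! ### The kernel of the total derivative -/

/-- The homomorphism `u_i^{(k)} ↦ t u_i^{(k)}` into the polynomials in `t`. -/
def scaleHom (odd : ι → Bool) : JetAlg odd →ₐ[ℂ] Polynomial (JetAlg odd) :=
  lift (fun x => Polynomial.C (gen odd x) * Polynomial.X) (by
    intro x y
    have h : ∀ a b : JetAlg odd, Polynomial.C a * Polynomial.X * (Polynomial.C b * Polynomial.X) =
        Polynomial.C (a * b) * Polynomial.X ^ 2 := by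
      intro a b
      rw [mul_assoc, ← mul_assoc Polynomial.X, Polynomial.X_mul_C, mul_assoc, ← mul_assoc, pow_two,
        Polynomial.C_mul]
    rw [h, h, gen_mul_gen, ← Polynomial.smul_C, smul_mul_assoc])

theorem derivative_scaleHom_mul_X (f : JetAlg odd) :
    Polynomial.derivative (scaleHom odd f) * Polynomial.X =
      scaleHom odd (der (gen odd) hasParity_gen f) := by
  induction f using induction with
  | algebraMap c =>
    rw [AlgHom.commutes, der_algebraMap, map_zero, Polynomial.algebraMap_apply]
    simp
  | gen x => simp [scaleHom]
  | add f g hf hg => simp only [map_add, add_mul, hf, hg]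
  | mul f g hf hg =>
    rw [map_mul, Polynomial.derivative_mul, add_mul, der_mul, map_add, map_mul, map_mul, ← hf, ← hg,
      mul_assoc, mul_assoc, mul_assoc, Polynomial.X_mul]

theorem eval_one_scaleHom (f : JetAlg odd) : (scaleHom odd f).eval 1 = f := by
  induction f using induction with
  | algebraMap c => rw [AlgHom.commutes, Polynomial.algebraMap_apply]; simp
  | gen x => simp [scaleHom]
  | add f g hf hg => simp [hf, hg]
  | mul f g hf hg =>
    rw [map_mul, Polynomial.eval, Polynomial.eval₂_mul_noncomm _ _ fun _ => Commute.one_right _]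
    exact congrArg₂ _ hf hg

/-- The augmentation: the value at zero fields. -/
def aug (odd : ι → Bool) : JetAlg odd →ₐ[ℂ] ℂ := lift (fun _ => 0) (by simp)

@[simp] theorem aug_gen (x : ι × ℕ) : aug odd (gen odd x) = 0 := by simp [aug]

theorem algebraMap_injective : Function.Injective (algebraMap ℂ (JetAlg odd)) :=
  fun _ _ h => by simpa using congrArg (aug odd) h

theorem scaleHom_coeff_zero (f : JetAlg odd) :
    (scaleHom odd f).coeff 0 = algebraMap ℂ _ (aug odd f) := by
  induction f using induction with
  | algebraMap c => rw [AlgHom.commutes, Polynomial.algebraMap_apply]; simp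
  | gen x => simp [scaleHom]
  | add f g hf hg => simp [hf, hg]
  | mul f g hf hg => simp [hf, hg, Polynomial.mul_coeff_zero]

theorem eq_algebraMap_of_der_gen_eq_zero {f : JetAlg odd}
    (hf : der (gen odd) hasParity_gen f = 0) : f = algebraMap ℂ _ (aug odd f) := by
  have hscale : scaleHom odd f = Polynomial.C (algebraMap ℂ _ (aug odd f)) := by
    ext n
    cases n with
    | zero => rw [scaleHom_coeff_zero, Polynomial.coeff_C_zero]
    | succ n =>
      have hcoeff := congrArg (fun p => p.coeff (n + 1)) (derivative_scaleHom_mul_X f)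
      simp only [hf, map_zero, Polynomial.coeff_mul_X, Polynomial.coeff_derivative,
        Polynomial.coeff_zero] at hcoeff
      have hsmul : ((n : ℂ) + 1) • (scaleHom odd f).coeff (n + 1) = 0 := by
        rw [Algebra.smul_def, Algebra.commutes]
        simpa using hcoeff
      rw [Polynomial.coeff_C_succ]
      exact (smul_eq_zero.1 hsmul).resolve_left (by exact_mod_cast n.succ_ne_zero)
  conv_lhs => rw [← eval_one_scaleHom f, hscale, Polynomial.eval_C]

theorem eq_algebraMap_of_pd_eq_zero [DecidableEq ι] [Finite ι] {f : JetAlg odd}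
    (hf : ∀ z, pd odd z f = 0) : f = algebraMap ℂ _ (aug odd f) := by
  have := Fintype.ofFinite ι
  obtain ⟨K, hK⟩ := (eventually_der_eq_sum_pd (X := gen odd) hasParity_gen f).exists
  exact eq_algebraMap_of_der_gen_eq_zero (by simpa [hf] using hK)

theorem OrderLT.of_succ_of_D_eq_zero [DecidableEq ι] {K : ℕ} {f : JetAlg odd}
    (hf : OrderLT (K + 1) f) (hD : JetAlg.D odd f = 0) : OrderLT K f := by
  rintro ⟨i, k⟩ (hk : K ≤ k)
  have h := pd_succ_D i k f
  rwa [hD, map_zero, hf (i, k + 1) (Nat.succ_le_succ hk), map_zero, zero_add, eq_comm] at h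

theorem eq_algebraMap_of_D_eq_zero [Finite ι] {f : JetAlg odd} (hf : D odd f = 0) :
    f = algebraMap ℂ _ (aug odd f) := by
  classical
  obtain ⟨K, hK⟩ := exists_orderLT f
  have h0 : OrderLT 0 f := by
    induction K with
    | zero => exact hK
    | succ K ih => exact ih (hK.of_succ_of_D_eq_zero hf)
  exact eq_algebraMap_of_pd_eq_zero fun z => h0 z z.2.zero_le

/-! ### Variational derivatives -/

theorem mul_D_pow_sub_mem (f g : JetAlg odd) (k : ℕ) :
    f * (D odd ^ k) g - ((-D odd) ^ k : Module.End ℂ (JetAlg odd)) f * g ∈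
      LinearMap.range (D odd) := by
  induction k generalizing f with
  | zero => simp
  | succ k ih =>
    have h := add_mem (ih (-D odd f)) (LinearMap.mem_range_self (D odd) (f * (D odd ^ k) g))
    rw [D_mul] at h
    rw [pow_succ', pow_succ, Module.End.mul_apply, Module.End.mul_apply, LinearMap.neg_apply]
    convert h using 1
    noncomm_ring

section Euler

variable [DecidableEq ι]

theorem euler_eq_sum {K : ℕ} {h : JetAlg odd} (hK : OrderLT K h) (i : ι) :
    euler odd i h = ∑ k ∈ Finset.range K,
      ((-D odd) ^ k : Module.End ℂ (JetAlg odd)) (pd odd (i, k) h) := by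
  refine finsum_eq_sum_of_support_subset _ fun k hk => ?_
  by_contra hkK
  rw [Finset.mem_coe, Finset.mem_range, not_lt] at hkK
  exact hk (by simp only [hK (i, k) hkK, map_zero])

theorem euler_add (i : ι) (f g : JetAlg odd) :
    euler odd i (f + g) = euler odd i f + euler odd i g := by
  obtain ⟨⟨K, hK⟩, ⟨L, hL⟩⟩ := exists_orderLT f, exists_orderLT g
  have hf := hK.mono (le_max_left K L)
  have hg := hL.mono (le_max_right K L)
  simp only [euler_eq_sum hf, euler_eq_sum hg, euler_eq_sum (hf.add hg), map_add,
    Finset.sum_add_distrib]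

theorem euler_smul (i : ι) (c : ℂ) (f : JetAlg odd) :
    euler odd i (c • f) = c • euler odd i f := by
  obtain ⟨K, hf⟩ := exists_orderLT f
  simp only [euler_eq_sum hf, euler_eq_sum (hf.smul c), Finset.smul_sum, map_smul]

theorem euler_algebraMap (i : ι) (c : ℂ) : euler odd i (algebraMap ℂ _ c) = 0 := by
  simp [euler]

theorem euler_D (i : ι) (f : JetAlg odd) : euler odd i (D odd f) = 0 := by
  obtain ⟨K, hK⟩ := exists_orderLT f
  have telescope : ∀ L, ∑ k ∈ Finset.range (L + 1), ((-D odd) ^ k : Module.End ℂ (JetAlg odd))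
      (pd odd (i, k) (D odd f)) =
        ((-D odd) ^ L : Module.End ℂ (JetAlg odd)) (D odd (pd odd (i, L) f)) := by
    intro L
    induction L with
    | zero => simp [pd_zero_D]
    | succ L ih =>
      rw [Finset.sum_range_succ, ih, pd_succ_D, map_add, pow_succ, Module.End.mul_apply,
        Module.End.mul_apply, LinearMap.neg_apply, LinearMap.neg_apply, map_neg, map_neg]
      abel
  rw [euler_eq_sum hK.D, telescope, hK (i, K) le_rfl, map_zero, map_zero]

theorem HasParity.euler {b : Bool} {f : JetAlg odd} (hf : HasParity b f) (i : ι) :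
    HasParity (xor b (odd i)) (euler odd i f) := by
  obtain ⟨K, hK⟩ := exists_orderLT f
  rw [euler_eq_sum hK]
  refine HasParity.sum _ fun k _ => ?_
  rw [neg_D_pow_apply]
  exact ((hf.pd (i, k)).D_pow k).smul _

theorem ev_sub_sum_euler_mem [Fintype ι] {X : ι → JetAlg odd} (hX : ∀ i, HasParity (odd i) (X i))
    (f : JetAlg odd) :
    ev X hX f - ∑ i, euler odd i f * X i ∈ LinearMap.range (D odd) := by
  obtain ⟨K₀, hK₀⟩ := exists_orderLT f
  obtain ⟨K, hK, hKK⟩ := ((eventually_der_eq_sum_pd (fun x => (hX x.1).D_pow x.2) f).and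
    (Filter.eventually_ge_atTop K₀)).exists
  rw [ev, hK, ← Finset.sum_sub_distrib]
  refine Submodule.sum_mem _ fun i _ => ?_
  rw [euler_eq_sum (hK₀.mono hKK), Finset.sum_mul, ← Finset.sum_sub_distrib]
  exact Submodule.sum_mem _ fun k _ => mul_D_pow_sub_mem _ _ k

theorem ev_ev_sub_sum_euler_mem [Fintype ι] {X Y : ι → JetAlg odd}
    (hX : ∀ i, HasParity (odd i) (X i)) (hY : ∀ i, HasParity (odd i) (Y i)) (f : JetAlg odd) :
    ev X hX (ev Y hY f) -
      (∑ i, ev X hX (euler odd i f) * Y i + ∑ i, euler odd i f * ev X hX (Y i)) ∈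
        LinearMap.range (D odd) := by
  obtain ⟨s, hs⟩ := ev_sub_sum_euler_mem hY f
  refine ⟨ev X hX s, ?_⟩
  rw [← ev_D, hs, map_sub, map_sum, ← Finset.sum_add_distrib]
  simp only [ev_mul]

/-- The Fréchet derivative of a variational gradient is self-adjoint: this is the commutator of the
evolutionary derivations `ev X` and `ev Y`, evaluated on `∫ f`. -/
theorem sum_ev_euler_mul_sub_mem [Fintype ι] {X Y : ι → JetAlg odd}
    (hX : ∀ i, HasParity (odd i) (X i)) (hY : ∀ i, HasParity (odd i) (Y i)) (f : JetAlg odd) :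
    ∑ i, ev X hX (euler odd i f) * Y i - ∑ i, ev Y hY (euler odd i f) * X i ∈
      LinearMap.range (D odd) := by
  have hcomm := ev_sub_sum_euler_mem (X := fun i => ev X hX (Y i) - ev Y hY (X i))
    (fun i => ((hY i).ev hX).sub ((hX i).ev hY)) f
  rw [← ev_ev_sub] at hcomm
  convert sub_mem (sub_mem hcomm (ev_ev_sub_sum_euler_mem hX hY f))
    (neg_mem (ev_ev_sub_sum_euler_mem hY hX f)) using 1
  simp only [mul_sub, Finset.sum_sub_distrib]
  abel

theorem pd_mul_gen_sq {j : ι} (hj : odd j = false) (y : JetAlg odd) (k L : ℕ) :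
    pd odd (j, k) (y * gen odd (j, L) ^ 2) = pd odd (j, k) y * gen odd (j, L) ^ 2 +
      if L = k then (2 : ℂ) • (y * gen odd (j, L)) else 0 := by
  simp only [sq, pd_mul, pd_gen, hj, twist, Bool.false_eq_true, if_false, AlgHom.id_apply,
    Prod.mk.injEq, true_and]
  split_ifs
  · rw [mul_one, one_mul, mul_add, two_smul, add_comm]
  · simp

theorem euler_mul_gen_sq {j : ι} (hj : odd j = false) {L : ℕ} {y : JetAlg odd}
    (hy : OrderLT L y) :
    euler odd j (y * gen odd (j, L) ^ 2) = ∑ k ∈ Finset.range L,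
      ((-D odd) ^ k : Module.End ℂ (JetAlg odd)) (pd odd (j, k) y * gen odd (j, L) ^ 2) +
        ((-D odd) ^ L : Module.End ℂ (JetAlg odd)) ((2 : ℂ) • (y * gen odd (j, L))) := by
  have hu : OrderLT (L + 1) (gen odd (j, L)) := orderLT_gen L.lt_succ_self
  rw [euler_eq_sum (sq (gen odd (j, L)) ▸ (hy.mono L.le_succ).mul (hu.mul hu)),
    Finset.sum_range_succ, pd_mul_gen_sq hj, if_pos rfl, hy (j, L) le_rfl, zero_mul, zero_add]
  congr 1
  refine Finset.sum_congr rfl fun k hk => ?_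
  rw [pd_mul_gen_sq hj, if_neg (Finset.mem_range.1 hk).ne', add_zero]

/-- The variational derivative of `y u_L²` contains `2 u_{2L}` with coefficient `±y`, and every
other contribution has order below `2L`. -/
theorem eq_zero_of_mul_gen_sq_mem {j : ι} (hj : odd j = false) {L : ℕ} {y : JetAlg odd}
    (hy : OrderLT L y) (h : y * gen odd (j, L) ^ 2 ∈ LinearMap.range (D odd)) : y = 0 := by
  obtain ⟨s, hs⟩ := h
  have hu : OrderLT (L + 1) (gen odd (j, L)) := orderLT_gen L.lt_succ_self
  have hy' : OrderLT (L + 1) y := hy.mono L.le_succ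
  have heuler := euler_mul_gen_sq hj hy
  rw [← hs, euler_D] at heuler
  have hlow : ∀ k ∈ Finset.range L, pd odd (j, L + L) (((-D odd) ^ k : Module.End ℂ (JetAlg odd))
      (pd odd (j, k) y * gen odd (j, L) ^ 2)) = 0 := fun k hk => by
    have hkL := Finset.mem_range.1 hk
    rw [neg_D_pow_apply, map_smul, sq,
      ((hy'.pd (j, k)).mul (hu.mul hu)).D_pow k _ (by simp only; omega), smul_zero]
  have htop := congrArg (pd odd (j, L + L)) heuler
  rw [map_zero, map_add, map_sum, Finset.sum_eq_zero hlow, neg_D_pow_apply, map_smul, map_smul,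
    map_smul, (hy'.mul hu).pd_D_pow, pd_mul, hy (j, L) le_rfl, pd_gen, zero_add, if_pos rfl,
    mul_one, zero_mul, add_zero, smul_smul, eq_comm] at htop
  exact (smul_eq_zero.1 htop).resolve_left (by simp)

end Euler

theorem eq_zero_of_sum_mul_mem [Fintype ι] {j : ι} (hj : odd j = false) {g : ι → JetAlg odd}
    (h : ∀ X : ι → JetAlg odd, (∀ i, HasParity (odd i) (X i)) →
      ∑ i, g i * X i ∈ LinearMap.range (D odd)) : g = 0 := by
  classical
  funext i
  obtain ⟨K, hK⟩ := exists_orderLT (g i)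
  have hgu : g i * gen odd (i, K) = 0 := by
    have hK' : OrderLT (K + 1) (gen odd (i, K)) := orderLT_gen K.lt_succ_self
    refine eq_zero_of_mul_gen_sq_mem hj ((hK.mono K.le_succ).mul hK') ?_
    have hu := hasParity_gen (odd := odd) (j, K + 1)
    have hX := (hasParity_gen (odd := odd) (i, K)).mul (hu.mul hu)
    rw [Bool.xor_self, Bool.xor_false] at hX
    have hsum := h (Pi.single i (gen odd (i, K) * gen odd (j, K + 1) ^ 2)) fun l => by
      obtain rfl | hl := eq_or_ne l i
      · simpa [sq] using hX
      · rw [Pi.single_eq_of_ne hl]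
        exact HasParity.zero _
    rwa [Finset.sum_eq_single i (fun l _ hl => by rw [Pi.single_eq_of_ne hl, mul_zero])
      (by simp), Pi.single_eq_same, ← mul_assoc] at hsum
  have hpd := congrArg (pd odd (i, K)) hgu
  rwa [pd_mul, hK (i, K) le_rfl, pd_gen, if_pos rfl, mul_one, zero_mul, add_zero, map_zero] at hpd

end JetAlg

/-! ### A reflective decision procedure for differential superpolynomials -/

/-- A supercommutative algebra, graded by the automorphism `par`, which is `1` on even and `-1` on
odd elements. -/
class SuperAlg (S : Type*) [Ring S] [Algebra ℂ S] where
  par : S →+* S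
  comm_of_even : ∀ x y : S, par x = x → x * y = y * x
  anticomm_of_odd : ∀ x y : S, par x = -x → par y = -y → x * y = -(y * x)

namespace SuperAlg

/-- The kind of an atom of an expression; a `const` is even and has derivative zero. -/
inductive Kind
  | even | odd | const

/-- The dyadic number `n / 2 ^ k`, as the pair `(n, k)`: unlike rational numbers, these need no
reduction to lowest terms when the kernel evaluates a sum. -/
abbrev Coef := ℤ × ℕ

namespace Coef

def mul (a b : Coef) : Coef := (a.1 * b.1, a.2 + b.2)

def neg (a : Coef) : Coef := (-a.1, a.2)

def add (a b : Coef) : Coef :=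
  bif Nat.ble a.2 b.2 then (a.1 * 2 ^ (b.2 - a.2) + b.1, b.2)
  else (a.1 + b.1 * 2 ^ (a.2 - b.2), a.2)

def isZero (a : Coef) : Bool := Nat.beq a.1.natAbs 0

noncomputable def val (a : Coef) : ℂ := a.1 / 2 ^ a.2

theorem val_mul (a b : Coef) : (mul a b).val = a.val * b.val := by
  simp only [mul, val, pow_add, Int.cast_mul]
  ring

theorem val_neg (a : Coef) : (neg a).val = -a.val := by
  simp only [neg, val, Int.cast_neg]
  ring

theorem val_mul_two_pow_sub {k l : ℕ} (h : k ≤ l) (n : ℤ) :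
    val (n * 2 ^ (l - k), l) = val (n, k) := by
  simp only [val]
  rw [div_eq_div_iff (pow_ne_zero _ two_ne_zero) (pow_ne_zero _ two_ne_zero)]
  push_cast
  rw [mul_assoc, ← pow_add, Nat.sub_add_cancel h]

theorem val_add_of_eq (m n : ℤ) (k : ℕ) : val (m + n, k) = val (m, k) + val (n, k) := by
  simp only [val, Int.cast_add, add_div]

theorem val_add (a b : Coef) : (add a b).val = a.val + b.val := by
  unfold add
  cases h : Nat.ble a.2 b.2 with
  | true =>
    rw [cond_true, val_add_of_eq, val_mul_two_pow_sub (Nat.le_of_ble_eq_true h)]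
  | false =>
    have hba : b.2 ≤ a.2 :=
      le_of_lt (not_le.1 fun hab => Bool.false_ne_true (h ▸ Nat.ble_eq_true_of_le hab))
    rw [cond_false, val_add_of_eq, val_mul_two_pow_sub hba]

theorem val_of_isZero {a : Coef} (h : a.isZero = true) : a.val = 0 := by
  have hnum : a.1 = 0 := Int.natAbs_eq_zero.1 (Nat.eq_of_beq_eq_true h)
  simp [val, hnum]

end Coef

/-- Expressions for differential superpolynomials in atoms numbered by `ℕ`. -/
inductive SExpr
  | var (i : ℕ)
  | const (q : Coef)
  | add (e f : SExpr)
  | sub (e f : SExpr)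
  | mul (e f : SExpr)
  | neg (e : SExpr)
  | der (e : SExpr)

/-- The pair `(i, k)` stands for the `k`-th derivative of the atom with number `i`. -/
abbrev Jet := ℕ × ℕ

/-- A coefficient times a monomial, whose jets are listed in increasing order of `code`. -/
abbrev Term := Coef × List Jet

def Kind.isOdd : Kind → Bool
  | odd => true
  | _ => false

def Kind.isConst : Kind → Bool
  | const => true
  | _ => false

def jetOdd (ks : List Kind) (v : Jet) : Bool := (ks.getD v.1 .even).isOdd

/-- The sorting key of jets. It is injective on jets of order less than `64`; soundness of the
procedure needs no such property, only its success does. -/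
def code (v : Jet) : ℕ := 64 * v.1 + v.2

/-- The product of the jet `v` and the term `(c, m)`: moving `v` to its place in `m` costs a sign
for every odd jet that an odd `v` passes. -/
def ins (ks : List Kind) (v : Jet) (c : Coef) : List Jet → Term
  | [] => (c, [v])
  | w :: m =>
    bif Nat.ble (code v) (code w) then
      bif jetOdd ks v && (Nat.beq v.1 w.1 && Nat.beq v.2 w.2) then ((0, 0), [])
      else (c, v :: w :: m)
    else
      ((bif jetOdd ks v && jetOdd ks w then (ins ks v c m).1.neg else (ins ks v c m).1),
        w :: (ins ks v c m).2)

def mulMono (ks : List Kind) (m : List Jet) (t : Term) : Term :=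
  m.foldr (fun v t => ins ks v t.1 t.2) t

def mulTerms (ks : List Kind) (p q : List Term) : List Term :=
  p.flatMap fun s => q.map fun t => mulMono ks s.2 (s.1.mul t.1, t.2)

def negTerms (p : List Term) : List Term := p.map fun t => (t.1.neg, t.2)

def derMono (ks : List Kind) (c : Coef) : List Jet → List Term
  | [] => []
  | v :: m =>
    (bif (ks.getD v.1 .even).isConst then [] else [ins ks (v.1, v.2 + 1) c m]) ++
      (derMono ks c m).map fun t => ins ks v t.1 t.2

def derTerms (ks : List Kind) (p : List Term) : List Term :=
  p.flatMap fun t => derMono ks t.1 t.2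

/-- The expansion of an expression into terms, with like terms not yet collected. -/
def SExpr.terms (ks : List Kind) : SExpr → List Term
  | var i => [((1, 0), [(i, 0)])]
  | const q => [(q, [])]
  | add e f => e.terms ks ++ f.terms ks
  | sub e f => e.terms ks ++ negTerms (f.terms ks)
  | mul e f => mulTerms ks (e.terms ks) (f.terms ks)
  | neg e => negTerms (e.terms ks)
  | der e => derTerms ks (e.terms ks)

/-- A binary search tree of terms, used to collect like terms. -/
inductive Tree
  | nil
  | node (l : Tree) (c : Coef) (m : List Jet) (r : Tree)

/-- The lexicographic order of monomials. -/
def cmp : List Jet → List Jet → Ordering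
  | [], [] => .eq
  | [], _ :: _ => .lt
  | _ :: _, [] => .gt
  | v :: m, w :: n =>
    bif Nat.beq v.1 w.1 then
      bif Nat.beq v.2 w.2 then cmp m n else bif Nat.ble v.2 w.2 then .lt else .gt
    else bif Nat.ble v.1 w.1 then .lt else .gt

def Tree.insert (c : Coef) (m : List Jet) : Tree → Tree
  | nil => node nil c m nil
  | node l d n r =>
    match cmp m n with
    | .eq => node l (c.add d) n r
    | .lt => node (l.insert c m) d n r
    | .gt => node l d n (r.insert c m)

def Tree.isZero : Tree → Bool
  | nil => true
  | node l c _ r => l.isZero && (c.isZero && r.isZero)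

/-- The terms of a tree with nonzero coefficient, prepended to a list. -/
def Tree.toTerms : Tree → List Term → List Term
  | nil, p => p
  | node l c m r, p =>
    bif c.isZero then l.toTerms (r.toTerms p) else (c, m) :: l.toTerms (r.toTerms p)

/-- `forceNat n k = k n`, but matching on `n` makes the kernel evaluate it before `k` is applied.
Without this, unevaluated arguments are duplicated by the recursions below and evaluation blows
up. -/
def forceNat {β : Type*} (n : ℕ) (k : ℕ → β) : β :=
  match n with
  | 0 => k 0
  | n + 1 => k n.succ

def forceMono {β : Type*} : List Jet → (List Jet → β) → β
  | [], k => k []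
  | v :: m, k => forceNat v.1 fun i => forceNat v.2 fun j => forceMono m fun m => k ((i, j) :: m)

def forceTerm {β : Type*} (t : Term) (k : Term → β) : β :=
  forceNat t.1.2 fun e => forceMono t.2 fun m =>
    match t.1.1 with
    | .ofNat n => forceNat n fun n => k ((.ofNat n, e), m)
    | .negSucc n => forceNat n fun n => k ((.negSucc n, e), m)

def forceTerms {β : Type*} : List Term → (List Term → β) → β
  | [], k => k []
  | t :: p, k => forceTerm t fun t => forceTerms p fun p => k (t :: p)

def collectInto : List Term → Tree → Tree
  | [], T => T
  | t :: p, T => forceTerm t fun t => collectInto p (T.insert t.1 t.2)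

def collect (p : List Term) : Tree := collectInto p .nil

def isZero (p : List Term) : Bool := (collect p).isZero

/-- Lowers by one the order of the first differentiated atom with number at least `h`. -/
def lower (ks : List Kind) (h : ℕ) (t : Term) : List Jet → Option Term
  | [] => none
  | v :: m =>
    bif Nat.ble h v.1 && Nat.ble 1 v.2 then some (ins ks (v.1, v.2 - 1) t.1 m)
    else (lower ks h t m).map fun t => ins ks v t.1 t.2

/-- An antiderivative, found by `n` rounds of integration by parts that move the derivatives off
the atoms with number at least `h`, in which the terms should be linear. The result need not be
correct: it is checked by differentiation. -/
def antiTerms (ks : List Kind) (h : ℕ) : ℕ → List Term → List Term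
  | 0, _ => []
  | n + 1, p =>
    forceTerms ((collect p).toTerms []) fun p =>
      forceTerms (p.filterMap fun t => lower ks h t t.2) fun q =>
        q ++ antiTerms ks h n (p ++ negTerms (derTerms ks q))

section Values

variable {S : Type*} [Ring S] [Algebra ℂ S]

/-- A parity preserving derivation. -/
structure IsEvenDer [SuperAlg S] (D : S →ₗ[ℂ] S) : Prop where
  leibniz : ∀ x y, D (x * y) = D x * y + x * D y
  par : ∀ x, par (D x) = D (par x)

/-- The element `x` is a legitimate value of an atom of the given kind. -/
def HasKind [SuperAlg S] (D : S →ₗ[ℂ] S) : Kind → S → Prop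
  | .even, x => par x = x
  | .odd, x => par x = -x
  | .const, x => par x = x ∧ D x = 0

variable (D : S →ₗ[ℂ] S) (env : List S)

/-- The value of a jet when the atoms take the values `env`, and likewise below. -/
def jetVal (v : Jet) : S := (D ^ v.2 : Module.End ℂ S) (env.getD v.1 0)

def monoVal (m : List Jet) : S := (m.map (jetVal D env)).prod

noncomputable def termVal (t : Term) : S := t.1.val • monoVal D env t.2

noncomputable def termsVal (p : List Term) : S := (p.map (termVal D env)).sum

noncomputable def SExpr.val : SExpr → S
  | var i => env.getD i 0
  | const q => algebraMap ℂ S q.val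
  | add e f => e.val + f.val
  | sub e f => e.val - f.val
  | mul e f => e.val * f.val
  | neg e => -e.val
  | der e => D e.val

noncomputable def Tree.val : Tree → S
  | nil => 0
  | node l c m r => l.val + c.val • monoVal D env m + r.val

variable {D env}

theorem jetVal_succ (i k : ℕ) : jetVal D env (i, k + 1) = D (jetVal D env (i, k)) := by
  simp only [jetVal, pow_succ', Module.End.mul_apply]

theorem monoVal_nil : monoVal D env [] = 1 := rfl

theorem monoVal_cons (v : Jet) (m : List Jet) :
    monoVal D env (v :: m) = jetVal D env v * monoVal D env m := by
  simp only [monoVal, List.map_cons, List.prod_cons]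

theorem termsVal_nil : termsVal D env [] = 0 := rfl

theorem termsVal_cons (t : Term) (q : List Term) :
    termsVal D env (t :: q) = termVal D env t + termsVal D env q := by
  simp only [termsVal, List.map_cons, List.sum_cons]

theorem termsVal_singleton (t : Term) : termsVal D env [t] = termVal D env t := by
  rw [termsVal_cons, termsVal_nil, add_zero]

theorem termsVal_append (p q : List Term) :
    termsVal D env (p ++ q) = termsVal D env p + termsVal D env q := by
  simp only [termsVal, List.map_append, List.sum_append]

theorem termsVal_flatMap (φ : S →+ S) {f : Term → List Term}
    (h : ∀ t, termsVal D env (f t) = φ (termVal D env t)) (p : List Term) :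
    termsVal D env (p.flatMap f) = φ (termsVal D env p) := by
  induction p with
  | nil => exact (map_zero φ).symm
  | cons t p ih => rw [List.flatMap_cons, termsVal_append, ih, h, termsVal_cons, map_add]

theorem termsVal_map (φ : S →+ S) {f : Term → Term}
    (h : ∀ t, termVal D env (f t) = φ (termVal D env t)) (p : List Term) :
    termsVal D env (p.map f) = φ (termsVal D env p) := by
  rw [List.map_eq_flatMap]
  exact termsVal_flatMap φ (fun t => (termsVal_singleton _).trans (h t)) p

theorem termVal_neg (t : Term) : termVal D env (t.1.neg, t.2) = -termVal D env t := by
  rw [termVal, Coef.val_neg, neg_smul, termVal]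

theorem termsVal_neg (p : List Term) : termsVal D env (negTerms p) = -termsVal D env p :=
  termsVal_map (-AddMonoidHom.id S) termVal_neg p

theorem cmp_eq : ∀ {m n : List Jet}, cmp m n = .eq → m = n
  | [], [], _ => rfl
  | v :: m, w :: n, h => by
    unfold cmp at h
    cases hfst : Nat.beq v.1 w.1 with
    | false => cases hle : Nat.ble v.1 w.1 <;> simp [hfst, hle] at h
    | true =>
      cases hsnd : Nat.beq v.2 w.2 with
      | false => cases hle : Nat.ble v.2 w.2 <;> simp [hfst, hsnd, hle] at h
      | true =>
        rw [hfst, hsnd, cond_true, cond_true] at h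
        rw [cmp_eq h, Prod.ext (Nat.eq_of_beq_eq_true hfst) (Nat.eq_of_beq_eq_true hsnd)]

theorem Tree.val_insert (c : Coef) (m : List Jet) (T : Tree) :
    (T.insert c m).val D env = T.val D env + termVal D env (c, m) := by
  induction T with
  | nil => simp only [Tree.insert, Tree.val, termVal, add_zero]
  | node l d n r hl hr =>
    unfold Tree.insert
    cases h : cmp m n with
    | eq =>
      simp only [cmp_eq h, Tree.val, termVal, Coef.val_add, add_smul]
      abel
    | lt =>
      simp only [Tree.val, hl]
      abel
    | gt =>
      simp only [Tree.val, hr]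
      abel

theorem Tree.val_of_isZero {T : Tree} (h : T.isZero = true) : T.val D env = 0 := by
  induction T with
  | nil => rfl
  | node l d n r hl hr =>
    simp only [Tree.isZero, Bool.and_eq_true] at h
    simp only [Tree.val, hl h.1, hr h.2.2, Coef.val_of_isZero h.2.1, zero_smul, add_zero]

theorem forceNat_eq {β : Type*} (n : ℕ) (k : ℕ → β) : forceNat n k = k n := by
  cases n <;> rfl

theorem forceMono_eq {β : Type*} (m : List Jet) (k : List Jet → β) : forceMono m k = k m := by
  induction m generalizing k with
  | nil => rfl
  | cons v m ih => rw [forceMono, forceNat_eq, forceNat_eq, ih]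

theorem forceTerm_eq {β : Type*} (t : Term) (k : Term → β) : forceTerm t k = k t := by
  obtain ⟨⟨n, e⟩, m⟩ := t
  rw [forceTerm, forceNat_eq, forceMono_eq]
  cases n <;> simp only [forceNat_eq]

theorem val_collectInto (p : List Term) (T : Tree) :
    (collectInto p T).val D env = T.val D env + termsVal D env p := by
  induction p generalizing T with
  | nil => exact (add_zero _).symm
  | cons t p ih => rw [collectInto, forceTerm_eq, ih, Tree.val_insert, termsVal_cons, add_assoc]

theorem termsVal_eq_zero {p : List Term} (h : isZero p = true) : termsVal D env p = 0 := by
  have hval : (collect p).val D env = 0 := Tree.val_of_isZero h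
  rwa [collect, val_collectInto, Tree.val, zero_add] at hval

variable [SuperAlg S] {ks : List Kind}

theorem mul_self_of_odd {x : S} (hx : par x = -x) : x * x = 0 := by
  have : IsAddTorsionFree S := .of_isTorsionFree ℂ S
  exact self_eq_neg.1 (anticomm_of_odd x x hx hx)

theorem IsEvenDer.map_one {D : S →ₗ[ℂ] S} (hD : IsEvenDer D) : D 1 = 0 := by
  simpa using hD.leibniz 1 1

theorem hasKind_getD (hk : List.Forall₂ (HasKind D) ks env) (i : ℕ) :
    HasKind D (ks.getD i .even) (env.getD i 0) := by
  induction hk generalizing i with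
  | nil => simp [HasKind]
  | cons h _ ih =>
    cases i with
    | zero => simpa using h
    | succ i => simpa using ih i

theorem map_jetVal_of_isConst (hk : List.Forall₂ (HasKind D) ks env) {v : Jet}
    (hv : (ks.getD v.1 .even).isConst = true) :
    D (jetVal D env v) = 0 := by
  have hconst : D (env.getD v.1 0) = 0 := by
    have hkind := hasKind_getD hk v.1
    revert hkind hv
    cases ks.getD v.1 .even <;> simp +contextual [Kind.isConst, HasKind]
  rw [← jetVal_succ, jetVal, pow_succ, Module.End.mul_apply, hconst, map_zero]

section Atoms

variable (hD : IsEvenDer D) (hk : List.Forall₂ (HasKind D) ks env)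

include hD hk

theorem par_jetVal (v : Jet) :
    par (jetVal D env v) = if jetOdd ks v then -jetVal D env v else jetVal D env v := by
  obtain ⟨i, k⟩ := v
  induction k with
  | zero =>
    have hkind := hasKind_getD hk i
    simp only [jetVal, pow_zero, Module.End.one_apply, jetOdd]
    revert hkind
    cases ks.getD i .even <;> simp +contextual [HasKind, Kind.isOdd]
  | succ k ih =>
    rw [jetVal_succ, hD.par, ih, show jetOdd ks (i, k + 1) = jetOdd ks (i, k) from rfl]
    split_ifs
    · rw [map_neg]
    · rfl

theorem jetVal_mul_comm (v w : Jet) : jetVal D env v * jetVal D env w =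
    if jetOdd ks v && jetOdd ks w then -(jetVal D env w * jetVal D env v)
    else jetVal D env w * jetVal D env v := by
  have hv := par_jetVal hD hk v
  have hw := par_jetVal hD hk w
  cases hvo : jetOdd ks v <;> cases hwo : jetOdd ks w <;>
    simp only [hvo, hwo, Bool.false_eq_true, if_false, if_true, Bool.and_true,
      Bool.and_false] at hv hw ⊢
  · exact comm_of_even _ _ hv
  · exact comm_of_even _ _ hv
  · exact (comm_of_even _ _ hw).symm
  · exact anticomm_of_odd _ _ hv hw

theorem jetVal_mul_self {v : Jet} (hv : jetOdd ks v = true) :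
    jetVal D env v * jetVal D env v = 0 :=
  mul_self_of_odd ((par_jetVal hD hk v).trans (if_pos hv))

theorem termVal_ins (v : Jet) (t : Term) :
    termVal D env (ins ks v t.1 t.2) = jetVal D env v * termVal D env t := by
  obtain ⟨c, m⟩ := t
  simp only [termVal, mul_smul_comm]
  induction m with
  | nil => simp only [ins, monoVal_cons]
  | cons w m ih =>
    unfold ins
    cases hle : Nat.ble (code v) (code w) with
    | true =>
      cases heq : jetOdd ks v && (Nat.beq v.1 w.1 && Nat.beq v.2 w.2) with
      | true =>
        simp only [Bool.and_eq_true] at heq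
        obtain ⟨hodd, hfst, hsnd⟩ := heq
        obtain rfl : v = w :=
          Prod.ext (Nat.eq_of_beq_eq_true hfst) (Nat.eq_of_beq_eq_true hsnd)
        rw [monoVal_cons, ← mul_assoc, jetVal_mul_self hD hk hodd]
        simp [Coef.val]
      | false => simp only [cond_true, cond_false, monoVal_cons]
    | false =>
      rw [cond_false, monoVal_cons, monoVal_cons, ← mul_assoc, jetVal_mul_comm hD hk]
      cases jetOdd ks v && jetOdd ks w with
      | true =>
        rw [cond_true, if_pos rfl, Coef.val_neg, neg_smul, ← mul_smul_comm, ih, mul_smul_comm,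
          neg_mul, smul_neg, mul_assoc]
      | false =>
        rw [cond_false, if_neg Bool.false_ne_true, ← mul_smul_comm, ih, mul_smul_comm, mul_assoc]

theorem termVal_mulMono (m : List Jet) (t : Term) :
    termVal D env (mulMono ks m t) = monoVal D env m * termVal D env t := by
  induction m with
  | nil => rw [monoVal_nil, one_mul, mulMono, List.foldr_nil]
  | cons v m ih =>
    rw [mulMono, List.foldr_cons, termVal_ins hD hk, ← mulMono, ih, monoVal_cons, mul_assoc]

theorem termVal_mulMono_mul (s t : Term) :
    termVal D env (mulMono ks s.2 (s.1.mul t.1, t.2)) = termVal D env s * termVal D env t := by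
  rw [termVal_mulMono hD hk]
  simp only [termVal, Coef.val_mul, mul_smul_comm, smul_mul_assoc, smul_smul, mul_comm s.1.val]

theorem termsVal_mul (p q : List Term) :
    termsVal D env (mulTerms ks p q) = termsVal D env p * termsVal D env q :=
  termsVal_flatMap (AddMonoidHom.mulRight (termsVal D env q))
    (fun s => termsVal_map (AddMonoidHom.mulLeft (termVal D env s))
      (termVal_mulMono_mul hD hk s) q) p

theorem termsVal_derMono (c : Coef) (m : List Jet) :
    termsVal D env (derMono ks c m) = D (termVal D env (c, m)) := by
  induction m with
  | nil => rw [derMono, termsVal_nil, termVal, monoVal_nil, map_smul, hD.map_one, smul_zero]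
  | cons v m ih =>
    have hfirst : termsVal D env (bif (ks.getD v.1 .even).isConst then []
        else [ins ks (v.1, v.2 + 1) c m]) = D (jetVal D env v) * termVal D env (c, m) := by
      cases hv : (ks.getD v.1 .even).isConst with
      | false => rw [cond_false, termsVal_singleton, termVal_ins hD hk _ (c, m), jetVal_succ]
      | true => rw [cond_true, termsVal_nil, map_jetVal_of_isConst hk hv, zero_mul]
    have hrest := termsVal_map (AddMonoidHom.mulLeft (jetVal D env v))
      (termVal_ins hD hk v) (derMono ks c m)
    rw [derMono, termsVal_append, hfirst, hrest, ih]
    simp only [termVal, monoVal_cons, AddMonoidHom.coe_mulLeft, map_smul, hD.leibniz, smul_add,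
      mul_smul_comm]

theorem termsVal_der (p : List Term) :
    termsVal D env (derTerms ks p) = D (termsVal D env p) :=
  termsVal_flatMap D.toAddMonoidHom (fun t => termsVal_derMono hD hk t.1 t.2) p

theorem SExpr.termsVal_terms (e : SExpr) : termsVal D env (e.terms ks) = e.val D env := by
  induction e with
  | var i => simp [SExpr.terms, SExpr.val, termsVal, termVal, monoVal, jetVal, Coef.val]
  | const q => simp [SExpr.terms, SExpr.val, termsVal, termVal, monoVal, Algebra.smul_def]
  | add e f he hf => rw [SExpr.terms, termsVal_append, he, hf, SExpr.val]
  | sub e f he hf =>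
    rw [SExpr.terms, termsVal_append, termsVal_neg, he, hf, SExpr.val, sub_eq_add_neg]
  | mul e f he hf => rw [SExpr.terms, termsVal_mul hD hk, he, hf, SExpr.val]
  | neg e he => rw [SExpr.terms, termsVal_neg, he, SExpr.val]
  | der e he => rw [SExpr.terms, termsVal_der hD hk, he, SExpr.val]

end Atoms

end Values

section Reify

variable {S : Type*} [Ring S] [Algebra ℂ S]

/-- `x` is the atom with number `i` in `env`; instance search finds `i`. -/
class IsAtom (env : List S) (x : S) (i : outParam ℕ) : Prop where
  eq : x = env.getD i 0

instance (priority := high) (x : S) (env : List S) : IsAtom (x :: env) x 0 := ⟨rfl⟩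

instance (x y : S) (env : List S) (i : ℕ) [h : IsAtom env x i] : IsAtom (y :: env) x (i + 1) :=
  ⟨by rw [h.eq]; rfl⟩

/-- `c` is the dyadic number `q`; instance search finds `q`. -/
class IsDyadic (c : ℂ) (q : outParam Coef) : Prop where
  eq : c = q.val

instance : IsDyadic (1 / 2) (1, 1) := ⟨by norm_num [Coef.val]⟩

instance : IsDyadic (1 / 4) (1, 2) := ⟨by norm_num [Coef.val]⟩

instance : IsDyadic 1 (1, 0) := ⟨by norm_num [Coef.val]⟩

instance : IsDyadic 2 (2, 0) := ⟨by norm_num [Coef.val]⟩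

instance (c : ℂ) (q : Coef) [h : IsDyadic c q] : IsDyadic (-c) (-q.1, q.2) :=
  ⟨by rw [h.eq]; simp [Coef.val, neg_div]⟩

/-- `x` is the value of the expression `e`; instance search finds `e`. -/
class Reify (D : S →ₗ[ℂ] S) (env : List S) (x : S) (e : outParam SExpr) : Prop where
  eq : x = e.val D env

variable (D : S →ₗ[ℂ] S) (env : List S)

instance (priority := low) (x : S) (i : ℕ) [h : IsAtom env x i] : Reify D env x (.var i) := ⟨h.eq⟩

instance : Reify D env 0 (.const (0, 0)) := ⟨by simp [SExpr.val, Coef.val]⟩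

instance : Reify D env 1 (.const (1, 0)) := ⟨by simp [SExpr.val, Coef.val]⟩

instance : Reify D env 2 (.const (2, 0)) := ⟨by simp [SExpr.val, Coef.val, map_ofNat]⟩

instance : Reify D env 4 (.const (4, 0)) := ⟨by simp [SExpr.val, Coef.val, map_ofNat]⟩

instance (x y : S) (e f : SExpr) [hx : Reify D env x e] [hy : Reify D env y f] :
    Reify D env (x + y) (.add e f) := ⟨by rw [SExpr.val, ← hx.eq, ← hy.eq]⟩

instance (x y : S) (e f : SExpr) [hx : Reify D env x e] [hy : Reify D env y f] :
    Reify D env (x - y) (.sub e f) := ⟨by rw [SExpr.val, ← hx.eq, ← hy.eq]⟩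

instance (x y : S) (e f : SExpr) [hx : Reify D env x e] [hy : Reify D env y f] :
    Reify D env (x * y) (.mul e f) := ⟨by rw [SExpr.val, ← hx.eq, ← hy.eq]⟩

instance (x : S) (e : SExpr) [hx : Reify D env x e] : Reify D env (-x) (.neg e) :=
  ⟨by rw [SExpr.val, ← hx.eq]⟩

instance (x : S) (e : SExpr) [hx : Reify D env x e] : Reify D env (D x) (.der e) :=
  ⟨by rw [SExpr.val, ← hx.eq]⟩

instance (c : ℂ) (q : Coef) (x : S) (e : SExpr) [hc : IsDyadic c q] [hx : Reify D env x e] :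
    Reify D env (c • x) (.mul (.const q) e) :=
  ⟨by rw [SExpr.val, ← hx.eq, SExpr.val, ← hc.eq, Algebra.smul_def]⟩

instance (priority := low) (c : ℂ) (i : ℕ) (x : S) (e : SExpr)
    [hc : IsAtom env (algebraMap ℂ S c) i] [hx : Reify D env x e] :
    Reify D env (c • x) (.mul (.var i) e) :=
  ⟨by rw [SExpr.val, ← hx.eq, SExpr.val, ← hc.eq, Algebra.smul_def]⟩

variable {D} [SuperAlg S]

theorem eq_of_check (hD : IsEvenDer D) (ks : List Kind) (env : List S)
    (hk : List.Forall₂ (HasKind D) ks env) {x y : S} {e f : SExpr}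
    [hx : Reify D env x e] [hy : Reify D env y f]
    (h : isZero ((SExpr.sub e f).terms ks) = true) : x = y := by
  have hval := termsVal_eq_zero (D := D) (env := env) h
  rw [SExpr.termsVal_terms hD hk, SExpr.val, ← hx.eq, ← hy.eq] at hval
  exact sub_eq_zero.1 hval

theorem mem_range_of_check (hD : IsEvenDer D) (ks : List Kind) (env : List S)
    (hk : List.Forall₂ (HasKind D) ks env) (i n : ℕ) {x : S} {e : SExpr} [hx : Reify D env x e]
    (h : isZero (e.terms ks ++ negTerms (derTerms ks (antiTerms ks i n (e.terms ks)))) = true) :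
    x ∈ LinearMap.range D := by
  have hval := termsVal_eq_zero (D := D) (env := env) h
  rw [termsVal_append, termsVal_neg, SExpr.termsVal_terms hD hk, termsVal_der hD hk,
    ← hx.eq, ← sub_eq_add_neg] at hval
  exact ⟨_, (sub_eq_zero.1 hval).symm⟩

end Reify

end SuperAlg

open JetAlg SuperAlg

-- Reification solves one instance problem per node of a large expression.
set_option synthInstance.maxSize 100000

/-! ### The Hamiltonian operators -/

instance {ι : Type} (odd : ι → Bool) : SuperAlg (JetAlg odd) where
  par := (parity odd).toRingHom
  comm_of_even _ y hx := IsEven.mul_comm hx y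
  anticomm_of_odd _ _ hx hy := IsOdd.anticomm hx hy

theorem isEvenDer_D {ι : Type} (odd : ι → Bool) : IsEvenDer (D odd) :=
  ⟨D_mul, parity_D⟩

/-- A column whose entries have the parities of the fields, such as a characteristic of a flow or
the gradient of an even functional. -/
abbrev Typed (G : Fin 4 → Alg) : Prop := ∀ i, HasParity (oddField i) (G i)

theorem Typed.kinds {G : Fin 4 → Alg} (hG : Typed G) :
    HasKind dx .even (G 0) ∧ HasKind dx .even (G 1) ∧ HasKind dx .odd (G 2) ∧
      HasKind dx .odd (G 3) :=
  ⟨hasParity_false.1 (hG 0), hasParity_false.1 (hG 1), hasParity_true.1 (hG 2),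
    hasParity_true.1 (hG 3)⟩

theorem Typed.parity {G : Fin 4 → Alg} (hG : Typed G) :
    JetAlg.parity oddField (G 0) = G 0 ∧ JetAlg.parity oddField (G 1) = G 1 ∧
      JetAlg.parity oddField (G 2) = -G 2 ∧ JetAlg.parity oddField (G 3) = -G 3 :=
  hG.kinds

theorem hasKind_algebraMap (c : ℂ) : HasKind dx .const (algebraMap ℂ Alg c) :=
  ⟨(parity oddField).commutes c, D_algebraMap c⟩

theorem typed_field : Typed field := fun i => hasParity_gen (i, 0)

/-- The column `(c₁ J + c₂ R) G`, written out so that the decision procedure can read it. -/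
def pencilAct (c₁ c₂ : ℂ) (G : Fin 4 → Alg) : Fin 4 → Alg :=
  let h : ℂ := 1 / 2
  let q : ℂ := 1 / 4
  ![c₁ • -dx (G 1) +
      c₂ • (-(2 * dx (G 0)) + h • dx (dx (G 1)) - h • dx (fv * G 1) - dx (fα * G 3)),
    c₁ • (-dx (G 0) - h • (fα * G 2) + h • (fβ * G 3)) +
      c₂ • (-(h • (fv * dx (G 0))) - h • dx (dx (G 0)) - h • (fw * dx (G 1)) - h • dx (fw * G 1)
        - dx (G 1) - q • dx (fα * G 2) - q • (fv * (fα * G 2)) - h • (fβ * G 2)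
        + q • dx (fβ * G 3) + (fw + 1) * (fα * G 3) + q • (fv * (fβ * G 3))),
    c₁ • (-(h • (fα * G 1)) - h • G 3) +
      c₂ • (q • (fα * dx (G 1)) - q • (fv * (fα * G 1)) - h • (fβ * G 1) + h • G 2 + h • dx (G 3)
        - q • (fv * G 3)),
    c₁ • (h • (fβ * G 1) - h • G 2) +
      c₂ • (fα * dx (G 0) - q • (fβ * dx (G 1)) + (fw + 1) * (fα * G 1) + q • (fv * (fβ * G 1))
        - h • dx (G 2) - q • (fv * G 2) + (fw + 1) * G 3 - fα * (fβ * G 3))]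

theorem act_pencil (c₁ c₂ : ℂ) (G : Fin 4 → Alg) :
    act (c₁ • J + c₂ • R) G = pencilAct c₁ c₂ G := by
  funext i
  fin_cases i <;>
    simp only [act, J, R, opJ, opR, pencilAct, Fin.sum_univ_four, Algebra.coe_lmul_eq_mul,
      Matrix.smul_of, Matrix.smul_cons, Matrix.smul_empty, Matrix.add_apply, Matrix.of_apply,
      Matrix.cons_val, Fin.zero_eta, Fin.mk_one, Fin.reduceFinMk, Fin.isValue,
      LinearMap.add_apply, LinearMap.sub_apply, LinearMap.neg_apply, LinearMap.smul_apply,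
      LinearMap.zero_apply, LinearMap.mul_apply_apply, Module.End.mul_apply, Module.End.one_apply,
      add_mul, one_mul, two_mul, smul_zero, zero_add, add_zero] <;>
    module

/-- The result of applying to `G` the Fréchet derivative in the direction `X` of the coefficients
of `c₁ J + c₂ R`. -/
def pencilVar (c₁ c₂ : ℂ) (X G : Fin 4 → Alg) : Fin 4 → Alg :=
  let h : ℂ := 1 / 2
  let q : ℂ := 1 / 4
  ![c₂ • (-(h • dx (X 0 * G 1)) - dx (X 2 * G 3)),
    c₁ • (-(h • (X 2 * G 2)) + h • (X 3 * G 3)) +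
      c₂ • (-(h • (X 0 * dx (G 0))) - h • (X 1 * dx (G 1)) - h • dx (X 1 * G 1)
        - q • dx (X 2 * G 2) - q • (X 0 * (fα * G 2)) - q • (fv * (X 2 * G 2)) - h • (X 3 * G 2)
        + q • dx (X 3 * G 3) + X 1 * (fα * G 3) + (fw + 1) * (X 2 * G 3) + q • (X 0 * (fβ * G 3))
        + q • (fv * (X 3 * G 3))),
    c₁ • -(h • (X 2 * G 1)) +
      c₂ • (q • (X 2 * dx (G 1)) - q • (X 0 * (fα * G 1)) - q • (fv * (X 2 * G 1))
        - h • (X 3 * G 1) - q • (X 0 * G 3)),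
    c₁ • (h • (X 3 * G 1)) +
      c₂ • (X 2 * dx (G 0) - q • (X 3 * dx (G 1)) + X 1 * (fα * G 1) + (fw + 1) * (X 2 * G 1)
        + q • (X 0 * (fβ * G 1)) + q • (fv * (X 3 * G 1)) - q • (X 0 * G 2) + X 1 * G 3
        - X 2 * (fβ * G 3) - fα * (X 3 * G 3))]

theorem ev_field {X : Fin 4 → Alg} (hX : Typed X) (i : Fin 4) : ev X hX (field i) = X i := by
  simp [field, ev_gen]

theorem ev_pencilAct (c₁ c₂ : ℂ) {X : Fin 4 → Alg} (hX : Typed X) (G : Fin 4 → Alg) (i : Fin 4) :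
    ev X hX (pencilAct c₁ c₂ G i) =
      pencilAct c₁ c₂ (fun j => ev X hX (G j)) i + pencilVar c₁ c₂ X G i := by
  fin_cases i <;>
    simp only [pencilAct, pencilVar, Matrix.cons_val, Fin.zero_eta, Fin.mk_one, Fin.reduceFinMk,
      Fin.isValue, map_add, map_sub, map_neg, map_smul, ev_mul, ev_D, ev_field, two_mul, add_mul,
      one_mul, mul_add] <;>
    module

theorem typed_pencilAct (c₁ c₂ : ℂ) {G : Fin 4 → Alg} (hG : Typed G) :
    Typed (pencilAct c₁ c₂ G) := by
  have hu := typed_field.parity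
  have hG' := hG.parity
  intro i
  fin_cases i
  · exact hasParity_false.2 (by simp [IsEven, pencilAct, parity_D, hu, hG', two_mul])
  · exact hasParity_false.2 (by simp [IsEven, pencilAct, parity_D, hu, hG', two_mul])
  · exact hasParity_true.2 (by
      simp only [IsOdd, pencilAct, Fin.isValue, smul_neg, one_div, smul_add, Fin.reduceFinMk,
        Matrix.cons_val, map_add, map_smul, map_sub, map_neg, map_mul, hu, hG', neg_mul, neg_neg,
        sub_neg_eq_add, parity_D, mul_neg, neg_add_rev]
      module)
  · exact hasParity_true.2 (by
      simp only [IsOdd, pencilAct, Fin.isValue, smul_neg, one_div, smul_add, Fin.reduceFinMk,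
        Matrix.cons_val, map_add, map_smul, map_sub, map_mul, hu, hG', neg_mul, sub_neg_eq_add,
        parity_D, map_one, mul_neg, map_neg, neg_neg, neg_add_rev]
      module)

set_option maxRecDepth 100000 in
theorem pencil_skew (c₁ c₂ : ℂ) {F G : Fin 4 → Alg} (hF : Typed F) (hG : Typed G) :
    ∑ i, F i * pencilAct c₁ c₂ G i + ∑ i, G i * pencilAct c₁ c₂ F i ∈ LinearMap.range dx := by
  obtain ⟨F0, F1, F2, F3⟩ := hF.kinds
  obtain ⟨G0, G1, G2, G3⟩ := hG.kinds
  obtain ⟨u0, u1, u2, u3⟩ := typed_field.kinds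
  simp only [pencilAct, Fin.sum_univ_four, Matrix.cons_val]
  exact mem_range_of_check (isEvenDer_D _)
    [.const, .const, .even, .even, .odd, .odd, .even, .even, .odd, .odd, .even, .even, .odd, .odd]
    [algebraMap ℂ Alg c₁, algebraMap ℂ Alg c₂, field 0, field 1, field 2, field 3,
      F 0, F 1, F 2, F 3, G 0, G 1, G 2, G 3]
    (by simp only [List.forall₂_cons, List.forall₂_nil_left_iff, hasKind_algebraMap]; tauto)
    (i := 10) (n := 3) (by decide +kernel)

set_option maxRecDepth 100000 in
theorem pencil_jacobi (c₁ c₂ : ℂ) {F G H : Fin 4 → Alg} (hF : Typed F) (hG : Typed G)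
    (hH : Typed H) :
    ∑ i, F i * pencilVar c₁ c₂ (pencilAct c₁ c₂ H) G i +
      ∑ i, G i * pencilVar c₁ c₂ (pencilAct c₁ c₂ F) H i +
      ∑ i, H i * pencilVar c₁ c₂ (pencilAct c₁ c₂ G) F i ∈ LinearMap.range dx := by
  obtain ⟨F0, F1, F2, F3⟩ := hF.kinds
  obtain ⟨G0, G1, G2, G3⟩ := hG.kinds
  obtain ⟨H0, H1, H2, H3⟩ := hH.kinds
  obtain ⟨u0, u1, u2, u3⟩ := typed_field.kinds
  simp only [pencilAct, pencilVar, Fin.sum_univ_four, Matrix.cons_val]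
  exact mem_range_of_check (isEvenDer_D _)
    [.const, .const, .even, .even, .odd, .odd, .even, .even, .odd, .odd, .even, .even, .odd, .odd,
      .even, .even, .odd, .odd]
    [algebraMap ℂ Alg c₁, algebraMap ℂ Alg c₂, field 0, field 1, field 2, field 3,
      F 0, F 1, F 2, F 3, G 0, G 1, G 2, G 3, H 0, H 1, H 2, H 3]
    (by simp only [List.forall₂_cons, List.forall₂_nil_left_iff, hasKind_algebraMap]; tauto)
    (i := 14) (n := 4) (by decide +kernel)

theorem typed_grad {f : Alg} (hf : IsEven f) : Typed (grad f) := fun i => by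
  have h := (hasParity_false.2 hf).euler i
  rwa [Bool.false_xor] at h

section Trilinear

variable {P : Matrix (Fin 4) (Fin 4) (Module.End ℂ Alg)}

theorem isEven_bracket (typed : ∀ {G}, Typed G → Typed (act P G)) {f g : Alg} (hf : IsEven f)
    (hg : IsEven g) : IsEven (bracket P f g) := by
  refine hasParity_false.1 (.sum _ fun i _ => ?_)
  simpa only [Bool.xor_self] using (typed_grad hf i).mul (typed (typed_grad hg) i)

variable {Q : (Fin 4 → Alg) → (Fin 4 → Alg) → Fin 4 → Alg}
  (typed : ∀ {G}, Typed G → Typed (act P G))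
  (skew : ∀ {F G}, Typed F → Typed G →
    ∑ i, F i * act P G i + ∑ i, G i * act P F i ∈ LinearMap.range dx)
  (ev_act : ∀ {X} (hX : Typed X) (G) (i),
    ev X hX (act P G i) = act P (fun j => ev X hX (G j)) i + Q X G i)

include typed skew ev_act

theorem bracket_bracket_sub_mem {f g h : Alg} (hf : IsEven f) (hg : IsEven g) (hh : IsEven h) :
    bracket P (bracket P f g) h -
      (∑ i, ev _ (typed (typed_grad hh)) (grad f i) * act P (grad g) i -
        ∑ i, ev _ (typed (typed_grad hh)) (grad g i) * act P (grad f) i +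
        ∑ i, grad f i * Q (act P (grad h)) (grad g) i) ∈ LinearMap.range dx := by
  have hX := typed (typed_grad hh)
  have hbracket := ev_sub_sum_euler_mem hX (bracket P f g)
  have hskew := skew (typed_grad hf) (G := fun j => ev _ hX (grad g j))
    fun j => (typed_grad hg j).ev _
  refine (Submodule.neg_mem_iff _).1 ?_
  convert sub_mem hbracket hskew using 1
  rw [bracket, bracket, map_sum]
  simp only [ev_mul, ev_act, mul_add, Finset.sum_add_distrib, grad]
  abel

/-- In the Jacobi sum of a skew-adjoint operator `P` the Fréchet derivatives of the gradients cancel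
by self-adjointness, so that only the derivative `Q` of the coefficients of `P` remains. -/
theorem isSuperHamiltonian_of_trilinear
    (trilinear : ∀ {F G H}, Typed F → Typed G → Typed H →
      ∑ i, F i * Q (act P H) G i + ∑ i, G i * Q (act P F) H i + ∑ i, H i * Q (act P G) F i ∈
        LinearMap.range dx) :
    IsSuperHamiltonian P := by
  refine ⟨fun f g => isEven_bracket typed,
    fun f g hf hg => skew (typed_grad hf) (typed_grad hg), fun f g h hf hg hh => ?_⟩
  have hsum := add_mem (add_mem
    (bracket_bracket_sub_mem typed skew ev_act hf hg hh)
    (bracket_bracket_sub_mem typed skew ev_act hg hh hf))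
    (bracket_bracket_sub_mem typed skew ev_act hh hf hg)
  have hself := add_mem (add_mem
    (sum_ev_euler_mul_sub_mem (typed (typed_grad hh)) (typed (typed_grad hg)) f)
    (sum_ev_euler_mul_sub_mem (typed (typed_grad hf)) (typed (typed_grad hh)) g))
    (sum_ev_euler_mul_sub_mem (typed (typed_grad hg)) (typed (typed_grad hf)) h)
  have htri := trilinear (typed_grad hf) (typed_grad hg) (typed_grad hh)
  convert add_mem (add_mem hsum htri) hself using 1
  simp only [grad]
  abel

end Trilinear

theorem isSuperHamiltonian_pencil (c₁ c₂ : ℂ) : IsSuperHamiltonian (c₁ • J + c₂ • R) := by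
  refine isSuperHamiltonian_of_trilinear (Q := pencilVar c₁ c₂) ?_ ?_ ?_ ?_
  · intro G hG
    rw [act_pencil]
    exact typed_pencilAct c₁ c₂ hG
  · intro F G hF hG
    rw [act_pencil, act_pencil]
    exact pencil_skew c₁ c₂ hF hG
  · intro X hX G i
    rw [act_pencil, act_pencil]
    exact ev_pencilAct c₁ c₂ hX G i
  · intro F G H hF hG hH
    rw [act_pencil, act_pencil, act_pencil]
    exact pencil_jacobi c₁ c₂ hF hG hH

/-! ### The factorization of `R` -/

theorem opJ_mul_opL {E : Type} [Ring E] [Algebra ℂ E] (mul : Alg →ₐ[ℂ] E) (d dinv : E)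
    (hd : ∀ f, d * mul f = mul f * d + mul (dx f)) (hdinv : d * dinv = 1) :
    opJ mul d * opL mul d dinv = opR mul d := by
  obtain ⟨u0, u1, u2, u3⟩ := typed_field.kinds
  have hαv : mul fα * mul fv = mul fv * mul fα := by
    rw [← map_mul, ← map_mul, IsEven.mul_comm u0]
  have hαw : mul fα * mul fw = mul fw * mul fα := by
    rw [← map_mul, ← map_mul, IsEven.mul_comm u1]
  have hβv : mul fβ * mul fv = mul fv * mul fβ := by
    rw [← map_mul, ← map_mul, IsEven.mul_comm u0]
  have hβα : mul fβ * mul fα = -(mul fα * mul fβ) := by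
    rw [← map_mul, ← map_mul, IsOdd.anticomm u3 u2, map_neg]
  have hαα : mul fα * mul fα = 0 := by
    rw [← map_mul, mul_self_of_odd u2, map_zero]
  have hββ : mul fβ * mul fβ = 0 := by
    rw [← map_mul, mul_self_of_odd u3, map_zero]
  have assoc : ∀ {a b c : E}, a * b = c → ∀ x, a * (b * x) = c * x := fun h x => by
    rw [← mul_assoc, h]
  ext i j
  fin_cases i <;> fin_cases j <;>
    simp only [opJ, opL, opR, recLocal, recRow, Matrix.mul_apply, Fin.sum_univ_four,
      Matrix.add_apply, Matrix.cons_val, Matrix.of_apply, Fin.zero_eta, Fin.mk_one,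
      Fin.reduceFinMk, Fin.isValue, mul_add, add_mul, mul_sub, neg_mul, mul_neg, zero_mul, mul_zero,
      add_zero, zero_add, smul_mul_assoc, mul_smul_comm, mul_assoc, two_mul, mul_two, mul_one,
      one_mul, hd fv, hd fw, hd fα, hd fβ, hαv, hαw, hβv, hβα, hαα, hββ, assoc hαw, assoc hαα,
      assoc hdinv] <;>
    module

/-! ### Power series in `z = λ⁻¹` -/

open PowerSeries (X C coeff)

/-- Power series in `z = λ⁻¹` over the differential superpolynomials. -/
abbrev PS : Type := PowerSeries Alg

/-- A linear map of `Alg` applied to all coefficients. -/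
def cmap (T : Alg →ₗ[ℂ] Alg) : PS →ₗ[ℂ] PS where
  toFun f := PowerSeries.mk fun n => T (coeff n f)
  map_add' f g := by ext n; simp
  map_smul' c f := by ext n; simp

@[simp] theorem coeff_cmap (T : Alg →ₗ[ℂ] Alg) (n : ℕ) (f : PS) :
    coeff n (cmap T f) = T (coeff n f) := by simp [cmap]

theorem map_parity_eq_self_iff {f : PS} :
    PowerSeries.map (parity oddField).toRingHom f = f ↔ ∀ n, IsEven (coeff n f) := by
  simp only [PowerSeries.ext_iff, PowerSeries.coeff_map]
  rfl

theorem map_parity_eq_neg_iff {f : PS} :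
    PowerSeries.map (parity oddField).toRingHom f = -f ↔ ∀ n, IsOdd (coeff n f) := by
  simp only [PowerSeries.ext_iff, PowerSeries.coeff_map, map_neg]
  rfl

instance : SuperAlg PS where
  par := PowerSeries.map (parity oddField).toRingHom
  comm_of_even x y hx := by
    ext n
    rw [PowerSeries.coeff_mul, PowerSeries.coeff_mul, ← Finset.Nat.sum_antidiagonal_swap]
    exact Finset.sum_congr rfl fun p _ => (map_parity_eq_self_iff.1 hx _).mul_comm _
  anticomm_of_odd x y hx hy := by
    ext n
    rw [map_neg, PowerSeries.coeff_mul, PowerSeries.coeff_mul, ← Finset.Nat.sum_antidiagonal_swap,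
      ← Finset.sum_neg_distrib]
    exact Finset.sum_congr rfl fun p _ =>
      (map_parity_eq_neg_iff.1 hx _).anticomm (map_parity_eq_neg_iff.1 hy _)

theorem coeff_par (n : ℕ) (f : PS) : coeff n (par f) = parity oddField (coeff n f) :=
  PowerSeries.coeff_map _ _ _

theorem isEvenDer_cmap {T : Alg →ₗ[ℂ] Alg} (hT : IsEvenDer T) : IsEvenDer (cmap T) where
  leibniz f g := by
    ext n
    simp only [coeff_cmap, PowerSeries.coeff_mul, map_add, map_sum, hT.leibniz,
      Finset.sum_add_distrib]
  par f := by
    ext n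
    rw [coeff_par, coeff_cmap, coeff_cmap, coeff_par]
    exact hT.par _

/-- `∂` on power series. -/
abbrev Dx : PS →ₗ[ℂ] PS := cmap dx

theorem isEvenDer_Dx : IsEvenDer Dx := isEvenDer_cmap (isEvenDer_D _)

theorem cmap_comm {S T : Alg →ₗ[ℂ] Alg} (h : ∀ f, S (T f) = T (S f)) (f : PS) :
    cmap S (cmap T f) = cmap T (cmap S f) := by
  ext n
  simp [h]

theorem cmap_C (T : Alg →ₗ[ℂ] Alg) (f : Alg) : cmap T (C f) = C (T f) := by
  ext n
  rw [coeff_cmap, PowerSeries.coeff_C, PowerSeries.coeff_C]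
  split_ifs <;> simp

theorem par_C (f : Alg) : par (C f : PS) = C (parity oddField f) := PowerSeries.map_C _ _

theorem hasKind_X : HasKind Dx .const (X : PS) := by
  constructor
  · exact PowerSeries.map_X _
  · ext n
    rw [coeff_cmap, PowerSeries.coeff_X]
    split_ifs <;> simp

theorem algebraMap_PS (c : ℂ) : algebraMap ℂ PS c = C (algebraMap ℂ Alg c) :=
  PowerSeries.algebraMap_apply ..

theorem hasKind_algebraMap_PS (c : ℂ) : HasKind Dx .const (algebraMap ℂ PS c) := by
  constructor
  · rw [algebraMap_PS, par_C, AlgHom.commutes]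
  · rw [algebraMap_PS, cmap_C, D_algebraMap, map_zero]

/-- The fields as constant power series: here `v`, below `w`, `α` and `β`. -/
abbrev sv : PS := C fv
abbrev sw : PS := C fw
abbrev sα : PS := C fα
abbrev sβ : PS := C fβ

theorem hasKind_fields : HasKind Dx .even sv ∧ HasKind Dx .even sw ∧ HasKind Dx .odd sα ∧
    HasKind Dx .odd sβ := by
  obtain ⟨hv, hw, hα, hβ⟩ := typed_field.parity
  refine ⟨?_, ?_, ?_, ?_⟩ <;> simp only [HasKind, par_C, hv, hw, hα, hβ, map_neg]

/-- A power series with constant coefficients. -/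
abbrev scal : PowerSeries ℂ →+* PS := PowerSeries.map (algebraMap ℂ Alg)

theorem scal_injective : Function.Injective scal :=
  PowerSeries.map_injective _ algebraMap_injective

theorem hasKind_scal (f : PowerSeries ℂ) : HasKind Dx .const (scal f) := by
  constructor
  · ext n
    rw [coeff_par, PowerSeries.coeff_map, AlgHom.commutes]
  · ext n
    rw [coeff_cmap, PowerSeries.coeff_map, D_algebraMap, map_zero]

theorem coeff_scal_mul (f : PowerSeries ℂ) (x : PS) (m : ℕ) :
    coeff m (scal f * x) = ∑ j ∈ Finset.range (m + 1), coeff j f • coeff (m - j) x := by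
  rw [PowerSeries.coeff_mul, Finset.Nat.sum_antidiagonal_eq_sum_range_succ_mk]
  simp only [PowerSeries.coeff_map, Algebra.smul_def]

theorem isUnit_of_coeff_zero {f : PS} {c : ℂ} (hc : c ≠ 0)
    (hf : coeff 0 f = algebraMap ℂ Alg c) : IsUnit f := by
  rw [PowerSeries.isUnit_iff_constantCoeff, ← PowerSeries.coeff_zero_eq_constantCoeff_apply, hf]
  exact (isUnit_iff_ne_zero.2 hc).map _

theorem two_mul_eq_zero {S : Type*} [Ring S] [Algebra ℂ S] {x : S} : 2 * x = 0 ↔ x = 0 := by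
  rw [two_mul, ← two_smul ℂ, smul_eq_zero_iff_right two_ne_zero]

theorem coeff_two_mul (m : ℕ) (f : PS) : coeff m (2 * f) = 2 * coeff m f := by
  rw [two_mul, map_add, two_mul]

theorem coeff_four_mul (m : ℕ) (f : PS) : coeff m (4 * f) = 4 * coeff m f :=
  PowerSeries.coeff_C_mul m f 4

theorem coeff_sw_add_one_mul (m : ℕ) (f : PS) :
    coeff m ((sw + 1) * f) = (fw + 1) * coeff m f := by
  rw [add_mul, one_mul, map_add, PowerSeries.coeff_C_mul, add_mul, one_mul]

theorem X_mul_eq_smul_add_iff {c c' : ℂ} (hc : c' * c = 1) (f g h : PS) :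
    X * f = c • g + X * h ↔
      coeff 0 g = 0 ∧ ∀ m, coeff (m + 1) g = c' • (coeff m f - coeff m h) := by
  have hsmul : ∀ x y : Alg, y = c • x ↔ x = c' • y := fun x y => by
    constructor
    · rintro rfl
      rw [smul_smul, hc, one_smul]
    · rintro rfl
      rw [smul_smul, mul_comm, hc, one_smul]
  rw [PowerSeries.ext_iff, Nat.and_forall_add_one.symm]
  simp only [map_add, PowerSeries.coeff_smul, PowerSeries.coeff_succ_X_mul,
    PowerSeries.coeff_zero_X_mul, add_zero, hsmul, smul_zero, ← sub_eq_iff_eq_add]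

/-! ### The stationary equation -/

/-- The entries of the matrix `[[a, b, ρ], [g, -a, δ], [δ, -ρ, 0]]`, the shape of `N` and of its
coefficients. -/
@[ext] structure Entries (S : Type*) where
  a : S
  b : S
  g : S
  ρ : S
  δ : S

namespace Entries

variable {S T : Type*}

def map (F : S → T) (n : Entries S) : Entries T := ⟨F n.a, F n.b, F n.g, F n.ρ, F n.δ⟩

/-- The supermatrix with the given entries. -/
def mat [Ring S] (n : Entries S) : Matrix (Fin 3) (Fin 3) S :=
  !![n.a, n.b, n.ρ; n.g, -n.a, n.δ; n.δ, -n.ρ, 0]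

theorem mat_injective [Ring S] : Function.Injective (mat : Entries S → _) := by
  intro m n h
  exact Entries.ext (congrFun₂ h 0 0) (congrFun₂ h 0 1) (congrFun₂ h 1 0) (congrFun₂ h 0 2)
    (congrFun₂ h 1 2)

theorem mat_map {F : Type*} [Ring S] [Ring T] [FunLike F S T] [AddMonoidHomClass F S T] (f : F)
    (n : Entries S) : (n.map f).mat = n.mat.map f := by
  ext1 i j
  fin_cases i <;> fin_cases j <;> simp [mat, map]

/-- The form `½ Str (m n)`, up to a part that is antisymmetric in `m` and `n`. -/
def form [Ring S] (m n : Entries S) : S := m.a * n.a + m.b * n.g + 2 * (m.ρ * n.δ)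

variable [Ring S] [Algebra ℂ S] [SuperAlg S]

/-- The parities of the entries of an even supermatrix. -/
structure Graded (n : Entries S) : Prop where
  par_a : par n.a = n.a
  par_b : par n.b = n.b
  par_g : par n.g = n.g
  par_ρ : par n.ρ = -n.ρ
  par_δ : par n.δ = -n.δ

/-- The coefficient of `z ^ m` in each entry. -/
def coeffs (m : ℕ) (n : Entries PS) : Entries Alg := n.map (coeff m)

/-- The power series with the coefficients `f 0, f 1, …` in each entry. -/
def series (f : ℕ → Entries Alg) : Entries PS :=
  ⟨.mk fun m => (f m).a, .mk fun m => (f m).b, .mk fun m => (f m).g, .mk fun m => (f m).ρ,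
    .mk fun m => (f m).δ⟩

@[simp] theorem coeffs_series (f : ℕ → Entries Alg) (m : ℕ) : (series f).coeffs m = f m := by
  simp [coeffs, series, map]

theorem ext_coeffs {n n' : Entries PS} (h : ∀ m, n.coeffs m = n'.coeffs m) : n = n' := by
  ext m
  exacts [congrArg a (h m), congrArg b (h m), congrArg g (h m), congrArg ρ (h m), congrArg δ (h m)]

theorem graded_iff_coeffs {n : Entries PS} : n.Graded ↔ ∀ m, (n.coeffs m).Graded := by
  constructor
  · intro h m
    exact ⟨map_parity_eq_self_iff.1 h.par_a m, map_parity_eq_self_iff.1 h.par_b m,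
      map_parity_eq_self_iff.1 h.par_g m, map_parity_eq_neg_iff.1 h.par_ρ m,
      map_parity_eq_neg_iff.1 h.par_δ m⟩
  · intro h
    exact ⟨map_parity_eq_self_iff.2 fun m => (h m).par_a,
      map_parity_eq_self_iff.2 fun m => (h m).par_b, map_parity_eq_self_iff.2 fun m => (h m).par_g,
      map_parity_eq_neg_iff.2 fun m => (h m).par_ρ, map_parity_eq_neg_iff.2 fun m => (h m).par_δ⟩

theorem coeff_form (n : Entries PS) (m : ℕ) : coeff m (n.form n) =
    ∑ x ∈ Finset.HasAntidiagonal.antidiagonal m, (n.coeffs x.1).form (n.coeffs x.2) := by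
  simp only [form, coeffs, map, map_add, coeff_two_mul, PowerSeries.coeff_mul m n.a,
    PowerSeries.coeff_mul m n.b, PowerSeries.coeff_mul m n.ρ, Finset.sum_add_distrib,
    Finset.mul_sum]

/-- The assumption of the decision procedure for identities between the entries of `n` and the
fields, where `ks` and `env` allow for further atoms. -/
theorem Graded.forall₂_hasKind {n : Entries PS} (h : n.Graded) {ks : List Kind} {env : List PS}
    (hk : List.Forall₂ (HasKind Dx) ks env) :
    List.Forall₂ (HasKind Dx)
      (.const :: .even :: .even :: .odd :: .odd :: .even :: .even :: .even :: .odd :: .odd :: ks)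
      (X :: sv :: sw :: sα :: sβ :: n.a :: n.b :: n.g :: n.ρ :: n.δ :: env) := by
  obtain ⟨hv, hw, hα, hβ⟩ := hasKind_fields
  simp only [List.forall₂_cons]
  exact ⟨hasKind_X, hv, hw, hα, hβ, h.par_a, h.par_b, h.par_g, h.par_ρ, h.par_δ, hk⟩

end Entries

/-- The matrix `z M`. -/
def zM : Matrix (Fin 3) (Fin 3) PS :=
  !![-1 + X * ((1 / 2 : ℂ) • sv), X, X * sα;
     X * (-(2 * sw) - 2), 1 - X * ((1 / 2 : ℂ) • sv), X * sβ;
     X * sβ, -(X * sα), 0]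

namespace Entries

/-- The entries of `z [M, n]`. -/
def zBracket (n : Entries PS) : Entries PS where
  a := X * (n.g + 2 * ((sw + 1) * n.b) + sα * n.δ + sβ * n.ρ)
  b := (-2 : ℂ) • n.b + X * (sv * n.b - 2 * n.a - 2 * (sα * n.ρ))
  g := (2 : ℂ) • n.g + X * (2 * (sβ * n.δ) - 4 * ((sw + 1) * n.a) - sv * n.g)
  ρ := (-1 : ℂ) • n.ρ + X * ((1 / 2 : ℂ) • (sv * n.ρ) + n.δ - n.a * sα - n.b * sβ)
  δ := (1 : ℂ) • n.δ +
    X * (n.a * sβ - 2 * ((sw + 1) * n.ρ) - (1 / 2 : ℂ) • (sv * n.δ) - n.g * sα)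

theorem Graded.zM_mul_mat_sub {n : Entries PS} (h : n.Graded) :
    zM * n.mat - n.mat * zM = n.zBracket.mat := by
  have hk := h.forall₂_hasKind .nil
  ext1 i j
  fin_cases i <;> fin_cases j <;>
    simp only [zM, mat, zBracket, Matrix.sub_apply, Matrix.mul_apply, Fin.sum_univ_three,
      Matrix.of_apply, Matrix.cons_val, Fin.zero_eta, Fin.mk_one, Fin.reduceFinMk, Fin.isValue] <;>
    exact eq_of_check isEvenDer_Dx _ _ hk (by decide +kernel)

/-- The stationary equation `N_x = [M, N]` for the entries off the diagonal. -/
structure OffDiagEq (n : Entries PS) : Prop where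
  eq_b : X * Dx n.b = n.zBracket.b
  eq_g : X * Dx n.g = n.zBracket.g
  eq_ρ : X * Dx n.ρ = n.zBracket.ρ
  eq_δ : X * Dx n.δ = n.zBracket.δ

/-- The solutions of the stationary equation `N_x = [M, N]`, as power series in `z`. -/
structure IsStationary (n : Entries PS) : Prop extends n.Graded, n.OffDiagEq where
  eq_a : X * Dx n.a = n.zBracket.a

theorem Graded.isStationary_iff {n : Entries PS} (h : n.Graded) :
    n.IsStationary ↔ n.mat.map (fun f => X * Dx f) = zM * n.mat - n.mat * zM := by
  have hmap : n.mat.map (fun f => X * Dx f) = (n.map fun f => X * Dx f).mat :=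
    (mat_map ((AddMonoidHom.mulLeft X).comp Dx.toAddMonoidHom) n).symm
  rw [h.zM_mul_mat_sub, hmap, mat_injective.eq_iff]
  constructor
  · intro hn
    exact Entries.ext hn.eq_a hn.eq_b hn.eq_g hn.eq_ρ hn.eq_δ
  · intro hn
    exact ⟨h, ⟨congrArg b hn, congrArg g hn, congrArg ρ hn, congrArg δ hn⟩, congrArg a hn⟩

end Entries

/-- The embedding of power series into Laurent series. -/
abbrev toSer : PS →+* Ser := HahnSeries.ofPowerSeries ℤ Alg

theorem toSer_injective : Function.Injective toSer := HahnSeries.ofPowerSeries_injective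

theorem toSer_C (f : Alg) : toSer (C f) = con f := HahnSeries.ofPowerSeries_C _

theorem toSer_X_mul_lam : toSer X * lam = 1 := by
  rw [HahnSeries.ofPowerSeries_X, lam, HahnSeries.single_mul_single]
  simp

theorem lam_mul_toSer_X : lam * toSer X = 1 := by
  rw [HahnSeries.ofPowerSeries_X, lam, HahnSeries.single_mul_single]
  simp

theorem single_one_mul (k : ℤ) (f : Ser) :
    HahnSeries.single k 1 * f = f * HahnSeries.single k 1 := by
  ext n
  rw [HahnSeries.coeff_single_mul, HahnSeries.coeff_mul_single, one_mul, mul_one]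

theorem mul_single_one_smul (k : ℤ) (A B : Matrix (Fin 3) (Fin 3) Ser) :
    A * ((HahnSeries.single k 1 : Ser) • B) = (HahnSeries.single k 1 : Ser) • (A * B) := by
  ext1 i j
  simp only [Matrix.mul_apply, Matrix.smul_apply, smul_eq_mul, Finset.mul_sum]
  refine Finset.sum_congr rfl fun l _ => ?_
  rw [← mul_assoc, ← single_one_mul, mul_assoc]

theorem mul_toSer_X_smul (A B : Matrix (Fin 3) (Fin 3) Ser) :
    A * (toSer X • B) = toSer X • (A * B) := by
  rw [HahnSeries.ofPowerSeries_X, mul_single_one_smul]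

theorem mul_lam_smul (A B : Matrix (Fin 3) (Fin 3) Ser) : A * lam • B = lam • (A * B) :=
  mul_single_one_smul (-1) A B

theorem toSer_X_smul_injective :
    Function.Injective fun A : Matrix (Fin 3) (Fin 3) Ser => toSer X • A := by
  refine Function.LeftInverse.injective (g := fun A => lam • A) fun A => ?_
  dsimp only
  rw [smul_smul, lam_mul_toSer_X, one_smul]

theorem toSer_map (T : Alg →ₗ[ℂ] Alg) (f : PS) : (toSer f).map T = toSer (cmap T f) := by
  ext n
  rw [HahnSeries.map_coeff]
  simp only [PowerSeries.coeff_coe]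
  split_ifs <;> simp

theorem toSer_X_smul_specM : toSer X • specM = zM.map toSer := by
  have hcon : ∀ f : Alg, toSer X * con f = toSer (X * C f) := fun f => by rw [map_mul, toSer_C]
  have hhalf : (1 / 2 : ℂ) • sv = C ((1 / 2 : ℂ) • fv) := by
    ext n
    rw [PowerSeries.coeff_smul, PowerSeries.coeff_C, PowerSeries.coeff_C]
    split_ifs <;> simp
  have htwo : (-(2 * sw) - 2 : PS) = C (-(2 * fw) - 2) := by
    simp [← one_add_one_eq_two]
  rw [zM, specM, hhalf, htwo]
  ext1 i j
  fin_cases i <;> fin_cases j <;>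
    simp only [Matrix.smul_apply, Matrix.map_apply, smul_eq_mul, Matrix.of_apply, Matrix.cons_val,
      Fin.zero_eta, Fin.mk_one, Fin.reduceFinMk, Fin.isValue, mul_add, mul_sub, mul_neg,
      toSer_X_mul_lam, hcon, map_add, map_sub, map_neg, map_one, mul_one, mul_zero, map_zero]

theorem stationary_iff (n : Matrix (Fin 3) (Fin 3) PS) :
    mapCoeff dx (n.map toSer) = specM * n.map toSer - n.map toSer * specM ↔
      n.map (fun f => X * Dx f) = zM * n - n * zM := by
  have hleft : toSer X • mapCoeff dx (n.map toSer) = (n.map fun f => X * Dx f).map toSer := by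
    ext1 i j
    simp only [mapCoeff, Matrix.smul_apply, Matrix.map_apply, toSer_map, smul_eq_mul, map_mul]
  have hright : toSer X • (specM * n.map toSer - n.map toSer * specM) =
      (zM * n - n * zM).map toSer := by
    rw [smul_sub, ← Matrix.smul_mul, ← mul_toSer_X_smul, toSer_X_smul_specM, ← Matrix.map_mul,
      ← Matrix.map_mul, Matrix.map_sub _ (map_sub toSer)]
  rw [← toSer_X_smul_injective.eq_iff, hleft, hright,
    (Matrix.map_injective toSer_injective).eq_iff]

namespace Coeffs

/-- The entry `N₂₁`. -/
def g (N : Coeffs) (m : ℕ) : Alg := -(2 * N.b m) + 2 * N.c m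

theorem c_eq (N : Coeffs) (m : ℕ) : N.c m = (1 / 2 : ℂ) • N.g m + N.b m := by
  simp only [g, two_mul]
  module

/-- The entries of `N_m`. -/
def entries (N : Coeffs) (m : ℕ) : Entries Alg := ⟨N.a m, N.b m, N.g m, N.ρ m, N.δ m⟩

/-- The entries of `N`. -/
def series (N : Coeffs) : Entries PS := Entries.series N.entries

@[simp] theorem coeffs_series (N : Coeffs) (m : ℕ) : N.series.coeffs m = N.entries m :=
  Entries.coeffs_series _ _

theorem series_injective : Function.Injective series := by
  intro N N' h
  have hm : ∀ m, N.entries m = N'.entries m := fun m => by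
    rw [← coeffs_series, h, coeffs_series]
  have hb : N.b = N'.b := funext fun m => congrArg Entries.b (hm m)
  refine Coeffs.ext (funext fun m => congrArg Entries.a (hm m)) hb (funext fun m => ?_)
    (funext fun m => congrArg Entries.ρ (hm m)) (funext fun m => congrArg Entries.δ (hm m))
  rw [c_eq, c_eq, hb, show N.g m = N'.g m from congrArg Entries.g (hm m)]

theorem mat_eq (N : Coeffs) (m : ℕ) : N.mat m = (N.entries m).mat := rfl

theorem ser_eq (N : Coeffs) : N.ser = N.series.mat.map toSer := by
  ext1 i j
  refine congrArg toSer ?_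
  ext m
  rw [PowerSeries.coeff_mk, mat_eq, ← coeffs_series, Entries.coeffs, Entries.mat_map,
    Matrix.map_apply]

end Coeffs

namespace Entries

/-! ### The recursion for the coefficients -/

/-- The coefficient following `p` in a solution, where `a` is its first entry. -/
def next (p : Entries Alg) (a : Alg) : Entries Alg where
  a := a
  b := (1 / 2 : ℂ) • (fv * p.b - 2 * p.a - 2 * (fα * p.ρ) - dx p.b)
  g := (1 / 2 : ℂ) • (dx p.g + 4 * ((fw + 1) * p.a) + fv * p.g - 2 * (fβ * p.δ))
  ρ := (1 / 2 : ℂ) • (fv * p.ρ) + p.δ - p.a * fα - p.b * fβ - dx p.ρ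
  δ := dx p.δ + 2 * ((fw + 1) * p.ρ) + (1 / 2 : ℂ) • (fv * p.δ) + p.g * fα - p.a * fβ

theorem Graded.next {p : Entries Alg} (h : p.Graded) {a : Alg} (ha : par a = a) :
    (p.next a).Graded := by
  obtain ⟨hv, hw, hα, hβ⟩ := typed_field.kinds
  simp only [HasKind] at hv hw hα hβ
  obtain ⟨pa, pb, pg, pρ, pδ⟩ := h
  have hdx : ∀ f : Alg, par (dx f) = dx (par f) := (isEvenDer_D oddField).par
  have hsmul : ∀ (c : ℂ) (f : Alg), par (c • f) = c • par f := fun c f =>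
    map_smul (parity oddField) c f
  constructor <;>
    simp only [Entries.next, ha, hsmul, map_sub, map_add, map_neg, map_mul, map_one, map_ofNat, hdx,
      hv, hw, hα, hβ, pa, pb, pg, pρ, pδ, neg_mul, mul_neg, neg_neg, smul_neg] <;>
    abel

theorem offDiagEq_iff {n : Entries PS} : n.OffDiagEq ↔ n.coeffs 0 = ⟨coeff 0 n.a, 0, 0, 0, 0⟩ ∧
    ∀ m, n.coeffs (m + 1) = (n.coeffs m).next (coeff (m + 1) n.a) := by
  have hb : X * Dx n.b = n.zBracket.b ↔ coeff 0 n.b = 0 ∧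
      ∀ m, coeff (m + 1) n.b = ((n.coeffs m).next (coeff (m + 1) n.a)).b := by
    rw [zBracket, X_mul_eq_smul_add_iff (c' := -1 / 2) (by norm_num)]
    simp only [next, coeffs, map, map_sub, coeff_cmap, coeff_two_mul, PowerSeries.coeff_C_mul]
    refine and_congr_right' (forall_congr' fun m => Eq.congr_right ?_)
    module
  have hg : X * Dx n.g = n.zBracket.g ↔ coeff 0 n.g = 0 ∧
      ∀ m, coeff (m + 1) n.g = ((n.coeffs m).next (coeff (m + 1) n.a)).g := by
    rw [zBracket, X_mul_eq_smul_add_iff (c' := 1 / 2) (by norm_num)]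
    simp only [next, coeffs, map, map_sub, coeff_cmap, coeff_two_mul, coeff_four_mul,
      coeff_sw_add_one_mul, PowerSeries.coeff_C_mul]
    refine and_congr_right' (forall_congr' fun m => Eq.congr_right ?_)
    module
  have hρ : X * Dx n.ρ = n.zBracket.ρ ↔ coeff 0 n.ρ = 0 ∧
      ∀ m, coeff (m + 1) n.ρ = ((n.coeffs m).next (coeff (m + 1) n.a)).ρ := by
    rw [zBracket, X_mul_eq_smul_add_iff (c' := -1) (by norm_num)]
    simp only [next, coeffs, map, map_sub, map_add, coeff_cmap, PowerSeries.coeff_smul,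
      PowerSeries.coeff_C_mul, PowerSeries.coeff_mul_C]
    refine and_congr_right' (forall_congr' fun m => Eq.congr_right ?_)
    module
  have hδ : X * Dx n.δ = n.zBracket.δ ↔ coeff 0 n.δ = 0 ∧
      ∀ m, coeff (m + 1) n.δ = ((n.coeffs m).next (coeff (m + 1) n.a)).δ := by
    rw [zBracket, X_mul_eq_smul_add_iff (c' := 1) (by norm_num)]
    simp only [next, coeffs, map, map_sub, coeff_cmap, coeff_two_mul, coeff_sw_add_one_mul,
      PowerSeries.coeff_smul, PowerSeries.coeff_C_mul, PowerSeries.coeff_mul_C]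
    refine and_congr_right' (forall_congr' fun m => Eq.congr_right ?_)
    module
  constructor
  · rintro ⟨eb, eg, eρ, eδ⟩
    obtain ⟨⟨b0, b1⟩, ⟨g0, g1⟩, ⟨ρ0, ρ1⟩, ⟨δ0, δ1⟩⟩ := And.intro (hb.1 eb)
      (And.intro (hg.1 eg) (And.intro (hρ.1 eρ) (hδ.1 eδ)))
    exact ⟨Entries.ext rfl b0 g0 ρ0 δ0, fun m => Entries.ext rfl (b1 m) (g1 m) (ρ1 m) (δ1 m)⟩
  · rintro ⟨h0, h⟩
    exact ⟨hb.2 ⟨congrArg b h0, fun m => congrArg b (h m)⟩,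
      hg.2 ⟨congrArg g h0, fun m => congrArg g (h m)⟩,
      hρ.2 ⟨congrArg ρ h0, fun m => congrArg ρ (h m)⟩,
      hδ.2 ⟨congrArg δ h0, fun m => congrArg δ (h m)⟩⟩

theorem IsStationary.dx_coeff_a {n : Entries PS} (h : n.IsStationary) (m : ℕ) :
    dx (coeff m n.a) = coeff m n.g + 2 * ((fw + 1) * coeff m n.b) + fα * coeff m n.δ +
      fβ * coeff m n.ρ := by
  have hm := congrArg (coeff (m + 1)) h.eq_a
  simpa only [zBracket, PowerSeries.coeff_succ_X_mul, coeff_cmap, map_add, coeff_two_mul,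
    coeff_sw_add_one_mul, PowerSeries.coeff_C_mul] using hm

/-! ### Linear structure of the solutions -/

theorem Graded.zBracket_map_mul {n : Entries PS} (h : n.Graded) {F : PS}
    (hF : HasKind Dx .const F) : (n.map (F * ·)).zBracket = n.zBracket.map (F * ·) := by
  have hk := h.forall₂_hasKind (.cons hF .nil)
  ext1 <;> simp only [zBracket, map] <;> exact eq_of_check isEvenDer_Dx _ _ hk (by decide +kernel)

theorem IsStationary.map_const_mul {n : Entries PS} (h : n.IsStationary) {F : PS}
    (hF : HasKind Dx .const F) : (n.map (F * ·)).IsStationary := by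
  have hX : ∀ x y : PS, X * Dx x = y → X * Dx (F * x) = F * y := by
    rintro x _ rfl
    rw [isEvenDer_Dx.leibniz, hF.2, zero_mul, zero_add, ← mul_assoc, ← mul_assoc,
      comm_of_even _ _ hF.1]
  have hpar : ∀ x y : PS, par x = y → par (F * x) = F * y := by
    rintro x _ rfl
    rw [map_mul par, hF.1]
  have hbr := h.toGraded.zBracket_map_mul hF
  refine ⟨⟨hpar _ _ h.par_a, hpar _ _ h.par_b, hpar _ _ h.par_g, ?_, ?_⟩, ⟨?_, ?_, ?_, ?_⟩, ?_⟩
  · exact (hpar _ _ h.par_ρ).trans (mul_neg _ _)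
  · exact (hpar _ _ h.par_δ).trans (mul_neg _ _)
  · exact (hX _ _ h.eq_b).trans (congrArg b hbr).symm
  · exact (hX _ _ h.eq_g).trans (congrArg g hbr).symm
  · exact (hX _ _ h.eq_ρ).trans (congrArg ρ hbr).symm
  · exact (hX _ _ h.eq_δ).trans (congrArg δ hbr).symm
  · exact (hX _ _ h.eq_a).trans (congrArg a hbr).symm

theorem IsStationary.eq_of_aug_eq {n n' : Entries PS} (h : n.IsStationary) (h' : n'.IsStationary)
    (ha : ∀ m, aug oddField (coeff m n.a) = aug oddField (coeff m n'.a)) : n = n' := by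
  obtain ⟨h0, hnext⟩ := offDiagEq_iff.1 h.toOffDiagEq
  obtain ⟨h0', hnext'⟩ := offDiagEq_iff.1 h'.toOffDiagEq
  have ext_a : ∀ m, coeff m n.b = coeff m n'.b → coeff m n.g = coeff m n'.g →
      coeff m n.ρ = coeff m n'.ρ → coeff m n.δ = coeff m n'.δ → n.coeffs m = n'.coeffs m := by
    intro m hb hg hρ hδ
    have hdx : dx (coeff m n.a - coeff m n'.a) = 0 := by
      rw [map_sub, h.dx_coeff_a, h'.dx_coeff_a, hb, hg, hρ, hδ, sub_self]
    have hconst := eq_algebraMap_of_D_eq_zero hdx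
    rw [map_sub, ha, sub_self, map_zero, sub_eq_zero] at hconst
    exact Entries.ext hconst hb hg hρ hδ
  refine ext_coeffs fun m => ?_
  induction m with
  | zero =>
    exact ext_a 0 ((congrArg b h0).trans (congrArg b h0').symm)
      ((congrArg g h0).trans (congrArg g h0').symm) ((congrArg ρ h0).trans (congrArg ρ h0').symm)
      ((congrArg δ h0).trans (congrArg δ h0').symm)
  | succ m ih =>
    have hm := hnext m
    rw [ih] at hm
    exact ext_a _ ((congrArg b hm).trans (congrArg b (hnext' m)).symm)
      ((congrArg g hm).trans (congrArg g (hnext' m)).symm)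
      ((congrArg ρ hm).trans (congrArg ρ (hnext' m)).symm)
      ((congrArg δ hm).trans (congrArg δ (hnext' m)).symm)

/-- The constant terms of the coefficients of `a` determine a solution, and those of `scal f * a`
are `f` times those of `a`. -/
theorem IsStationary.exists_eq_map_scal {n n' : Entries PS} {k₀ : ℂ} (hk₀ : k₀ ≠ 0)
    (h : n.IsStationary) (h' : n'.IsStationary) (ha : coeff 0 n.a = algebraMap ℂ Alg k₀)
    (ha' : coeff 0 n'.a = algebraMap ℂ Alg k₀) :
    ∃ f : PowerSeries ℂ, coeff 0 f = 1 ∧ n' = n.map (scal f * ·) := by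
  let e : PS →+* PowerSeries ℂ := PowerSeries.map (aug oddField).toRingHom
  have coeff_e : ∀ m x, coeff m (e x) = aug oddField (coeff m x) := fun m x =>
    PowerSeries.coeff_map _ _ _
  have e_scal : ∀ f, e (scal f) = f := fun f => by
    ext m
    rw [coeff_e, PowerSeries.coeff_map, AlgHom.commutes]
    rfl
  have constantCoeff_e : ∀ x : PS, coeff 0 x = algebraMap ℂ Alg k₀ →
      PowerSeries.constantCoeff (e x) = k₀ := fun x hx => by
    rw [← PowerSeries.coeff_zero_eq_constantCoeff_apply, coeff_e, hx, AlgHom.commutes]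
    rfl
  refine ⟨e n'.a * (e n.a)⁻¹, ?_, h'.eq_of_aug_eq (h.map_const_mul (hasKind_scal _)) fun m => ?_⟩
  · rw [PowerSeries.coeff_zero_eq_constantCoeff_apply, map_mul, PowerSeries.constantCoeff_inv,
      constantCoeff_e _ ha, constantCoeff_e _ ha', mul_inv_cancel₀ hk₀]
  · rw [← coeff_e, ← coeff_e, map, map_mul, e_scal, mul_assoc, PowerSeries.inv_mul_cancel, mul_one]
    rwa [constantCoeff_e _ ha]

end Entries

namespace Coeffs

variable {N N' : Coeffs} {k₀ : ℂ}

theorem IsSolution.isStationary (h : N.IsSolution k₀) : N.series.IsStationary := by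
  have hgraded : N.series.Graded := Entries.graded_iff_coeffs.2 fun m => by
    obtain ⟨ha, hb, hc⟩ := h.even m
    obtain ⟨hρ, hδ⟩ := h.odd m
    rw [coeffs_series]
    refine ⟨ha, hb, ?_, hρ, hδ⟩
    change parity oddField (-(2 * N.b m) + 2 * N.c m) = -(2 * N.b m) + 2 * N.c m
    rw [map_add, map_neg, map_mul, map_mul, map_ofNat, show parity oddField (N.b m) = _ from hb,
      show parity oddField (N.c m) = _ from hc]
  have hs := h.stationary
  rw [ser_eq, stationary_iff] at hs
  exact hgraded.isStationary_iff.2 hs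

theorem isSolution_of_isStationary (h : N.series.IsStationary)
    (ha : N.a 0 = algebraMap ℂ Alg k₀) : N.IsSolution k₀ where
  even m := by
    have hm := Entries.graded_iff_coeffs.1 h.toGraded m
    rw [coeffs_series] at hm
    refine ⟨hm.par_a, hm.par_b, ?_⟩
    rw [c_eq, IsEven, map_add, map_smul, show parity oddField (N.b m) = _ from hm.par_b,
      show parity oddField (N.g m) = _ from hm.par_g]
    rfl
  odd m := by
    have hm := Entries.graded_iff_coeffs.1 h.toGraded m
    rw [coeffs_series] at hm
    exact ⟨hm.par_ρ, hm.par_δ⟩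
  init := by
    have h0 := (Entries.offDiagEq_iff.1 h.toOffDiagEq).1
    rw [coeffs_series] at h0
    have hb : N.b 0 = 0 := congrArg Entries.b h0
    have hg : N.g 0 = 0 := congrArg Entries.g h0
    refine ⟨ha, hb, ?_, congrArg Entries.ρ h0, congrArg Entries.δ h0⟩
    rw [c_eq, hb, hg, smul_zero, add_zero]
  stationary := by
    rw [ser_eq, stationary_iff]
    exact h.toGraded.isStationary_iff.1 h

theorem IsSolution.coeff_zero_a (h : N.IsSolution k₀) :
    coeff 0 N.series.a = algebraMap ℂ Alg k₀ :=
  (congrArg Entries.a (coeffs_series N 0)).trans h.init.1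

end Coeffs

/-! ### Normalized solutions -/

namespace Entries

theorem form_map_scal (f : PowerSeries ℂ) (n : Entries PS) :
    (n.map (scal f * ·)).form (n.map (scal f * ·)) = scal (f * f) * n.form n := by
  have hmul : ∀ x y : PS, scal f * x * (scal f * y) = scal (f * f) * (x * y) := fun x y => by
    rw [map_mul, mul_assoc, ← mul_assoc x, ← comm_of_even _ x (hasKind_scal f).1]
    simp only [mul_assoc]
  simp only [form, map, hmul, two_mul, mul_add]

theorem Graded.str_mat_mul_mat {n : Entries PS} (h : n.Graded) :
    (n.mat * n.mat) 0 0 + (n.mat * n.mat) 1 1 - (n.mat * n.mat) 2 2 = 2 * n.form n := by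
  have hk := h.forall₂_hasKind .nil
  simp only [mat, form, Matrix.mul_apply, Fin.sum_univ_three, Matrix.of_apply, Matrix.cons_val,
    Fin.isValue]
  exact eq_of_check isEvenDer_Dx _ _ hk (by decide +kernel)

end Entries

theorem Coeffs.isNormalized_iff {N : Coeffs} (h : N.series.Graded) (k₀ : ℂ) :
    N.IsNormalized k₀ ↔
      N.series.form N.series = algebraMap ℂ PS k₀ * algebraMap ℂ PS k₀ := by
  have hstr : str (N.ser * N.ser) = toSer (2 * N.series.form N.series) := by
    rw [N.ser_eq, ← Matrix.map_mul, ← h.str_mat_mul_mat, map_sub, map_add]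
    rfl
  have hconst : con (algebraMap ℂ Alg (2 * k₀ ^ 2)) =
      toSer (2 * (algebraMap ℂ PS k₀ * algebraMap ℂ PS k₀)) := by
    rw [← toSer_C, ← algebraMap_PS, pow_two, map_mul (algebraMap ℂ PS), map_mul (algebraMap ℂ PS),
      map_ofNat]
  rw [Coeffs.IsNormalized, hstr, hconst, toSer_injective.eq_iff, ← sub_eq_zero, ← mul_sub,
    two_mul_eq_zero, sub_eq_zero]

namespace Entries

/-- The coefficients of the normalized solution: `Str N² = 2 k₀²` determines each `a` in terms of
the preceding coefficients. -/
def normal (k₀ : ℂ) : ℕ → Entries Alg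
  | 0 => ⟨algebraMap ℂ Alg k₀, 0, 0, 0, 0⟩
  | n + 1 => (normal k₀ n).next
      (-((1 / (2 * k₀)) • ∑ i : Fin n, (normal k₀ (i + 1)).form (normal k₀ (n - i))))

theorem Graded.par_form {m n : Entries Alg} (hm : m.Graded) (hn : n.Graded) :
    par (m.form n) = m.form n := by
  simp only [form, map_add, map_mul, map_ofNat, hm.par_a, hm.par_b, hm.par_ρ, hn.par_a, hn.par_g,
    hn.par_δ, neg_mul_neg]

theorem graded_normal (k₀ : ℂ) (n : ℕ) : (normal k₀ n).Graded := by
  induction n using Nat.strongRec with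
  | ind n ih =>
    cases n with
    | zero =>
      rw [normal]
      exact ⟨AlgHom.commutes _ _, map_zero _, map_zero _, by simp, by simp⟩
    | succ n =>
      rw [normal]
      refine (ih n n.lt_succ_self).next ?_
      have hsmul : ∀ (c : ℂ) (f : Alg), par (c • f) = c • par f := fun c f =>
        map_smul (parity oddField) c f
      rw [map_neg, hsmul, map_sum]
      refine congrArg (fun x => -((1 / (2 * k₀)) • x)) (Finset.sum_congr rfl fun i _ => ?_)
      exact (ih _ (by lia)).par_form (ih _ (by lia))

theorem form_normal {k₀ : ℂ} (hk₀ : k₀ ≠ 0) : (series (normal k₀)).form (series (normal k₀)) =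
    algebraMap ℂ PS k₀ * algebraMap ℂ PS k₀ := by
  rw [algebraMap_PS, ← map_mul]
  ext m
  rw [coeff_form]
  simp only [coeffs_series]
  cases m with
  | zero => simp [normal, form]
  | succ n =>
    have hleft : (normal k₀ 0).form (normal k₀ (n + 1)) = k₀ • (normal k₀ (n + 1)).a := by
      rw [normal.eq_1, form, Algebra.smul_def]
      simp
    have hright : (normal k₀ (n + 1)).form (normal k₀ 0) = k₀ • (normal k₀ (n + 1)).a := by
      rw [normal.eq_1, form, Algebra.smul_def, Algebra.commutes]
      simp
    have ha : (2 * k₀) • (normal k₀ (n + 1)).a =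
        -∑ i : Fin n, (normal k₀ (i + 1)).form (normal k₀ (n - i)) := by
      rw [normal, next, smul_neg, smul_smul, mul_one_div_cancel (by simpa using hk₀), one_smul]
    rw [PowerSeries.coeff_C, if_neg n.succ_ne_zero,
      Finset.Nat.sum_antidiagonal_eq_sum_range_succ_mk, Finset.sum_range_succ',
      Finset.sum_range_succ,
      Finset.sum_range fun i => (normal k₀ (i + 1)).form (normal k₀ (n + 1 - (i + 1)))]
    simp only [Nat.add_sub_add_right, Nat.sub_self, Nat.sub_zero, hleft, hright]
    rw [add_assoc, ← add_smul, ← two_mul, ha, add_neg_cancel]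

theorem Graded.two_mul_a_mul_sub {n : Entries PS} (h : n.Graded) :
    2 * (n.a * (X * Dx n.a - n.zBracket.a)) = X * Dx (n.form n) -
      (X * Dx n.b - n.zBracket.b) * n.g - n.b * (X * Dx n.g - n.zBracket.g) -
      2 * ((X * Dx n.ρ - n.zBracket.ρ) * n.δ) - 2 * (n.ρ * (X * Dx n.δ - n.zBracket.δ)) := by
  have hk := h.forall₂_hasKind .nil
  rw [zBracket, form]
  exact eq_of_check isEvenDer_Dx _ _ hk (by decide +kernel)

theorem isStationary_of_form_eq {n : Entries PS} {k₀ : ℂ} (hk₀ : k₀ ≠ 0) (h : n.Graded)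
    (heq : n.OffDiagEq) (ha : coeff 0 n.a = algebraMap ℂ Alg k₀)
    (hform : n.form n = algebraMap ℂ PS k₀ * algebraMap ℂ PS k₀) : n.IsStationary := by
  refine ⟨h, heq, ?_⟩
  have hconst : Dx (algebraMap ℂ PS k₀ * algebraMap ℂ PS k₀) = 0 := by
    rw [← map_mul]
    exact (hasKind_algebraMap_PS _).2
  have hmul := h.two_mul_a_mul_sub
  rw [hform, hconst, heq.eq_b, heq.eq_g, heq.eq_ρ, heq.eq_δ] at hmul
  simp only [sub_self, mul_zero, zero_mul] at hmul
  exact sub_eq_zero.1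
    ((isUnit_of_coeff_zero hk₀ ha).mul_right_eq_zero.1 (two_mul_eq_zero.1 hmul))

theorem isStationary_normal {k₀ : ℂ} (hk₀ : k₀ ≠ 0) : (series (normal k₀)).IsStationary := by
  refine isStationary_of_form_eq hk₀ (graded_iff_coeffs.2 fun m => ?_)
    (offDiagEq_iff.2 ⟨?_, fun m => ?_⟩) ?_ (form_normal hk₀)
  · rw [coeffs_series]
    exact graded_normal k₀ m
  · rw [coeffs_series]
    simp [normal, series]
  · rw [coeffs_series, coeffs_series]
    simp only [series, PowerSeries.coeff_mk]
    rw [normal.eq_2]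
    rfl
  · simp [normal, series]

end Entries

/-- The normalized solution. -/
def normalCoeffs (k₀ : ℂ) : Coeffs where
  a n := (Entries.normal k₀ n).a
  b n := (Entries.normal k₀ n).b
  c n := (1 / 2 : ℂ) • (Entries.normal k₀ n).g + (Entries.normal k₀ n).b
  ρ n := (Entries.normal k₀ n).ρ
  δ n := (Entries.normal k₀ n).δ

theorem series_normalCoeffs (k₀ : ℂ) :
    (normalCoeffs k₀).series = Entries.series (Entries.normal k₀) := by
  have hg : (normalCoeffs k₀).g = fun n => (Entries.normal k₀ n).g := by
    funext n
    simp only [Coeffs.g, normalCoeffs, two_mul]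
    module
  exact congrArg Entries.series (funext fun m => Entries.ext rfl rfl (congrFun hg m) rfl rfl)

namespace Coeffs

variable {N N' : Coeffs} {k₀ : ℂ}

theorem IsSolution.isNormalized_iff_eq_one (hk₀ : k₀ ≠ 0) (h : N.IsSolution k₀)
    (hn : N.IsNormalized k₀) (h' : N'.IsSolution k₀) {f : PowerSeries ℂ} (hf : coeff 0 f = 1)
    (hN' : N'.series = N.series.map (scal f * ·)) : N'.IsNormalized k₀ ↔ f = 1 := by
  rw [isNormalized_iff h.isStationary.toGraded] at hn
  rw [isNormalized_iff h'.isStationary.toGraded, hN', Entries.form_map_scal, hn]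
  constructor
  · intro hff
    have hunit : IsUnit (algebraMap ℂ PS k₀ * algebraMap ℂ PS k₀) := by
      rw [← map_mul]
      exact (isUnit_iff_ne_zero.2 (mul_ne_zero hk₀ hk₀)).map _
    have hff_one : scal (f * f) = scal 1 := by
      rw [map_one]
      exact hunit.mul_right_cancel (by rw [hff, one_mul])
    refine (mul_self_eq_one_iff.1 (scal_injective hff_one)).resolve_right ?_
    rintro rfl
    norm_num at hf
  · rintro rfl
    rw [mul_one, map_one, one_mul]

end Coeffs

theorem existsUnique_normalized {k₀ : ℂ} (hk₀ : k₀ ≠ 0) :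
    ∃! N : Coeffs, N.IsSolution k₀ ∧ N.IsNormalized k₀ := by
  have hs : (normalCoeffs k₀).series.IsStationary := by
    rw [series_normalCoeffs]
    exact Entries.isStationary_normal hk₀
  have h : (normalCoeffs k₀).IsSolution k₀ :=
    Coeffs.isSolution_of_isStationary hs (by simp [normalCoeffs, Entries.normal])
  have hn : (normalCoeffs k₀).IsNormalized k₀ := by
    rw [Coeffs.isNormalized_iff hs.toGraded, series_normalCoeffs]
    exact Entries.form_normal hk₀
  refine ⟨_, ⟨h, hn⟩, fun N' ⟨h', hn'⟩ => ?_⟩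
  obtain ⟨f, hf, hN'⟩ :=
    hs.exists_eq_map_scal hk₀ h'.isStationary h.coeff_zero_a h'.coeff_zero_a
  obtain rfl := (h.isNormalized_iff_eq_one hk₀ hn h' hf hN').1 hn'
  refine Coeffs.series_injective (hN'.trans ?_)
  simp only [map_one, one_mul]
  rfl

/-! ### The Riccati variables -/

/-- The right-hand side of the Riccati equation for `s`. -/
abbrev riccS (s σ : PS) : PS :=
  2 * s + X * (-(2 * (sw + 1)) - sv * s + sβ * σ - s * s - sα * σ * s)

/-- The right-hand side of the Riccati equation for `σ`. -/
abbrev riccσ (s σ : PS) : PS :=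
  σ + X * (sβ - sα * s - (1 / 2 : ℂ) • (sv * σ) - s * σ)

/-- The solution `n` with `½ Str n² = κ²`, expressed by `n.b`, `n.ρ` and the ratios `s` and `σ` of
the components of the eigenvector `(1, s, σ)` of `n` for the eigenvalue `κ`. -/
def riccEntries (κ b ρ s σ : PS) : Entries PS where
  a := κ - b * s - ρ * σ
  b := b
  g := (κ + (κ - b * s - ρ * σ)) * s - (κ * σ + ρ * s) * σ
  ρ := ρ
  δ := κ * σ + ρ * s

/-- The parities of the data of `riccEntries`, where `κ` is a constant. -/
structure RiccatiParity (κ b ρ s σ : PS) : Prop where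
  const_κ : HasKind Dx .const κ
  par_b : par b = b
  par_ρ : par ρ = -ρ
  par_s : par s = s
  par_σ : par σ = -σ

namespace RiccatiParity

variable {κ b ρ s σ : PS}

theorem forall₂_hasKind (h : RiccatiParity κ b ρ s σ) {ks : List Kind} {env : List PS}
    (hk : List.Forall₂ (HasKind Dx) ks env) :
    List.Forall₂ (HasKind Dx)
      (.const :: .even :: .even :: .odd :: .odd :: .const :: .even :: .odd :: .even :: .odd :: ks)
      (X :: sv :: sw :: sα :: sβ :: κ :: b :: ρ :: s :: σ :: env) := by
  obtain ⟨hv, hw, hα, hβ⟩ := hasKind_fields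
  simp only [List.forall₂_cons]
  exact ⟨hasKind_X, hv, hw, hα, hβ, h.const_κ, h.par_b, h.par_ρ, h.par_s, h.par_σ, hk⟩

theorem b_mul_g (h : RiccatiParity κ b ρ s σ) :
    b * (riccEntries κ b ρ s σ).g =
      κ * κ - (riccEntries κ b ρ s σ).a * (riccEntries κ b ρ s σ).a -
        2 * (ρ * (riccEntries κ b ρ s σ).δ) := by
  have hk := h.forall₂_hasKind .nil
  simp only [riccEntries]
  exact eq_of_check isEvenDer_Dx _ _ hk (by decide +kernel)

theorem riccσ_add_riccS (h : RiccatiParity κ b ρ s σ) {n : Entries PS}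
    (hn : n = riccEntries κ b ρ s σ) :
    κ * (X * Dx σ - riccσ s σ) + ρ * (X * Dx s - riccS s σ) =
      X * Dx n.δ - n.zBracket.δ - (X * Dx n.ρ - n.zBracket.ρ) * s := by
  have hk := h.forall₂_hasKind .nil
  subst hn
  simp only [Entries.zBracket, riccEntries]
  exact eq_of_check isEvenDer_Dx _ _ hk (by decide +kernel)

theorem riccS_add_riccσ (h : RiccatiParity κ b ρ s σ) {n : Entries PS}
    (hn : n = riccEntries κ b ρ s σ) :
    b * (X * Dx s - riccS s σ) + ρ * (X * Dx σ - riccσ s σ) =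
      -(X * Dx n.a - n.zBracket.a) - (X * Dx n.b - n.zBracket.b) * s -
        (X * Dx n.ρ - n.zBracket.ρ) * σ := by
  have hk := h.forall₂_hasKind .nil
  subst hn
  simp only [Entries.zBracket, riccEntries]
  exact eq_of_check isEvenDer_Dx _ _ hk (by decide +kernel)

end RiccatiParity

/-- `s` and `σ` are Riccati variables of the stationary solution `riccEntries κ b ρ s σ`. -/
structure RiccatiForm (κ b ρ s σ : PS) : Prop extends RiccatiParity κ b ρ s σ where
  stationary : (riccEntries κ b ρ s σ).IsStationary
  eq_s : X * Dx s = riccS s σ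
  eq_σ : X * Dx σ = riccσ s σ

namespace Entries.IsStationary

variable {n : Entries PS} {k₀ : ℂ}

theorem exists_b_eq_X_mul (h : n.IsStationary) (hk₀ : k₀ ≠ 0)
    (ha : coeff 0 n.a = algebraMap ℂ Alg k₀) : ∃ u, IsUnit u ∧ n.b = X * u := by
  obtain ⟨h0, hnext⟩ := offDiagEq_iff.1 h.toOffDiagEq
  have hb0 : coeff 0 n.b = 0 := congrArg Entries.b h0
  have hb1 : coeff 1 n.b = algebraMap ℂ Alg (-k₀) := by
    have hb : coeff (0 + 1) n.b = _ := congrArg Entries.b (hnext 0)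
    rw [h0, next, ha, map_zero] at hb
    rw [zero_add] at hb
    rw [hb, map_neg]
    simp only [mul_zero, zero_sub, sub_zero, two_mul]
    module
  obtain ⟨u, hu⟩ := PowerSeries.X_dvd_iff.2
    ((PowerSeries.coeff_zero_eq_constantCoeff_apply n.b).symm.trans hb0)
  refine ⟨u, isUnit_of_coeff_zero (neg_ne_zero.2 hk₀) ?_, hu⟩
  rw [← hb1, hu]
  exact (PowerSeries.coeff_succ_X_mul 0 u).symm

theorem b_mul_left_cancel (h : n.IsStationary) (hk₀ : k₀ ≠ 0)
    (ha : coeff 0 n.a = algebraMap ℂ Alg k₀) {x y : PS} (hxy : n.b * x = n.b * y) : x = y := by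
  obtain ⟨u, hu, hb⟩ := h.exists_b_eq_X_mul hk₀ ha
  rw [hb, mul_assoc, mul_assoc] at hxy
  exact hu.mul_left_cancel (PowerSeries.X_mul_cancel hxy)

theorem b_dvd (h : n.IsStationary) (hk₀ : k₀ ≠ 0) (ha : coeff 0 n.a = algebraMap ℂ Alg k₀) {x : PS}
    (hx : coeff 0 x = 0) : n.b ∣ x := by
  obtain ⟨u, hu, hb⟩ := h.exists_b_eq_X_mul hk₀ ha
  obtain ⟨y, rfl⟩ := PowerSeries.X_dvd_iff.2
    ((PowerSeries.coeff_zero_eq_constantCoeff_apply x).symm.trans hx)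
  refine ⟨hu.unit⁻¹ * y, ?_⟩
  rw [hb, mul_assoc, ← mul_assoc u, IsUnit.mul_val_inv, one_mul]

theorem exists_riccEntries (h : n.IsStationary) (hk₀ : k₀ ≠ 0)
    (ha : coeff 0 n.a = algebraMap ℂ Alg k₀)
    (hn : n.form n = algebraMap ℂ PS k₀ * algebraMap ℂ PS k₀) :
    ∃ s σ, RiccatiParity (algebraMap ℂ PS k₀) n.b n.ρ s σ ∧
      n = riccEntries (algebraMap ℂ PS k₀) n.b n.ρ s σ := by
  have cancel : ∀ {x y : PS}, n.b * x = n.b * y → x = y := h.b_mul_left_cancel hk₀ ha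
  have κ_mul_i : algebraMap ℂ PS k₀ * algebraMap ℂ PS k₀⁻¹ = 1 := by
    rw [← map_mul, mul_inv_cancel₀ hk₀, map_one]
  have hκ := hasKind_algebraMap_PS k₀
  have hi := hasKind_algebraMap_PS k₀⁻¹
  have coeff_κ : coeff 0 (algebraMap ℂ PS k₀) = coeff 0 n.a := by
    rw [algebraMap_PS, PowerSeries.coeff_zero_C, ha]
  generalize algebraMap ℂ PS k₀ = κ at *
  generalize algebraMap ℂ PS k₀⁻¹ = i at *
  have coeff_ρ : coeff 0 n.ρ = 0 := congrArg Entries.ρ (offDiagEq_iff.1 h.toOffDiagEq).1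
  obtain ⟨s, hs⟩ : n.b ∣ κ - n.a - i * (n.ρ * n.δ) := h.b_dvd hk₀ ha (by
    rw [map_sub, map_sub, coeff_κ, sub_self, zero_sub, neg_eq_zero]
    simp [PowerSeries.coeff_mul, coeff_ρ])
  have par_s : par s = s := cancel (by
    rw [← hs, ← h.par_b, ← map_mul, ← hs]
    simp only [map_sub, map_mul, hκ.1, hi.1, h.par_a, h.par_ρ, h.par_δ, neg_mul_neg])
  obtain ⟨σ, hσ⟩ : ∃ σ, σ = i * (n.δ - n.ρ * s) := ⟨_, rfl⟩
  have par_σ : par σ = -σ := by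
    rw [hσ, map_mul, map_sub, map_mul, par_s, hi.1, h.par_ρ, h.par_δ]
    noncomm_ring
  have hδ : n.δ = κ * σ + n.ρ * s := by
    rw [hσ, ← mul_assoc, κ_mul_i, one_mul, sub_add_cancel]
  have hρσ : i * (n.ρ * n.δ) = n.ρ * σ := by
    rw [hσ, ← mul_assoc n.ρ, ← comm_of_even i _ hi.1, mul_assoc, mul_sub, ← mul_assoc n.ρ n.ρ,
      mul_self_of_odd h.par_ρ, zero_mul, sub_zero]
  have ha' : n.a = κ - n.b * s - n.ρ * σ := by
    rw [← hs, hρσ]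
    abel
  have hp : RiccatiParity κ n.b n.ρ s σ := ⟨hκ, h.par_b, h.par_ρ, par_s, par_σ⟩
  refine ⟨s, σ, hp, Entries.ext ha' rfl (cancel ?_) rfl hδ⟩
  rw [hp.b_mul_g, riccEntries, ← ha', ← hδ, ← hn, form]
  abel

theorem exists_riccatiForm (h : n.IsStationary) (hk₀ : k₀ ≠ 0)
    (ha : coeff 0 n.a = algebraMap ℂ Alg k₀)
    (hn : n.form n = algebraMap ℂ PS k₀ * algebraMap ℂ PS k₀) :
    ∃ s σ, RiccatiForm (algebraMap ℂ PS k₀) n.b n.ρ s σ ∧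
      n = riccEntries (algebraMap ℂ PS k₀) n.b n.ρ s σ := by
  obtain ⟨s, σ, hp, hn'⟩ := h.exists_riccEntries hk₀ ha hn
  have κ_cancel : ∀ {x : PS}, algebraMap ℂ PS k₀ * x = 0 → x = 0 := fun {x} hx => by
    rwa [← Algebra.smul_def, smul_eq_zero_iff_right hk₀] at hx
  have hκ := hp.riccσ_add_riccS hn'
  have hb := hp.riccS_add_riccσ hn'
  simp only [h.eq_a, h.eq_b, h.eq_ρ, h.eq_δ, sub_self, zero_mul, neg_zero] at hκ hb
  have hρσ : n.ρ * (X * Dx σ - riccσ s σ) = 0 := κ_cancel (by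
    rw [← mul_assoc, comm_of_even _ _ hp.const_κ.1, mul_assoc, eq_neg_of_add_eq_zero_left hκ,
      mul_neg, ← mul_assoc, mul_self_of_odd hp.par_ρ, zero_mul, neg_zero])
  have hs : X * Dx s - riccS s σ = 0 := h.b_mul_left_cancel hk₀ ha (by
    rwa [hρσ, add_zero, ← mul_zero n.b] at hb)
  have hσ : X * Dx σ - riccσ s σ = 0 := κ_cancel (by rwa [hs, mul_zero, add_zero] at hκ)
  exact ⟨s, σ, ⟨hp, hn' ▸ h, sub_eq_zero.1 hs, sub_eq_zero.1 hσ⟩, hn'⟩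

end Entries.IsStationary

/-! ### Variations of the Riccati variables -/

/-- The contraction of the gradient `(a, -2 b, -2 δ, 2 ρ)` with a variation `y` of the fields. -/
def Entries.contract {S : Type*} [Ring S] (n : Entries S) (y : Fin 4 → S) : S :=
  n.a * y 0 - 2 * (n.b * y 1) - 2 * (n.δ * y 2) + 2 * (n.ρ * y 3)

/-- The linearization of `riccS` at `s`, `σ` for the variations `y`, `s'`, `σ'` of the fields and of
`s`, `σ`, where `z` is multiplied by `m`. -/
abbrev linRiccS (m s σ : PS) (y : Fin 4 → PS) (s' σ' : PS) : PS :=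
  2 * s' - 2 * (m * s) + X * (-(2 * y 1) - (y 0 * s + sv * s') + (y 3 * σ + sβ * σ') -
    (s' * s + s * s') - ((y 2 * σ + sα * σ') * s + sα * σ * s'))

/-- The linearization of `riccσ`, as in `linRiccS`. -/
abbrev linRiccσ (m s σ : PS) (y : Fin 4 → PS) (s' σ' : PS) : PS :=
  σ' - m * σ + X * (y 3 - (y 2 * s + sα * s') - (1 / 2 : ℂ) • (y 0 * σ + sv * σ') -
    (s' * σ + s * σ'))

theorem RiccatiParity.contract_eq {κ b ρ s σ m s' σ' : PS} {y : Fin 4 → PS} {n : Entries PS}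
    (h : RiccatiParity κ b ρ s σ) (hn : n = riccEntries κ b ρ s σ)
    (hk : List.Forall₂ (HasKind Dx) [.const, .even, .even, .odd, .odd, .even, .odd]
      [m, y 0, y 1, y 2, y 3, s', σ']) :
    2 * (m * n.a) + X * n.contract y -
        2 * (κ * (m + X * ((1 / 2 : ℂ) • y 0 + s' + (y 2 * σ + sα * σ')))) -
        X * Dx (b * s' + (2 * ρ + b * σ) * σ') =
      -((X * Dx n.b - n.zBracket.b) * (s' + σ * σ') + b * (X * Dx s' - linRiccS m s σ y s' σ') +
        (2 * (X * Dx n.ρ - n.zBracket.ρ) + b * (X * Dx σ - riccσ s σ)) * σ' +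
        (2 * ρ + b * σ) * (X * Dx σ' - linRiccσ m s σ y s' σ')) := by
  have hk := h.forall₂_hasKind hk
  subst hn
  simp only [Entries.contract, Entries.zBracket, riccEntries]
  exact eq_of_check isEvenDer_Dx _ _ hk (by decide +kernel)

/-- An even derivation commuting with `∂` and multiplying `z` by the constant `m`. -/
structure IsVariation (m : PS) (T : PS →ₗ[ℂ] PS) : Prop where
  const_m : HasKind Dx .const m
  der : IsEvenDer T
  comm : ∀ x, T (Dx x) = Dx (T x)
  apply_X : T X = m * X

namespace RiccatiForm

variable {κ b ρ s σ m : PS} {T : PS →ₗ[ℂ] PS}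

theorem X_mul_Dx_map_s (h : RiccatiForm κ b ρ s σ) (hT : IsVariation m T) :
    X * Dx (T s) = linRiccS m s σ ![T sv, T sw, T sα, T sβ] (T s) (T σ) := by
  have T_two_mul : ∀ x, T (2 * x) = 2 * T x := fun x => by rw [two_mul, map_add, two_mul]
  have hTs := congrArg T h.eq_s
  simp only [riccS, map_add, map_sub, map_neg, T_two_mul, hT.der.leibniz, hT.apply_X,
    hT.der.map_one, hT.comm, add_zero] at hTs
  rw [mul_assoc m X (Dx s), h.eq_s, riccS, mul_add m, ← mul_assoc m X] at hTs
  simp only [linRiccS, Matrix.cons_val]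
  linear_combination (norm := (simp only [two_mul, mul_add]; abel)) hTs

theorem X_mul_Dx_map_σ (h : RiccatiForm κ b ρ s σ) (hT : IsVariation m T) :
    X * Dx (T σ) = linRiccσ m s σ ![T sv, T sw, T sα, T sβ] (T s) (T σ) := by
  have hTσ := congrArg T h.eq_σ
  simp only [riccσ, map_add, map_sub, map_smul, hT.der.leibniz, hT.apply_X, hT.comm] at hTσ
  rw [mul_assoc m X (Dx σ), h.eq_σ, riccσ, mul_add m, ← mul_assoc m X] at hTσ
  simp only [linRiccσ, Matrix.cons_val]
  linear_combination (norm := abel) hTσ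

/-- On the left, `½ T v + T s + T (α σ)` is the variation of the conserved density
`½ v + s + α σ`. -/
theorem contract_sub_eq (h : RiccatiForm κ b ρ s σ) (hT : IsVariation m T) {n : Entries PS}
    (hn : n = riccEntries κ b ρ s σ) :
    2 * (m * n.a) + X * n.contract ![T sv, T sw, T sα, T sβ] -
        2 * (κ * (m + X * ((1 / 2 : ℂ) • T sv + T s + T (sα * σ)))) =
      X * Dx (b * T s + (2 * ρ + b * σ) * T σ) := by
  obtain ⟨hv, hw, hα, hβ⟩ := hasKind_fields
  have even : ∀ {x : PS}, par x = x → par (T x) = T x := fun hx => by rw [hT.der.par, hx]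
  have odd : ∀ {x : PS}, par x = -x → par (T x) = -T x := fun hx => by
    rw [hT.der.par, hx, map_neg]
  have hk : List.Forall₂ (HasKind Dx) [.const, .even, .even, .odd, .odd, .even, .odd]
      [m, T sv, T sw, T sα, T sβ, T s, T σ] := by
    simp only [List.forall₂_cons, List.forall₂_nil_left_iff]
    exact ⟨hT.const_m, even hv, even hw, odd hα, odd hβ, even h.par_s, odd h.par_σ, trivial⟩
  have heq := h.contract_eq (y := ![T sv, T sw, T sα, T sβ]) hn hk
  have hs := hn ▸ h.stationary
  rw [hs.eq_b, hs.eq_ρ, h.eq_σ, h.X_mul_Dx_map_s hT, h.X_mul_Dx_map_σ hT] at heq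
  simp only [sub_self, mul_zero, zero_mul, add_zero, neg_zero] at heq
  rw [hT.der.leibniz sα σ]
  exact sub_eq_zero.1 heq

end RiccatiForm

/-! ### The Hamiltonians -/

/-- The derivation `z d/dz`. -/
def zder : PS →ₗ[ℂ] PS where
  toFun f := PowerSeries.mk fun n => (n : ℂ) • coeff n f
  map_add' f g := by ext n; simp
  map_smul' c f := by ext n; simp [smul_comm c]

@[simp] theorem coeff_zder (n : ℕ) (f : PS) : coeff n (zder f) = (n : ℂ) • coeff n f := by
  simp [zder]

theorem isEvenDer_zder : IsEvenDer zder where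
  leibniz f g := by
    ext n
    simp only [coeff_zder, PowerSeries.coeff_mul, map_add, Finset.smul_sum,
      ← Finset.sum_add_distrib]
    refine Finset.sum_congr rfl fun p hp => ?_
    rw [← Finset.HasAntidiagonal.mem_antidiagonal.1 hp, smul_mul_assoc, mul_smul_comm, ← add_smul]
    push_cast
    rfl
  par f := by
    ext n
    rw [coeff_par, coeff_zder, coeff_zder, coeff_par, map_smul]

theorem zder_C (f : Alg) : zder (C f) = 0 := by
  ext n
  rw [coeff_zder, PowerSeries.coeff_C, map_zero]
  split_ifs with h <;> simp [h]

theorem isVariation_zder : IsVariation 1 zder where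
  const_m := by simpa using hasKind_algebraMap_PS 1
  der := isEvenDer_zder
  comm f := by
    ext n
    simp
  apply_X := by
    ext n
    rw [coeff_zder, one_mul, PowerSeries.coeff_X]
    split_ifs with h <;> simp [h]

theorem isVariation_cmap_ev {Y : Fin 4 → Alg} (hY : Typed Y) : IsVariation 0 (cmap (ev Y hY)) where
  const_m := by simpa using hasKind_algebraMap_PS 0
  der := isEvenDer_cmap ⟨ev_mul hY, parity_der _⟩
  comm := cmap_comm (ev_D hY)
  apply_X := by
    ext n
    rw [coeff_cmap, zero_mul, PowerSeries.coeff_X, map_zero]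
    split_ifs
    · simpa using derivation_algebraMap (ev_mul hY) 1
    · exact map_zero _

theorem coeff_algebraMap_mul (c : ℂ) (n : ℕ) (f : PS) :
    coeff n (algebraMap ℂ PS c * f) = c • coeff n f := by
  rw [algebraMap_PS, PowerSeries.coeff_C_mul, Algebra.smul_def]

/-- The variations `z d/dz` and `ev Y` of the conserved density are related by applying `ev Y` to
the first one. -/
theorem RiccatiForm.two_smul_ev_sub_mem {k₀ : ℂ} {b ρ s σ : PS} {n : Entries PS}
    (h : RiccatiForm (algebraMap ℂ PS k₀) b ρ s σ)
    (hn : n = riccEntries (algebraMap ℂ PS k₀) b ρ s σ) {Y : Fin 4 → Alg} (hY : Typed Y) (m : ℕ) :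
    (2 : ℂ) • ev Y hY (coeff (m + 1) n.a) - (m : ℂ) • (n.coeffs m).contract Y ∈
      LinearMap.range dx := by
  have hz := congrArg (coeff (m + 1)) (h.contract_sub_eq isVariation_zder hn)
  have hY' := congrArg (coeff (m + 1)) (h.contract_sub_eq (isVariation_cmap_ev hY) hn)
  simp only [Entries.contract, Matrix.cons_val, zder_C, mul_zero, sub_zero, zero_mul, add_zero,
    zero_add, smul_zero, one_mul, map_sub, coeff_two_mul, coeff_algebraMap_mul, map_add,
    PowerSeries.coeff_succ_X_mul, PowerSeries.coeff_one, if_neg m.succ_ne_zero, coeff_cmap,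
    coeff_zder, cmap_C, ev_field, PowerSeries.coeff_mul_C, PowerSeries.coeff_smul] at hz hY'
  have hC : (m : ℂ) • coeff m (C (Y 0)) = 0 := by
    rw [PowerSeries.coeff_C]
    split_ifs with h <;> simp [h]
  generalize coeff m ((2 * ρ + b * σ) * zder σ) = y₁ at hz
  generalize coeff m ((2 * ρ + b * σ) * cmap (ev Y hY) σ) = y₂ at hY'
  have hevz := congrArg (ev Y hY) hz
  simp only [two_mul, map_sub, map_add, map_smul, ev_D] at hevz
  rw [two_mul (k₀ • _)] at hY'
  simp only [Entries.contract, Entries.coeffs, Entries.map]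
  generalize coeff m n.a * Y 0 - 2 * (coeff m n.b * Y 1) - 2 * (coeff m n.δ * Y 2) +
    2 * (coeff m n.ρ * Y 3) = G at *
  refine ⟨ev Y hY (coeff m (b * zder s)) + ev Y hY y₁ -
    (m : ℂ) • (coeff m (b * cmap (ev Y hY) s) + y₂), ?_⟩
  simp only [map_sub, map_add, map_smul]
  linear_combination (norm := module) -hevz + (m : ℂ) • hY' + k₀ • hC

theorem grad_smul (c : ℂ) (f : Alg) : grad (c • f) = c • grad f :=
  funext fun i => euler_smul i c f

theorem grad_add (f g : Alg) : grad (f + g) = grad f + grad g :=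
  funext fun i => euler_add i f g

theorem grad_field (i : Fin 4) : grad (field i) = Pi.single i 1 := by
  funext j
  have h : OrderLT 1 (field i) := fun z hz => by
    rw [field, pd_gen, if_neg]
    rintro rfl
    exact absurd hz (by simp)
  rw [grad, euler_eq_sum h, Finset.sum_range_one, pow_zero, Module.End.one_apply, field, pd_gen]
  by_cases hij : i = j
  · subst hij; simp
  · rw [if_neg (by simpa using hij), Pi.single_apply, if_neg (Ne.symm hij)]

section Normalized

variable {N : Coeffs} {k₀ : ℂ} (hk₀ : k₀ ≠ 0) (h : N.IsSolution k₀) (hn : N.IsNormalized k₀)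

include hk₀ h hn

theorem two_smul_grad_a (n : ℕ) : (2 : ℂ) • grad (N.a (n + 1)) = (n : ℂ) • N.vec n := by
  obtain ⟨s, σ, hs, hN⟩ := h.isStationary.exists_riccatiForm hk₀ h.coeff_zero_a
    ((Coeffs.isNormalized_iff h.isStationary.toGraded k₀).1 hn)
  have ha : coeff (n + 1) N.series.a = N.a (n + 1) :=
    congrArg Entries.a (N.coeffs_series (n + 1))
  rw [← sub_eq_zero]
  refine eq_zero_of_sum_mul_mem (odd := oddField) (j := 0) rfl fun Y hY => ?_
  have hvar := hs.two_smul_ev_sub_mem hN hY n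
  rw [N.coeffs_series, ha] at hvar
  have hgrad : _ - ∑ i, grad _ i * Y i ∈ LinearMap.range dx :=
    ev_sub_sum_euler_mem hY (N.a (n + 1))
  convert sub_mem hvar (Submodule.smul_mem _ (2 : ℂ) hgrad) using 1
  simp only [Fin.sum_univ_four, Pi.sub_apply, Pi.smul_apply, Coeffs.vec, Coeffs.entries,
    Entries.contract, Matrix.cons_val, sub_mul, smul_mul_assoc, neg_mul, mul_assoc]
  module

theorem grad_ham (n : ℕ) : grad (N.ham k₀ n) = N.vec n := by
  unfold Coeffs.ham
  split_ifs with hn₀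
  · subst hn₀
    obtain ⟨ha, hb, -, hρ, hδ⟩ := h.init
    rw [grad_smul, grad_field, Coeffs.vec, ha, hb, hρ, hδ]
    funext i
    fin_cases i <;> simp [Algebra.smul_def]
  · rw [grad_smul, div_eq_inv_mul, mul_smul, two_smul_grad_a hk₀ h hn, smul_smul,
      inv_mul_cancel₀ (Nat.cast_ne_zero.2 hn₀), one_smul]

end Normalized

/-! ### The super-trace identity -/

theorem coeff_dlam (f : Ser) (m : ℤ) :
    (dlam f).coeff m = -(((m - 1 : ℤ) : ℂ) • f.coeff (m - 1)) := by
  have h : m - 2 + (1 : ℕ) = m - 1 := by push_cast; ring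
  rw [dlam, HahnSeries.coeff_neg, HahnSeries.coeff_single_mul, one_mul,
    LaurentSeries.derivative_apply, LaurentSeries.hasseDeriv_coeff, Ring.choose_one_right, h,
    Int.cast_smul_eq_zsmul]

theorem dlam_add (f g : Ser) : dlam (f + g) = dlam f + dlam g := by
  simp only [dlam, map_add, mul_add, neg_add]

theorem dlam_neg (f : Ser) : dlam (-f) = -dlam f := by
  simp only [dlam, map_neg, mul_neg]

theorem dlam_con (f : Alg) : dlam (con f) = 0 := by
  ext m
  rw [coeff_dlam, HahnSeries.coeff_zero, HahnSeries.C_apply, HahnSeries.coeff_single]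
  split_ifs with h <;> simp [h]

theorem dlam_lam : dlam lam = 1 := by
  ext m
  rw [coeff_dlam, lam, HahnSeries.coeff_single, HahnSeries.coeff_one]
  by_cases h : m = 0
  · subst h; simp
  · rw [if_neg (by lia), if_neg h, smul_zero, neg_zero]

theorem specM_map_dlam : specM.map dlam = !![-1, 0, 0; 0, 1, 0; 0, 0, 0] := by
  have hone : dlam (1 : Ser) = 0 := by simpa using dlam_con 1
  have hzero : dlam (0 : Ser) = 0 := by simpa using dlam_con 0
  ext1 i j
  fin_cases i <;> fin_cases j <;>
    simp only [specM, Matrix.map_apply, Matrix.of_apply, Matrix.cons_val, Fin.zero_eta, Fin.mk_one,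
      Fin.reduceFinMk, Fin.isValue, sub_eq_add_neg (lam), dlam_add, dlam_neg, dlam_con, dlam_lam,
      hone, hzero, neg_zero, add_zero]

theorem map_con (T : Alg →ₗ[ℂ] Alg) (f : Alg) : (con f).map T = con (T f) := by
  ext m
  rw [HahnSeries.map_coeff, HahnSeries.C_apply, HahnSeries.C_apply, HahnSeries.coeff_single,
    HahnSeries.coeff_single]
  split_ifs <;> simp

theorem ser_map_add (T : Alg →ₗ[ℂ] Alg) (f g : Ser) : (f + g).map T = f.map T + g.map T := by
  ext m
  simp

theorem ser_map_neg (T : Alg →ₗ[ℂ] Alg) (f : Ser) : (-f).map T = -f.map T := by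
  ext m
  simp

theorem map_lam {T : Alg →ₗ[ℂ] Alg} (hT : T 1 = 0) : lam.map T = 0 := by
  ext m
  rw [HahnSeries.map_coeff, lam, HahnSeries.coeff_single, HahnSeries.coeff_zero]
  split_ifs <;> simp [hT]

/-- The derivative of `M` when the fields vary by `y`. -/
def specMDeriv (y : Fin 4 → Alg) : Matrix (Fin 3) (Fin 3) Alg :=
  !![(1 / 2 : ℂ) • y 0, 0, y 2; -(2 * y 1), -((1 / 2 : ℂ) • y 0), y 3; y 3, -y 2, 0]

/-- The embedding of matrices over `Alg` as matrices of constant Laurent series. -/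
abbrev conM : Matrix (Fin 3) (Fin 3) Alg →+* Matrix (Fin 3) (Fin 3) Ser := con.mapMatrix

theorem mapCoeff_specM {T : Alg →ₗ[ℂ] Alg} (hT : T 1 = 0) :
    mapCoeff T specM = conM (specMDeriv fun i => T (field i)) := by
  have hone : (1 : Ser).map T = 0 := by simpa [hT] using map_con T 1
  have hzero : (0 : Ser).map T = 0 := by simpa using map_con T 0
  have htwo : T 2 = 0 := by rw [← one_add_one_eq_two, map_add, hT, add_zero]
  ext1 i j
  fin_cases i <;> fin_cases j <;>
    simp only [mapCoeff, specM, specMDeriv, Matrix.map_apply, Matrix.of_apply, Matrix.cons_val,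
      RingHom.mapMatrix_apply, Fin.zero_eta, Fin.mk_one, Fin.reduceFinMk, Fin.isValue,
      sub_eq_add_neg (lam), ser_map_add, ser_map_neg, map_con, map_lam hT, hone, hzero, htwo,
      two_mul, map_sub T, map_add T, map_neg T, map_smul, map_neg con, map_zero con, neg_zero,
      zero_add, sub_zero]

theorem str_mul_specM_map_dlam (N : Coeffs) :
    str (N.ser * specM.map dlam) = toSer (-(2 * N.series.a)) := by
  rw [specM_map_dlam, N.ser_eq]
  simp [str, Matrix.mul_apply, Fin.sum_univ_three, Entries.mat, two_mul]

theorem str_mul_mapCoeff_specM (N : Coeffs) {T : Alg →ₗ[ℂ] Alg} (hT : T 1 = 0) :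
    str (N.ser * mapCoeff T specM) =
      toSer (N.series.contract fun i => C (T (field i))) := by
  have hhalf : ∀ (x : Ser) (y : Alg), x * con ((1 / 2 : ℂ) • y) + x * con ((1 / 2 : ℂ) • y) =
      x * con y := fun x y => by
    rw [← mul_add, ← map_add, ← add_smul]
    norm_num
  rw [mapCoeff_specM hT, N.ser_eq]
  simp only [str, specMDeriv, Entries.contract, Entries.mat, Matrix.mul_apply, Fin.sum_univ_three,
    Matrix.map_apply, RingHom.mapMatrix_apply, Matrix.of_apply, Matrix.cons_val, Fin.isValue,
    two_mul, map_neg, map_add, map_sub, map_mul, map_zero, toSer_C, mul_zero, add_zero,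
    zero_add, ← hhalf _ (T (field 0)), mul_neg, neg_mul, mul_add]
  abel

theorem str_mul_mapCoeff_pd_specM (N : Coeffs) (i : Fin 4) :
    str (N.ser * mapCoeff (JetAlg.pd oddField (i, 0)) specM) =
      toSer (PowerSeries.mk fun m => N.vec m i) := by
  have hone : JetAlg.pd oddField (i, 0) 1 = 0 := by
    simpa using pd_algebraMap (odd := oddField) (i, 0) 1
  have hfield : ∀ j, JetAlg.pd oddField (i, 0) (field j) = if j = i then 1 else 0 := fun j => by
    rw [field, pd_gen]
    simp
  rw [str_mul_mapCoeff_specM N hone]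
  congr 1
  ext m
  simp only [hfield, Entries.contract, map_add, map_sub, coeff_two_mul, PowerSeries.coeff_mul_C]
  fin_cases i <;> simp [Coeffs.vec, Coeffs.series, Entries.series, Coeffs.entries]

theorem supertrace_identity {N : Coeffs} {k₀ : ℂ} (hk₀ : k₀ ≠ 0) (h : N.IsSolution k₀)
    (hn : N.IsNormalized k₀) (i : Fin 4) (m : ℤ) :
    JetAlg.euler oddField i ((str (N.ser * specM.map dlam)).coeff m) =
      (dlam (str (N.ser * mapCoeff (JetAlg.pd oddField (i, 0)) specM))).coeff m := by
  have ha : ∀ n, coeff n (-(2 * N.series.a)) = (-2 : ℂ) • N.a n := fun n => by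
    rw [map_neg, coeff_two_mul, two_mul, neg_smul, two_smul,
      show coeff n N.series.a = N.a n from congrArg Entries.a (N.coeffs_series n)]
  rw [str_mul_specM_map_dlam, str_mul_mapCoeff_pd_specM, coeff_dlam, PowerSeries.coeff_coe,
    PowerSeries.coeff_coe]
  rcases lt_trichotomy m 0 with hm | rfl | hm
  · rw [if_pos hm, if_pos (by lia), smul_zero, neg_zero, ← map_zero (algebraMap ℂ Alg),
      euler_algebraMap]
    simp
  · rw [if_neg (by lia), if_pos (by lia), smul_zero, neg_zero, Int.natAbs_zero, ha, h.init.1,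
      euler_smul, euler_algebraMap, smul_zero]
  · obtain ⟨n, rfl⟩ : ∃ n : ℕ, m = n + 1 := ⟨(m - 1).toNat, by lia⟩
    have hgrad : (2 : ℂ) • euler oddField i (N.a (n + 1)) = (n : ℂ) • N.vec n i :=
      congrFun (two_smul_grad_a hk₀ h hn n) i
    rw [if_neg (by lia), if_neg (by lia), PowerSeries.coeff_mk, add_sub_cancel_right,
      Int.natAbs_natCast, Int.cast_natCast, show ((n : ℤ) + 1).natAbs = n + 1 by lia, ha,
      euler_smul, neg_smul, hgrad]

/-! ### The flows -/

namespace Entries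

/-- The properties of a coefficient of a solution that do not involve the other coefficients. -/
structure IsCoefficient (p : Entries Alg) : Prop extends p.Graded where
  dx_a : dx p.a = p.g + 2 * ((fw + 1) * p.b) + fα * p.δ + fβ * p.ρ

theorem Graded.forall₂_hasKind_dx {p : Entries Alg} (h : p.Graded) : List.Forall₂ (HasKind dx)
    [.even, .even, .odd, .odd, .even, .even, .even, .odd, .odd]
    [fv, fw, fα, fβ, p.a, p.b, p.g, p.ρ, p.δ] := by
  obtain ⟨hv, hw, hα, hβ⟩ := typed_field.kinds
  simp only [List.forall₂_cons, List.forall₂_nil_left_iff]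
  exact ⟨hv, hw, hα, hβ, h.par_a, h.par_b, h.par_g, h.par_ρ, h.par_δ, trivial⟩

end Entries

namespace Coeffs.IsSolution

variable {N : Coeffs} {k₀ : ℂ} (h : N.IsSolution k₀)

include h

theorem isCoefficient (m : ℕ) : (N.entries m).IsCoefficient := by
  rw [← coeffs_series]
  exact ⟨Entries.graded_iff_coeffs.1 h.isStationary.toGraded m, h.isStationary.dx_coeff_a m⟩

theorem entries_succ (m : ℕ) : N.entries (m + 1) = (N.entries m).next (N.a (m + 1)) := by
  have ha : coeff (m + 1) N.series.a = N.a (m + 1) :=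
    congrArg Entries.a (N.coeffs_series (m + 1))
  rw [← coeffs_series, (Entries.offDiagEq_iff.1 h.isStationary.toOffDiagEq).2, coeffs_series, ha]

end Coeffs.IsSolution

/-- The coefficient of `λ` in `M`. -/
def matE : Matrix (Fin 3) (Fin 3) Alg := !![-1, 0, 0; 0, 1, 0; 0, 0, 0]

/-- The part of `M` that is constant in `λ`. -/
def matM : Matrix (Fin 3) (Fin 3) Alg :=
  !![(1 / 2 : ℂ) • fv, 1, fα; -(2 * fw) - 2, -((1 / 2 : ℂ) • fv), fβ; fβ, -fα, 0]

/-- The matrix `b diag(1, -1, 0)` added to the polynomial part of `λⁿ N`. -/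
def diagTerm (b : Alg) : Matrix (Fin 3) (Fin 3) Alg := !![b, 0, 0; 0, -b, 0; 0, 0, 0]

theorem matE_mul_diagTerm (b : Alg) : matE * diagTerm b = diagTerm b * matE := by
  ext1 i j
  fin_cases i <;> fin_cases j <;> simp [matE, diagTerm]

theorem specMDeriv_injective : Function.Injective specMDeriv := by
  intro y y' h
  have h₀ := congrFun₂ h 0 0
  have h₁ := congrFun₂ h 1 0
  simp only [specMDeriv, Matrix.of_apply, Matrix.cons_val] at h₀ h₁
  funext i
  fin_cases i
  · exact smul_right_injective Alg (by norm_num : (1 / 2 : ℂ) ≠ 0) h₀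
  · rw [neg_inj, ← sub_eq_zero, ← mul_sub, two_mul_eq_zero] at h₁
    exact sub_eq_zero.1 h₁
  · exact congrFun₂ h 0 2
  · exact congrFun₂ h 1 2

namespace Entries

variable {p : Entries Alg}

theorem matE_mul_mat_sub (p : Entries Alg) : matE * p.mat - p.mat * matE =
    !![0, -(2 * p.b), -p.ρ; 2 * p.g, 0, p.δ; p.δ, p.ρ, 0] := by
  ext1 i j
  fin_cases i <;> fin_cases j <;> (simp [matE, mat, two_mul]; try abel)

theorem IsCoefficient.mat_map_dx (h : p.IsCoefficient) (a : Alg) : p.mat.map dx =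
    (matE * (p.next a).mat - (p.next a).mat * matE) + (matM * p.mat - p.mat * matM) := by
  have hk := h.forall₂_hasKind_dx
  rw [matE_mul_mat_sub]
  ext1 i j
  fin_cases i <;> fin_cases j <;>
    simp only [mat, matM, next, Matrix.add_apply, Matrix.mul_apply, Matrix.sub_apply,
      Matrix.map_apply, Fin.sum_univ_three, Matrix.of_apply, Matrix.cons_val, Fin.zero_eta,
      Fin.mk_one, Fin.reduceFinMk, Fin.isValue, map_neg dx, map_zero dx, h.dx_a] <;>
    exact eq_of_check (isEvenDer_D oddField) _ _ hk (by decide +kernel)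

/-- The vector field of the `n`-th flow, in terms of the entries of `N_{n+1}`. -/
def flow (p : Entries Alg) : Fin 4 → Alg :=
  ![2 * dx p.b, -dx p.a + fα * p.δ + fβ * p.ρ, fα * p.b - p.ρ, -(fβ * p.b) + p.δ]

theorem IsCoefficient.specMDeriv_flow (h : p.IsCoefficient) : specMDeriv p.flow =
    (matE * p.mat - p.mat * matE) + (diagTerm p.b).map dx -
      (matM * diagTerm p.b - diagTerm p.b * matM) := by
  have hk := h.forall₂_hasKind_dx
  rw [matE_mul_mat_sub]
  ext1 i j
  fin_cases i <;> fin_cases j <;>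
    simp only [specMDeriv, flow, diagTerm, matM, h.dx_a, Matrix.mul_apply, Matrix.add_apply,
      Matrix.sub_apply, Matrix.map_apply, Fin.sum_univ_three, Matrix.of_apply, Matrix.cons_val,
      Fin.zero_eta, Fin.mk_one, Fin.reduceFinMk, Fin.isValue] <;>
    exact eq_of_check (isEvenDer_D oddField) _ _ hk (by decide +kernel)

theorem Graded.typed_flow (h : p.Graded) : Typed p.flow := by
  obtain ⟨-, -, hα, hβ⟩ := typed_field.parity
  obtain ⟨ha, hb, -, hρ, hδ⟩ := h
  change parity oddField _ = _ at ha hb hρ hδ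
  intro i
  fin_cases i
  · refine hasParity_false.2 ?_
    simp [IsEven, flow, parity_D, hb, two_mul]
  · refine hasParity_false.2 ?_
    simp [IsEven, flow, parity_D, ha, hδ, hρ, hα, hβ]
  · refine hasParity_true.2 ?_
    simp [IsOdd, flow, hb, hρ, hα]
    abel
  · refine hasParity_true.2 ?_
    simp [IsOdd, flow, hb, hδ, hβ]
    abel

end Entries

theorem specM_eq : specM = lam • conM matE + conM matM := by
  ext1 i j
  fin_cases i <;> fin_cases j <;> simp [specM, matE, matM, sub_eq_add_neg, -HahnSeries.C_apply]

theorem specM_mul_conM_sub (Q : Matrix (Fin 3) (Fin 3) Alg) :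
    specM * conM Q - conM Q * specM =
      lam • conM (matE * Q - Q * matE) + conM (matM * Q - Q * matM) := by
  rw [specM_eq, add_mul, mul_add, mul_lam_smul, Matrix.smul_mul]
  simp only [map_sub, map_mul, smul_sub]
  abel

theorem mapCoeff_add (T : Alg →ₗ[ℂ] Alg) (A B : Matrix (Fin 3) (Fin 3) Ser) :
    mapCoeff T (A + B) = mapCoeff T A + mapCoeff T B := by
  ext1 i j
  exact ser_map_add T _ _

theorem mapCoeff_lam_smul (T : Alg →ₗ[ℂ] Alg) (A : Matrix (Fin 3) (Fin 3) Ser) :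
    mapCoeff T (lam • A) = lam • mapCoeff T A := by
  ext i j n
  simp only [mapCoeff, Matrix.map_apply, Matrix.smul_apply, smul_eq_mul, HahnSeries.map_coeff, lam,
    HahnSeries.coeff_single_mul, one_mul]

theorem mapCoeff_conM (T : Alg →ₗ[ℂ] Alg) (A : Matrix (Fin 3) (Fin 3) Alg) :
    mapCoeff T (conM A) = conM (A.map T) := by
  ext1 i j
  exact map_con T _

theorem conM_injective : Function.Injective conM := fun _ _ h =>
  Matrix.map_injective HahnSeries.C_injective h

namespace Coeffs

/-- The polynomial part of `λⁿ N`. -/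
def pos (N : Coeffs) (n : ℕ) : Matrix (Fin 3) (Fin 3) Ser :=
  Matrix.of fun i j =>
    ∑ m ∈ Finset.range (n + 1), HahnSeries.single ((m : ℤ) - (n : ℤ)) (N.mat m i j)

theorem pos_zero (N : Coeffs) : N.pos 0 = conM (N.mat 0) := by
  ext1 i j
  simp [pos]

theorem pos_succ (N : Coeffs) (n : ℕ) :
    N.pos (n + 1) = lam • N.pos n + conM (N.mat (n + 1)) := by
  ext1 i j
  rw [Matrix.add_apply, Matrix.smul_apply, pos, pos, Matrix.of_apply, Matrix.of_apply,
    Finset.sum_range_succ, smul_eq_mul, Finset.mul_sum]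
  congr 1
  · refine Finset.sum_congr rfl fun m _ => ?_
    have hm : ((m : ℤ) - ((n + 1 : ℕ) : ℤ)) = -1 + (m - n) := by push_cast; ring
    rw [lam, HahnSeries.single_mul_single, one_mul, hm]
  · simp

theorem aux_eq (N : Coeffs) (n : ℕ) : N.aux n = N.pos n + conM (diagTerm (N.b (n + 1))) := by
  rw [aux, pos]
  congr 1
  ext1 i j
  fin_cases i <;> fin_cases j <;> simp [diagTerm]

namespace IsSolution

variable {N : Coeffs} {k₀ : ℂ} (h : N.IsSolution k₀)

include h

theorem matE_mul_mat_zero_sub : matE * N.mat 0 - N.mat 0 * matE = 0 := by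
  obtain ⟨-, hb, hc, hρ, hδ⟩ := h.init
  rw [mat_eq, Entries.matE_mul_mat_sub]
  ext1 i j
  fin_cases i <;> fin_cases j <;> simp [entries, g, hb, hc, hρ, hδ]

theorem specM_mul_conM_mat_sub (m : ℕ) :
    specM * conM (N.mat m) - conM (N.mat m) * specM - mapCoeff dx (conM (N.mat m)) =
      lam • conM (matE * N.mat m - N.mat m * matE) -
        conM (matE * N.mat (m + 1) - N.mat (m + 1) * matE) := by
  rw [mapCoeff_conM, specM_mul_conM_sub, mat_eq, mat_eq, h.entries_succ,
    (h.isCoefficient m).mat_map_dx (N.a (m + 1)), map_add]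
  abel

theorem specM_mul_pos_sub (n : ℕ) :
    specM * N.pos n - N.pos n * specM - mapCoeff dx (N.pos n) =
      -conM (matE * N.mat (n + 1) - N.mat (n + 1) * matE) := by
  induction n with
  | zero =>
    rw [pos_zero, h.specM_mul_conM_mat_sub, h.matE_mul_mat_zero_sub, map_zero, smul_zero, zero_sub]
  | succ n ih =>
    have hsplit : specM * N.pos (n + 1) - N.pos (n + 1) * specM - mapCoeff dx (N.pos (n + 1)) =
        lam • (specM * N.pos n - N.pos n * specM - mapCoeff dx (N.pos n)) +
          (specM * conM (N.mat (n + 1)) - conM (N.mat (n + 1)) * specM -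
            mapCoeff dx (conM (N.mat (n + 1)))) := by
      rw [pos_succ, mapCoeff_add, mapCoeff_lam_smul, mul_add, add_mul, mul_lam_smul,
        Matrix.smul_mul]
      simp only [smul_sub]
      abel
    rw [hsplit, ih, h.specM_mul_conM_mat_sub, smul_neg]
    abel

theorem specM_mul_aux_sub (n : ℕ) :
    specM * N.aux n - N.aux n * specM - mapCoeff dx (N.aux n) =
      -conM (specMDeriv (N.entries (n + 1)).flow) := by
  have hdiag := specM_mul_conM_sub (diagTerm (N.b (n + 1)))
  rw [matE_mul_diagTerm, sub_self, map_zero, smul_zero, zero_add] at hdiag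
  have hflow : conM (specMDeriv (N.entries (n + 1)).flow) =
      conM (matE * N.mat (n + 1) - N.mat (n + 1) * matE) +
        mapCoeff dx (conM (diagTerm (N.b (n + 1)))) -
        (specM * conM (diagTerm (N.b (n + 1))) - conM (diagTerm (N.b (n + 1))) * specM) := by
    rw [(h.isCoefficient (n + 1)).specMDeriv_flow, map_sub, map_add, ← mat_eq, hdiag,
      mapCoeff_conM, entries]
  rw [hflow, aux_eq, mapCoeff_add, mul_add, add_mul]
  linear_combination (norm := abel) h.specM_mul_pos_sub n

theorem zeroCurvature_iff (n : ℕ) {T : Alg →ₗ[ℂ] Alg}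
    (hT : ∀ f g, T (f * g) = T f * g + f * T g) :
    mapCoeff T specM - mapCoeff dx (N.aux n) + (specM * N.aux n - N.aux n * specM) = 0 ↔
      (fun i => T (field i)) = (N.entries (n + 1)).flow := by
  have hone : T 1 = 0 := by simpa using hT 1 1
  have hsum :
      mapCoeff T specM - mapCoeff dx (N.aux n) + (specM * N.aux n - N.aux n * specM) =
        mapCoeff T specM - conM (specMDeriv (N.entries (n + 1)).flow) := by
    linear_combination (norm := abel) h.specM_mul_aux_sub n
  rw [hsum, sub_eq_zero, mapCoeff_specM hone, conM_injective.eq_iff, specMDeriv_injective.eq_iff]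

theorem isFlow_iff (n : ℕ) (T : Alg →ₗ[ℂ] Alg) :
    N.IsFlow n T ↔ T = ev (N.entries (n + 1)).flow (h.isCoefficient (n + 1)).typed_flow := by
  have hflow := (h.isCoefficient (n + 1)).typed_flow
  constructor
  · intro hT
    refine derivation_ext hT.leibniz (ev_mul hflow) hT.comm (ev_D hflow) fun i => ?_
    exact (congrFun ((h.zeroCurvature_iff n hT.leibniz).1 hT.zeroCurvature) i).trans
      (ev_field hflow i).symm
  · rintro rfl
    exact ⟨ev_mul hflow, ev_D hflow,
      (h.zeroCurvature_iff n (ev_mul hflow)).2 (funext fun i => ev_field hflow i)⟩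

theorem existsUnique_flow (n : ℕ) : ∃! T, N.IsFlow n T :=
  ⟨_, (h.isFlow_iff n _).2 rfl, fun _ hT => (h.isFlow_iff n _).1 hT⟩

theorem flow_eq {n : ℕ} {T : Alg →ₗ[ℂ] Alg} (hT : N.IsFlow n T) :
    (fun i => T (field i)) = (N.entries (n + 1)).flow :=
  (h.zeroCurvature_iff n hT.leibniz).1 hT.zeroCurvature

end IsSolution

end Coeffs

/-! ### The bi-Hamiltonian form -/

theorem act_J (G : Fin 4 → Alg) : act J G =
    ![-dx (G 1), -dx (G 0) - (1 / 2 : ℂ) • (fα * G 2) + (1 / 2 : ℂ) • (fβ * G 3),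
      -((1 / 2 : ℂ) • (fα * G 1)) - (1 / 2 : ℂ) • G 3,
      (1 / 2 : ℂ) • (fβ * G 1) - (1 / 2 : ℂ) • G 2] := by
  simpa [pencilAct] using act_pencil 1 0 G

theorem act_R (G : Fin 4 → Alg) : act R G = pencilAct 0 1 G := by
  simpa using act_pencil 0 1 G

theorem act_recLocal (G : Fin 4 → Alg) : act (recLocal (Algebra.lmul ℂ Alg) dx) G =
    ![(1 / 2 : ℂ) • dx (G 0) + ((1 / 2 : ℂ) • (fw * G 1) + G 1) + (1 / 4 : ℂ) • (fα * G 2) -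
        (1 / 4 : ℂ) • (fβ * G 3),
      2 * G 0 + (-((1 / 2 : ℂ) • dx (G 1)) + (1 / 2 : ℂ) • (fv * G 1)) + fα * G 3,
      2 * (fβ * G 0) - 2 * (fα * dx (G 0)) - 2 * (fα * ((fw + 1) * G 1)) + dx (G 2) +
        (1 / 2 : ℂ) • (fv * G 2) + (fα * (fβ * G 3) - 2 * (fw * G 3) - 2 * G 3),
      -(2 * (fα * G 0)) + fβ * G 1 - G 2 + (-dx (G 3) + (1 / 2 : ℂ) • (fv * G 3))] := by
  funext i
  fin_cases i <;>
    simp [act, recLocal, Fin.sum_univ_four, two_mul, add_mul, mul_add] <;> module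

theorem sum_recRow (G : Fin 4 → Alg) : ∑ j, recRow (Algebra.lmul ℂ Alg) dx j (G j) =
    (1 / 2 : ℂ) • (fv * dx (G 0)) + (1 / 2 : ℂ) • (fw * dx (G 1)) -
      (1 / 2 : ℂ) • (fα * dx (G 2)) - (1 / 2 : ℂ) • (fβ * dx (G 3)) := by
  simp [recRow, Fin.sum_univ_four]
  module

/-- The values of `𝓛 G` differ by constants in the first entry, which `J` annihilates. -/
theorem RecursionRel.act_J_eq {G G₁ G₂ : Fin 4 → Alg} (h₁ : RecursionRel G G₁)
    (h₂ : RecursionRel G G₂) : act J G₁ = act J G₂ := by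
  obtain ⟨s₁, hs₁, rfl⟩ := h₁
  obtain ⟨s₂, hs₂, rfl⟩ := h₂
  simp [act_J, hs₁, hs₂]

namespace Entries

variable {p : Entries Alg} {a : Alg}

/-- The column `G = (a, -2 b, -2 δ, 2 ρ)`, the gradient of a Hamiltonian of the hierarchy. -/
def vec (p : Entries Alg) : Fin 4 → Alg := ![p.a, -(2 * p.b), -(2 * p.δ), 2 * p.ρ]

theorem act_J_vec (p : Entries Alg) : act J p.vec = p.flow := by
  rw [act_J]
  funext i
  fin_cases i <;> simp [vec, flow, two_mul, mul_add] <;> module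

theorem IsCoefficient.act_R_vec (h : p.IsCoefficient) (hnext : (p.next a).IsCoefficient) :
    act R p.vec = (p.next a).flow := by
  have hk := h.forall₂_hasKind_dx
  have hdx := hnext.dx_a
  simp only [next] at hdx
  rw [act_R, pencilAct]
  simp only [zero_smul, zero_add, one_smul, flow, vec, next, Matrix.cons_val, hdx]
  funext i
  fin_cases i
  · simp only [Matrix.cons_val, Fin.zero_eta, Fin.isValue]
    exact eq_of_check (isEvenDer_D oddField) _ _ hk (by decide +kernel)
  all_goals
    simp only [Matrix.cons_val, Fin.mk_one, Fin.reduceFinMk, Fin.isValue, h.dx_a]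
    exact eq_of_check (isEvenDer_D oddField) _ _ hk (by decide +kernel)

theorem IsCoefficient.recursionRel (h : p.IsCoefficient) (hnext : (p.next a).IsCoefficient) :
    RecursionRel p.vec (p.next a).vec := by
  have hk := h.forall₂_hasKind_dx
  have hdx := hnext.dx_a
  simp only [next] at hdx
  refine ⟨a - act (recLocal (Algebra.lmul ℂ Alg) dx) p.vec 0, ?_, ?_⟩
  · rw [sum_recRow, act_recLocal, map_sub]
    simp only [vec, Matrix.cons_val, hdx, h.dx_a]
    exact eq_of_check (isEvenDer_D oddField) _ _ hk (by decide +kernel)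
  · rw [act_recLocal]
    funext i
    fin_cases i
    · simp [vec, next]
    all_goals
      simp only [Pi.add_apply, Matrix.cons_val, Fin.mk_one, Fin.reduceFinMk, Fin.isValue, vec, next,
        add_zero, h.dx_a]
      exact eq_of_check (isEvenDer_D oddField) _ _ hk (by decide +kernel)

end Entries

theorem Coeffs.IsSolution.biHamiltonianForm {N : Coeffs} {k₀ : ℂ} (h : N.IsSolution k₀) {n : ℕ}
    {T : Alg →ₗ[ℂ] Alg} (hT : N.IsFlow n T) {h₀ h₁ : Alg} (hgrad₀ : grad h₀ = N.vec n)
    (hgrad₁ : grad h₁ = N.vec (n + 1)) : BiHamiltonianForm T h₀ h₁ := by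
  have hnext := h.isCoefficient (n + 1)
  rw [h.entries_succ] at hnext
  have hvec : N.vec (n + 1) = ((N.entries n).next (N.a (n + 1))).vec := by
    rw [← h.entries_succ]
    rfl
  have hrec : RecursionRel (grad h₀) (grad h₁) := by
    rw [hgrad₀, hgrad₁, hvec]
    exact (h.isCoefficient n).recursionRel hnext
  have hfirst : (fun i => T (field i)) = act J (grad h₁) := by
    rw [h.flow_eq hT, hgrad₁, ← Entries.act_J_vec]
    rfl
  refine ⟨hfirst, hrec, fun G hG => hfirst.trans (hrec.act_J_eq hG), ?_⟩
  rw [h.flow_eq hT, h.entries_succ, hgrad₀]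
  exact ((h.isCoefficient n).act_R_vec hnext).symm

/-! ### Other integration constants -/

theorem grad_sum {κ : Type*} (s : Finset κ) (F : κ → Alg) :
    grad (∑ j ∈ s, F j) = ∑ j ∈ s, grad (F j) :=
  map_sum (AddMonoidHom.mk' grad grad_add) F s

theorem cmap_scal_mul (T : Alg →ₗ[ℂ] Alg) (f : PowerSeries ℂ) (x : PS) :
    cmap T (scal f * x) = scal f * cmap T x := by
  ext m
  simp only [coeff_cmap, coeff_scal_mul, map_sum, map_smul]

/-- The variational derivative with respect to `v`. -/
def gradV : Alg →ₗ[ℂ] Alg where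
  toFun h := grad h 0
  map_add' f g := congrFun (grad_add f g) 0
  map_smul' c f := congrFun (grad_smul c f) 0

namespace Coeffs

variable {N N' : Coeffs} {k₀ : ℂ} {f : PowerSeries ℂ}

theorem entries_eq_sum (hN' : N'.series = N.series.map (scal f * ·)) (m : ℕ) : N'.entries m =
    ⟨∑ j ∈ Finset.range (m + 1), coeff j f • N.a (m - j),
      ∑ j ∈ Finset.range (m + 1), coeff j f • N.b (m - j),
      ∑ j ∈ Finset.range (m + 1), coeff j f • N.g (m - j),
      ∑ j ∈ Finset.range (m + 1), coeff j f • N.ρ (m - j),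
      ∑ j ∈ Finset.range (m + 1), coeff j f • N.δ (m - j)⟩ := by
  rw [← coeffs_series, hN']
  simp only [Entries.coeffs, Entries.map, coeff_scal_mul, series, Entries.series,
    PowerSeries.coeff_mk, entries]

theorem vec_eq_sum (hN' : N'.series = N.series.map (scal f * ·)) (m : ℕ) :
    N'.vec m = ∑ j ∈ Finset.range (m + 1), coeff j f • N.vec (m - j) := by
  change (N'.entries m).vec = _
  rw [entries_eq_sum hN']
  funext i
  rw [Finset.sum_apply]
  fin_cases i <;>
    simp only [Entries.vec, vec, Pi.smul_apply, Matrix.cons_val, Fin.zero_eta, Fin.mk_one,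
      Fin.reduceFinMk, Fin.isValue, Finset.mul_sum, mul_smul_comm, smul_neg, Finset.sum_neg_distrib]

theorem mat_eq_sum (hN' : N'.series = N.series.map (scal f * ·)) (m : ℕ) :
    N'.mat m = ∑ j ∈ Finset.range (m + 1), coeff j f • N.mat (m - j) := by
  simp only [mat_eq, entries_eq_sum hN']
  ext1 i j
  rw [Matrix.sum_apply]
  fin_cases i <;> fin_cases j <;>
    simp only [Entries.mat, entries, Matrix.smul_apply, Matrix.of_apply, Matrix.cons_val,
      Fin.zero_eta, Fin.mk_one, Fin.reduceFinMk, Fin.isValue, smul_neg, smul_zero,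
      Finset.sum_neg_distrib, Finset.sum_const_zero]

theorem two_smul_cmap_gradV (hk₀ : k₀ ≠ 0) (h : N.IsSolution k₀) (hn : N.IsNormalized k₀) :
    (2 : ℂ) • cmap gradV N.series.a = X * zder N.series.a := by
  ext m
  rw [PowerSeries.coeff_smul, coeff_cmap]
  cases m with
  | zero =>
    rw [h.coeff_zero_a, PowerSeries.coeff_zero_X_mul]
    exact (congrArg _ (euler_algebraMap 0 k₀)).trans (smul_zero _)
  | succ m =>
    have ha : ∀ m, coeff m N.series.a = N.a m := fun m => congrArg Entries.a (N.coeffs_series m)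
    rw [PowerSeries.coeff_succ_X_mul, coeff_zder, ha, ha]
    exact congrFun (two_smul_grad_a hk₀ h hn m) 0

/-- With `z d/dz` denoted by a prime, the variational derivative of `f a` with respect to `v` is
`½ z f a'` since `f` is constant, but it is `½ z (f a)'` by assumption, so that `f' a = 0`. -/
theorem IsSolution.factor_eq_one (hk₀ : k₀ ≠ 0) (h : N.IsSolution k₀) (hn : N.IsNormalized k₀)
    (hf : coeff 0 f = 1) (hN' : N'.series = N.series.map (scal f * ·))
    (hgrad : ∀ n, grad (N'.ham k₀ n) = N'.vec n) : f = 1 := by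
  have ha' : scal f * N.series.a = N'.series.a := (congrArg Entries.a hN').symm
  have coeff_a' : ∀ m, coeff m N'.series.a = N'.a m := fun m =>
    congrArg Entries.a (N'.coeffs_series m)
  have hvar : (2 : ℂ) • cmap gradV N'.series.a = X * (scal f * zder N.series.a) := by
    rw [← ha', cmap_scal_mul, ← mul_smul_comm, two_smul_cmap_gradV hk₀ h hn, ← mul_assoc,
      ← mul_assoc, comm_of_even _ _ hasKind_X.1]
  have hzder : zder (scal f) * N.series.a = 0 := by
    ext m
    rcases eq_or_ne m 0 with rfl | hm
    · rw [PowerSeries.coeff_mul]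
      simp
    · have hm' : (2 : ℂ) • gradV (N'.a (m + 1)) = (m : ℂ) • N'.a m := by
        have hham := congrFun (hgrad m) 0
        rw [ham, if_neg hm, grad_smul, div_eq_mul_inv, mul_comm, mul_smul] at hham
        exact (inv_smul_eq_iff₀ (Nat.cast_ne_zero.2 hm)).1 hham
      have hcoeff := congrArg (coeff (m + 1)) hvar
      rw [PowerSeries.coeff_smul, coeff_cmap, coeff_a', hm', PowerSeries.coeff_succ_X_mul,
        ← coeff_a', ← coeff_zder, ← ha', isEvenDer_zder.leibniz, map_add] at hcoeff
      simpa using hcoeff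
  have hzero := (isUnit_of_coeff_zero hk₀ h.coeff_zero_a).mul_left_eq_zero.1 hzder
  ext m
  rcases eq_or_ne m 0 with rfl | hm
  · simpa using hf
  · have hcoeff := congrArg (coeff m) hzero
    rw [coeff_zder, PowerSeries.coeff_map, map_zero, smul_eq_zero] at hcoeff
    rw [PowerSeries.coeff_one, if_neg hm]
    exact (map_eq_zero_iff _ algebraMap_injective).1
      (hcoeff.resolve_left (Nat.cast_ne_zero.2 hm))

end Coeffs

theorem hierarchy_of_factor {N N' : Coeffs} {k₀ : ℂ} (hk₀ : k₀ ≠ 0)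
    (h : N.IsSolution k₀) (hn : N.IsNormalized k₀) (h' : N'.IsSolution k₀) :
    ((∀ n, grad (N'.ham k₀ n) = N'.vec n) ↔ N'.IsNormalized k₀) ∧
      ∃ f : ℕ → ℂ, f 0 = 1 ∧
        (∀ m, N'.mat m = ∑ j ∈ Finset.range (m + 1), f j • N.mat (m - j)) ∧
        ∀ n : ℕ, grad (∑ j ∈ Finset.range (n + 1), f j • N.ham k₀ (n - j)) = N'.vec n ∧
          (∃! T, N'.IsFlow n T) ∧
          ∀ T, N'.IsFlow n T →
            BiHamiltonianForm T (∑ j ∈ Finset.range (n + 1), f j • N.ham k₀ (n - j))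
              (∑ j ∈ Finset.range (n + 2), f j • N.ham k₀ (n + 1 - j)) := by
  obtain ⟨f, hf, hN'⟩ :=
    h.isStationary.exists_eq_map_scal hk₀ h'.isStationary h.coeff_zero_a h'.coeff_zero_a
  have hgrad : ∀ n, grad (∑ j ∈ Finset.range (n + 1), coeff j f • N.ham k₀ (n - j)) =
      N'.vec n := fun n => by
    simp only [grad_sum, Coeffs.vec_eq_sum hN', grad_smul, grad_ham hk₀ h hn]
  refine ⟨⟨fun hN => ?_, fun hN => grad_ham hk₀ h' hN⟩, fun j => coeff j f, hf,
    Coeffs.mat_eq_sum hN', fun n => ⟨hgrad n, h'.existsUnique_flow n, fun T hT => ?_⟩⟩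
  · exact (h.isNormalized_iff_eq_one hk₀ hn h' hf hN').2 (h.factor_eq_one hk₀ hn hf hN' hN)
  · exact h'.biHamiltonianForm hT (hgrad n) (hgrad (n + 1))

end

end SuperGBK

open SuperGBK in
theorem mainTheorem2 (k₀ : ℂ) (hk₀ : k₀ ≠ 0) :
    -- `R = J𝓛` in every algebra of operators with `∂ f = f ∂ + f_x` and an inverse of `∂`
    (∀ (E : Type) [Ring E] [Algebra ℂ E] (mul : Alg →ₐ[ℂ] E) (d dinv : E),
      (∀ f, d * mul f = mul f * d + mul (dx f)) → d * dinv = 1 → dinv * d = 1 →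
        opJ mul d * opL mul d dinv = opR mul d) ∧
    -- `J` and `R` form a pair of compatible super-Hamiltonian operators
    (∀ c₁ c₂ : ℂ, IsSuperHamiltonian (c₁ • J + c₂ • R)) ∧
    -- integration constants with `Str N²` independent of `λ` exist and are unique
    (∃! N : Coeffs, N.IsSolution k₀ ∧ N.IsNormalized k₀) ∧
    ∀ N : Coeffs, N.IsSolution k₀ → N.IsNormalized k₀ →
      -- the super-trace identity with `γ = 0`
      (∀ (i : Fin 4) (m : ℤ),
        JetAlg.euler oddField i ((str (N.ser * specM.map dlam)).coeff m) =
          (dlam (str (N.ser * mapCoeff (JetAlg.pd oddField (i, 0)) specM))).coeff m) ∧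
      -- the Hamiltonians and the hierarchy
      (∀ n : ℕ, grad (N.ham k₀ n) = N.vec n ∧
        (∃! T, N.IsFlow n T) ∧
        ∀ T, N.IsFlow n T →
          (fun i => T (field i)) =
            ![2 * dx (N.b (n + 1)),
              -dx (N.a (n + 1)) + fα * N.δ (n + 1) + fβ * N.ρ (n + 1),
              fα * N.b (n + 1) - N.ρ (n + 1),
              -(fβ * N.b (n + 1)) + N.δ (n + 1)] ∧
          BiHamiltonianForm T (N.ham k₀ n) (N.ham k₀ (n + 1))) ∧
      -- all other choices of the integration constants
      (∀ N' : Coeffs, N'.IsSolution k₀ →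
        ((∀ n, grad (N'.ham k₀ n) = N'.vec n) ↔ N'.IsNormalized k₀) ∧
        ∃ f : ℕ → ℂ, f 0 = 1 ∧
          (∀ m, N'.mat m = ∑ j ∈ Finset.range (m + 1), f j • N.mat (m - j)) ∧
          ∀ n : ℕ, grad (∑ j ∈ Finset.range (n + 1), f j • N.ham k₀ (n - j)) = N'.vec n ∧
            (∃! T, N'.IsFlow n T) ∧
            ∀ T, N'.IsFlow n T →
              BiHamiltonianForm T (∑ j ∈ Finset.range (n + 1), f j • N.ham k₀ (n - j))
                (∑ j ∈ Finset.range (n + 2), f j • N.ham k₀ (n + 1 - j))) := by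
  refine ⟨fun E _ _ mul d dinv hd h₁ _ => ?_, isSuperHamiltonian_pencil,
    existsUnique_normalized hk₀, fun N h hn => ⟨supertrace_identity hk₀ h hn, fun n => ?_,
      fun N' h' => hierarchy_of_factor hk₀ h hn h'⟩⟩
  · exact opJ_mul_opL mul d dinv hd h₁
  · exact ⟨grad_ham hk₀ h hn n, h.existsUnique_flow n, fun T hT => ⟨h.flow_eq hT,
      h.biHamiltonianForm hT (grad_ham hk₀ h hn n) (grad_ham hk₀ h hn (n + 1))⟩⟩
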